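/- Write points of $\mathbb{R}^3$ as $x=(x_h,x_3)$ with $x_h=(x_1,x_2)\in\mathbb{R}^2$, and let $\nabla^h b=(\partial_1 b,\partial_2 b)$. For a function $f$ on $\mathbb{R}^d$ which is a tempered distribution and whose Fourier transform $\widehat f$ is a locally integrable function, put $$\|f\|_{\dot H^{1/2}(\mathbb{R}^d)}=\Bigl(\int_{\mathbb{R}^d}|\xi|\,|\widehat f(\xi)|^2\,d\xi\Bigr)^{1/2}\in[0,\infty],$$ and put $\|f\|_{\dot H^{1/2}(\mathbb{R}^d)}=\infty$ for every other $f$. For functions on $\mathbb{R}^3$ put $$\|F\|_{L^\infty_v(L^2_h)}=\operatorname*{ess\,sup}_{x_3\in\mathbb{R}}\|F(\cdot,x_3)\|_{L^2(\mathbb{R}^2)},\qquad \|f\|_{L^2_v(\dot H^{1/2}_h)}=\Bigl(\int_{\mathbb{R}}\|f(\cdot,x_3)\|_{\dot H^{1/2}(\mathbb{R}^2)}^2\,dx_3\Bigr)^{1/2}.$$ There is an absolute constant $C$ such that, for all complex-valued $C^\infty$ functions $a$ and $b$ on $\mathbb{R}^3$, $$\|ab\|_{\dot H^{1/2}(\mathbb{R}^3)}\le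 C\,\|a\|_{\dot H^{1/2}(\mathbb{R}^3)}\Bigl(\|\nabla^h b\|_{L^\infty_v(L^2_h)}+\|b\|_{L^\infty(\mathbb{R}^3)}+\|\partial_3 b\|_{L^2_v(\dot H^{1/2}_h)}\Bigr).$$ The inequality holds in $[0,\infty]$, with the convention $0\cdot\infty=0$; in particular $ab\in\dot H^{1/2}(\mathbb{R}^3)$ whenever $\|a\|_{\dot H^{1/2}(\mathbb{R}^3)}$ and the three norms of $b$ are finite. -/

import Mathlib

open MeasureTheory
open scoped ENNReal NNReal SchwartzMap FourierTransform

noncomputable section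

/-- The Euclidean space `ℝ^d`. -/
abbrev RSpace (d : ℕ) : Type := EuclideanSpace ℝ (Fin d)

/-- The tempered distribution `T` on `ℝ^d` is (given by) the locally integrable function `f`:
`⟨T, φ⟩ = ∫ φ f` for every smooth compactly supported test function `φ`. -/
def IsGivenBy {d : ℕ} (T : 𝓢'(RSpace d, ℂ)) (f : RSpace d → ℂ) : Prop :=
  LocallyIntegrable f volume ∧
    ∀ φ : 𝓢(RSpace d, ℂ), HasCompactSupport (φ : RSpace d → ℂ) → T φ = ∫ x, φ x * f x

/-- The homogeneous Sobolev norm `‖f‖_{Ḣ^s(ℝ^d)} ∈ [0, ∞]` of a function `f` on `ℝ^d`.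
If `f` is (as a distribution) a tempered distribution `T` whose Fourier transform is a locally
integrable function `g`, it is the `L²` norm of `|ξ|^s g(ξ)`; otherwise it is `∞`.
(`T` is determined by `f`, and `g` is determined almost everywhere, so that the infimum is taken
over at most one value.)  The Fourier transform is normalized with the kernel `e^{-2πi x·ξ}`. -/
def homSobolevNorm {d : ℕ} (s : ℝ) (f : RSpace d → ℂ) : ℝ≥0∞ :=
  ⨅ (T : 𝓢'(RSpace d, ℂ)) (g : RSpace d → ℂ) (_ : IsGivenBy T f) (_ : IsGivenBy (𝓕 T) g),
    eLpNorm (fun ξ => ((‖ξ‖ ^ s : ℝ) : ℂ) * g ξ) 2 volume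

/-- The point `(x_h, x_3)` of `ℝ³` with horizontal part `x_h = (x_1, x_2)` and height `x_3`. -/
def joinHV (xh : RSpace 2) (x3 : ℝ) : RSpace 3 := !₂[xh 0, xh 1, x3]

/-- The norm of `L^q_v X_h = L^q(ℝ_{x_3}; X(ℝ²))`, where `N` is the norm of the space `X(ℝ²)`:
the `L^q` norm of `x_3 ↦ N (f(·, x_3))`. -/
def vertHorNorm {F : Type*} (q : ℝ≥0∞) (N : (RSpace 2 → F) → ℝ≥0∞) (f : RSpace 3 → F) : ℝ≥0∞ :=
  eLpNorm (fun x3 : ℝ => N (fun xh => f (joinHV xh x3))) q volume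

/-- The partial derivative of `f` in the `i`-th coordinate of `ℝ³` (`i = 0, 1, 2`). -/
def partialDeriv3 (i : Fin 3) (f : RSpace 3 → ℂ) (x : RSpace 3) : ℂ :=
  fderiv ℝ f x (EuclideanSpace.single i 1)

/-- The horizontal gradient `∇^h f = (∂_1 f, ∂_2 f)`. -/
def horGrad (f : RSpace 3 → ℂ) (x : RSpace 3) : EuclideanSpace ℂ (Fin 2) :=
  !₂[partialDeriv3 0 f x, partialDeriv3 1 f x]

end

open MeasureTheory
open scoped ENNReal NNReal SchwartzMap FourierTransform

noncomputable section

/-! The square of the `Ḣ^{1/2}` norm is traded for two Gagliardo energies, `gagH` and `gagV`, built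
from horizontal and vertical increments. This works because `∫ |z|^{-(n+1)} |e^{2πi z·ξ} - 1|² dz`
is comparable to `|ξ|` (`exists_lintegral_charDiff_le`, `exists_le_lintegral_charDiff`), while
`|ξ_h|, |ξ_3| ≤ |ξ| ≤ |ξ_h| + |ξ_3|`. An increment of `ab` is `b(x+z) δ_z a(x) + a(x) δ_z b(x)`; the
first term costs `‖b‖_∞²` times the energy of `a`, and only the second needs work.

Horizontally one argues on each slice. Cauchy-Schwarz and the planar embedding of `Ḣ^{1/2}` into
`L⁴` (`exists_lintegral_pow_four_le_gagliardo`) bound `∫ |a|² |δ_z b|²` by the energy of `a` times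
the energy of `δ_z b`. Integrating the latter against `|z|^{-3}` produces the multiplier `|ξ|·|ξ|`,
that is `‖∇^h b‖²` (`exists_lintegral_gagliardo_difference_le`), which is bounded uniformly in
`x_3`.

Vertically, Hardy's inequality on the line (`exists_lintegral_gagKernel_mul_le`) replaces `∫
|t|^{-2} |b(x + t e_3) - b(x)|² dt` by `∫ |∂_3 b(x_h, s)|² ds`, which no longer depends on `x_3`.
Cauchy-Schwarz in `x_h` then separates the heights: the bound is `∫ ‖a(·, y)‖_{L⁴}² dy` times `∫
‖∂_3 b(·, s)‖_{L⁴}² ds`, and the planar embedding controls both factors.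

The energies do not see constants, so they cannot by themselves place `ab` in the space. The missing
information is `VanishesAtInfinity`: it follows from a finite norm and survives multiplication by a
bounded function. With it, finite energies imply a finite norm (`exists_homSobolevNorm_sq_le`): soft
thresholding gives square integrable approximations of no larger energy, and duality with
`L²(|ξ|^{-1} dξ)` passes to the limit. -/

/-! ### The difference symbol and the Gagliardo kernel -/

/-- The symbol `e^{2πit} - 1` of a difference operator. -/
def charDiff (t : ℝ) : ℂ := (Real.fourierChar t : ℂ) - 1

lemma continuous_charDiff : Continuous charDiff := by
  unfold charDiff
  fun_prop

lemma norm_charDiff (t : ℝ) : ‖charDiff t‖ = 2 * |Real.sin (Real.pi * t)| := by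
  have h : charDiff t = Complex.exp (Complex.I * ((2 * Real.pi * t : ℝ) : ℂ)) - 1 := by
    simp only [charDiff, Real.fourierChar_apply]
    rw [mul_comm]
  rw [h, Complex.norm_exp_I_mul_ofReal_sub_one, norm_mul]
  simp only [Real.norm_eq_abs, Nat.abs_ofNat]
  congr 3
  ring

lemma norm_charDiff_sq_le (t : ℝ) : ‖charDiff t‖ ^ 2 ≤ (2 * Real.pi) ^ 2 * min 1 (t ^ 2) := by
  rw [norm_charDiff, mul_pow, mul_pow, mul_assoc]
  refine mul_le_mul_of_nonneg_left ?_ (by positivity)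
  rw [sq_abs, mul_min_of_nonneg _ _ (by positivity), le_min_iff]
  constructor
  · have h1 := Real.sin_sq_le_one (Real.pi * t)
    nlinarith [Real.pi_gt_three]
  · rw [← mul_pow]
    exact Real.sin_sq_le_sq

/-- Near half a turn the symbol is close to `-2`; the margin `1/8` leaves `|sin πt| ≥ 7/8`. -/
lemma one_le_norm_charDiff {t : ℝ} (ht : |t - 1 / 2| ≤ 1 / 8) : 1 ≤ ‖charDiff t‖ := by
  have h : Real.sin (Real.pi * t) = Real.cos (Real.pi * (t - 1 / 2)) := by
    rw [← Real.cos_sub_pi_div_two]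
    congr 1
    ring
  have h2 := Real.one_sub_sq_div_two_le_cos (x := Real.pi * (t - 1 / 2))
  have h3 : (Real.pi * (t - 1 / 2)) ^ 2 ≤ 1 / 4 := by
    rw [← sq_abs, abs_mul, abs_of_pos Real.pi_pos]
    have : Real.pi * |t - 1 / 2| ≤ 1 / 2 := by nlinarith [Real.pi_lt_four, Real.pi_pos]
    have h0 : 0 ≤ Real.pi * |t - 1 / 2| := by positivity
    nlinarith
  rw [norm_charDiff, h]
  have := le_abs_self (Real.cos (Real.pi * (t - 1 / 2)))
  linarith

/-- The kernel `|y|^{-(n+1)}` of the Gagliardo seminorm of order `1/2` in dimension `n`. -/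
def gagKernel {E : Type*} [NormedAddCommGroup E] [NormedSpace ℝ E] (y : E) : ℝ≥0∞ :=
  (‖y‖ₑ ^ (Module.finrank ℝ E + 1))⁻¹

lemma gagKernel_smul {E : Type*} [NormedAddCommGroup E] [NormedSpace ℝ E] {r : ℝ} (hr : 0 < r) (y : E) :
    gagKernel y = ENNReal.ofReal r ^ (Module.finrank ℝ E + 1) * gagKernel (r • y) := by
  have h0 : ENNReal.ofReal r ≠ 0 := by simpa using hr
  have hp : ENNReal.ofReal r ^ (Module.finrank ℝ E + 1) ≠ 0 := pow_ne_zero _ h0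
  have hp' : ENNReal.ofReal r ^ (Module.finrank ℝ E + 1) ≠ ⊤ :=
    ENNReal.pow_ne_top ENNReal.ofReal_ne_top
  unfold gagKernel
  rw [enorm_smul, mul_pow, Real.enorm_of_nonneg hr.le, ENNReal.mul_inv (Or.inl hp) (Or.inl hp'),
    ← mul_assoc, ENNReal.mul_inv_cancel hp hp', one_mul]

section Kernel

variable {E : Type*} [NormedAddCommGroup E] [InnerProductSpace ℝ E] [FiniteDimensional ℝ E]
  [MeasurableSpace E] [BorelSpace E]

@[fun_prop]
lemma measurable_gagKernel : Measurable (gagKernel : E → ℝ≥0∞) := by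
  unfold gagKernel
  fun_prop

lemma lintegral_comp_smul_of_pos (μ : Measure E) [μ.IsAddHaarMeasure] {H : E → ℝ≥0∞}
    (hH : Measurable H) {r : ℝ} (hr : 0 < r) :
    ∫⁻ y, H (r • y) ∂μ = (ENNReal.ofReal r ^ Module.finrank ℝ E)⁻¹ * ∫⁻ y, H y ∂μ := by
  rw [← lintegral_map hH (by fun_prop : Measurable fun y : E => r • y),
    Measure.map_addHaar_smul μ hr.ne', lintegral_smul_measure, abs_of_pos (by positivity),
    ENNReal.ofReal_inv_of_pos (by positivity), ENNReal.ofReal_pow hr.le, smul_eq_mul]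

/-- In polar coordinates the Jacobian cancels all but two powers of the kernel, leaving `min(1,
s²)/s² ≤ 2/(1 + s²)` on the half-line. -/
lemma lintegral_min_mul_gagKernel_lt_top [Nontrivial E] (μ : Measure E) [μ.IsAddHaarMeasure] :
    ∫⁻ y : E, ENNReal.ofReal (min 1 (‖y‖ ^ 2)) * gagKernel y ∂μ < ⊤ := by
  have hint : Integrable (fun y : E =>
      (fun s : ℝ => min 1 (s ^ 2) * (s ^ (Module.finrank ℝ E + 1))⁻¹) ‖y‖) μ := by
    refine (integrable_fun_norm_addHaar (f := fun s : ℝ =>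
      min 1 (s ^ 2) * (s ^ (Module.finrank ℝ E + 1))⁻¹) μ).2 ?_
    refine Integrable.mono' (g := fun s : ℝ => 2 * (1 + s ^ 2)⁻¹)
      (integrable_inv_one_add_sq.const_mul 2).integrableOn
      (by refine Measurable.aestronglyMeasurable ?_; fun_prop) ?_
    filter_upwards [self_mem_ae_restrict measurableSet_Ioi] with s hs
    have hs : 0 < s := hs
    obtain ⟨m, hm⟩ : ∃ m, Module.finrank ℝ E = m + 1 :=
      Nat.exists_eq_succ_of_ne_zero Module.finrank_pos.ne'
    rw [hm, smul_eq_mul, Real.norm_of_nonneg (by positivity)]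
    have h1 : s ^ (m + 1 - 1) * (min 1 (s ^ 2) * (s ^ (m + 1 + 1))⁻¹) = min 1 (s ^ 2) / s ^ 2 := by
      simp only [Nat.add_sub_cancel]
      rw [pow_succ, pow_succ]
      field_simp
      ring
    rw [h1, ← div_eq_mul_inv, div_le_div_iff₀ (by positivity) (by positivity)]
    rcases le_total 1 (s ^ 2) with h | h
    · rw [min_eq_left h]; nlinarith
    · rw [min_eq_right h]; nlinarith [sq_nonneg s]
  refine lt_of_le_of_lt (le_of_eq ?_) hint.lintegral_lt_top
  refine lintegral_congr_ae ?_
  have : ∀ᵐ y : E ∂μ, y ≠ 0 := by simp [ae_iff]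
  filter_upwards [this] with y hy
  have hy' : 0 < ‖y‖ := norm_pos_iff.2 hy
  rw [ENNReal.ofReal_mul (by positivity), ENNReal.ofReal_inv_of_pos (by positivity),
    ENNReal.ofReal_pow hy'.le, ofReal_norm]
  rfl

/-- Since `|e^{2πi y·ξ} - 1|²` is at most a constant times `min(1, |ξ|²|y|²)`, the dilation `y ↦ |ξ|
y` reduces everything to one convergent integral; the kernel contributes `|ξ|^{n+1}` and the volume
`|ξ|^{-n}`. -/
lemma exists_lintegral_charDiff_le [Nontrivial E] (μ : Measure E) [μ.IsAddHaarMeasure] :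
    ∃ C : ℝ≥0, ∀ ξ : E,
      ∫⁻ y, gagKernel y * ‖charDiff (inner ℝ y ξ)‖ₑ ^ 2 ∂μ ≤ C * ‖ξ‖ₑ := by
  set I := ∫⁻ y : E, ENNReal.ofReal (min 1 (‖y‖ ^ 2)) * gagKernel y ∂μ with hI
  have hIt : I ≠ ⊤ := (lintegral_min_mul_gagKernel_lt_top μ).ne
  refine ⟨(ENNReal.ofReal ((2 * Real.pi) ^ 2) * I).toNNReal, fun ξ => ?_⟩
  rw [ENNReal.coe_toNNReal (ENNReal.mul_ne_top ENNReal.ofReal_ne_top hIt)]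
  rcases eq_or_ne ξ 0 with rfl | hξ
  · simp [charDiff]
  have hr : 0 < ‖ξ‖ := norm_pos_iff.2 hξ
  set r := ‖ξ‖ with hrdef
  set n := Module.finrank ℝ E with hn
  have hr0 : ENNReal.ofReal r ≠ 0 := by simpa using hr
  have key : ∀ y : E, gagKernel y * ‖charDiff (inner ℝ y ξ)‖ₑ ^ 2 ≤
      (ENNReal.ofReal ((2 * Real.pi) ^ 2) * ENNReal.ofReal r ^ (n + 1)) *
        (ENNReal.ofReal (min 1 (‖r • y‖ ^ 2)) * gagKernel (r • y)) := by
    intro y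
    rw [gagKernel_smul hr y]
    have h1 : ‖charDiff (inner ℝ y ξ)‖ₑ ^ 2 ≤
        ENNReal.ofReal ((2 * Real.pi) ^ 2) * ENNReal.ofReal (min 1 (‖r • y‖ ^ 2)) := by
      rw [← ENNReal.ofReal_mul (by positivity), ← ofReal_norm, ← ENNReal.ofReal_pow (norm_nonneg _)]
      refine ENNReal.ofReal_le_ofReal ((norm_charDiff_sq_le _).trans ?_)
      refine mul_le_mul_of_nonneg_left (min_le_min le_rfl ?_) (by positivity)
      rw [norm_smul, Real.norm_of_nonneg hr.le, mul_comm]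
      exact sq_le_sq.2 ((abs_real_inner_le_norm _ _).trans (le_abs_self _))
    calc _ ≤ ENNReal.ofReal r ^ (n + 1) * gagKernel (r • y) *
          (ENNReal.ofReal ((2 * Real.pi) ^ 2) * ENNReal.ofReal (min 1 (‖r • y‖ ^ 2))) := by gcongr
      _ = _ := by ring
  calc _ ≤ ∫⁻ y : E, (ENNReal.ofReal ((2 * Real.pi) ^ 2) * ENNReal.ofReal r ^ (n + 1)) *
        (ENNReal.ofReal (min 1 (‖r • y‖ ^ 2)) * gagKernel (r • y)) ∂μ := lintegral_mono key
    _ = (ENNReal.ofReal ((2 * Real.pi) ^ 2) * ENNReal.ofReal r ^ (n + 1)) *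
        ((ENNReal.ofReal r ^ n)⁻¹ * I) := by
      rw [lintegral_const_mul _ (by fun_prop), lintegral_comp_smul_of_pos μ
        (H := fun y : E => ENNReal.ofReal (min 1 (‖y‖ ^ 2)) * gagKernel y) (by fun_prop) hr]
    _ = (ENNReal.ofReal ((2 * Real.pi) ^ 2) * I) * ENNReal.ofReal r *
        (ENNReal.ofReal r ^ n * (ENNReal.ofReal r ^ n)⁻¹) := by ring
    _ = _ := by
      rw [ENNReal.mul_inv_cancel (pow_ne_zero _ hr0) (ENNReal.pow_ne_top ENNReal.ofReal_ne_top),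
        mul_one, ofReal_norm]

/-- It is enough to integrate over the ball of radius `1/(8|ξ|)` about `ξ/(2|ξ|²)`: there `y·ξ` is
within `1/8` of `1/2`, so the symbol is at least `1`, and `|y| ≤ 1/|ξ|`, so the kernel is at least
`|ξ|^{n+1}`. -/
lemma exists_le_lintegral_charDiff (μ : Measure E) [μ.IsAddHaarMeasure] :
    ∃ C : ℝ≥0, ∀ ξ : E,
      ‖ξ‖ₑ ≤ C * ∫⁻ y, gagKernel y * ‖charDiff (inner ℝ y ξ)‖ₑ ^ 2 ∂μ := by
  set n := Module.finrank ℝ E with hn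
  set m : ℝ≥0∞ := (ENNReal.ofReal (1 / 8)) ^ n * μ (Metric.ball 0 1) with hm
  have hm0 : m ≠ 0 := mul_ne_zero (pow_ne_zero _ (by simp)) (Metric.measure_ball_pos _ _ one_pos).ne'
  have hmt : m ≠ ⊤ := ENNReal.mul_ne_top (ENNReal.pow_ne_top ENNReal.ofReal_ne_top)
    measure_ball_lt_top.ne
  refine ⟨m⁻¹.toNNReal, fun ξ => ?_⟩
  rw [ENNReal.coe_toNNReal (ENNReal.inv_ne_top.2 hm0)]
  rcases eq_or_ne ξ 0 with rfl | hξ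
  · simp
  have hr : 0 < ‖ξ‖ := norm_pos_iff.2 hξ
  set r := ‖ξ‖ with hrdef
  have hr0 : ENNReal.ofReal r ≠ 0 := by simpa using hr
  have hrt : ENNReal.ofReal r ≠ ⊤ := ENNReal.ofReal_ne_top
  set y₀ : E := (1 / (2 * r ^ 2)) • ξ with hy₀
  have hin : inner ℝ y₀ ξ = 1 / 2 := by
    rw [hy₀, real_inner_smul_left, real_inner_self_eq_norm_sq, ← hrdef]
    field_simp
  have hny : ‖y₀‖ = 1 / (2 * r) := by
    rw [hy₀, norm_smul, Real.norm_of_nonneg (by positivity), ← hrdef]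
    field_simp
  set B := Metric.ball y₀ (1 / 8 * r⁻¹) with hB
  have key : ∀ y ∈ B, ENNReal.ofReal r ^ (n + 1) ≤
      gagKernel y * ‖charDiff (inner ℝ y ξ)‖ₑ ^ 2 := by
    intro y hy
    have hd : ‖y - y₀‖ ≤ 1 / 8 * r⁻¹ := by
      rw [← dist_eq_norm]; exact (Metric.mem_ball.1 hy).le
    have h1 : (1 : ℝ≥0∞) ≤ ‖charDiff (inner ℝ y ξ)‖ₑ := by
      rw [← ofReal_norm, ← ENNReal.ofReal_one]
      refine ENNReal.ofReal_le_ofReal (one_le_norm_charDiff ?_)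
      rw [← hin, ← inner_sub_left]
      refine (abs_real_inner_le_norm _ _).trans ?_
      calc ‖y - y₀‖ * ‖ξ‖ ≤ (1 / 8 * r⁻¹) * r := by gcongr
        _ = 1 / 8 := by field_simp
    have h2 : ‖y‖ ≤ r⁻¹ := by
      calc ‖y‖ = ‖(y - y₀) + y₀‖ := by simp
        _ ≤ 1 / 8 * r⁻¹ + 1 / (2 * r) := (norm_add_le _ _).trans (by rw [hny]; gcongr)
        _ = 5 / 8 * r⁻¹ := by field_simp; norm_num
        _ ≤ r⁻¹ := by
          have := inv_pos.2 hr
          linarith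
    have h3 : ENNReal.ofReal r ^ (n + 1) ≤ gagKernel y := by
      unfold gagKernel
      rw [ENNReal.inv_pow, ← hn]
      gcongr
      rw [ENNReal.le_inv_iff_le_inv, ← ENNReal.ofReal_inv_of_pos hr, ← ofReal_norm]
      exact ENNReal.ofReal_le_ofReal h2
    calc ENNReal.ofReal r ^ (n + 1) = ENNReal.ofReal r ^ (n + 1) * 1 ^ 2 := by simp
      _ ≤ _ := by gcongr
  have hBm : μ B = m * (ENNReal.ofReal r ^ n)⁻¹ := by
    rw [hB, Measure.addHaar_ball_of_pos _ _ (by positivity), mul_pow,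
      ENNReal.ofReal_mul (by positivity), inv_pow, ENNReal.ofReal_inv_of_pos (by positivity),
      ENNReal.ofReal_pow hr.le, ENNReal.ofReal_pow (by norm_num), hm, ← hn]
    ring
  calc ‖ξ‖ₑ = m⁻¹ * (m * (ENNReal.ofReal r * (ENNReal.ofReal r ^ n * (ENNReal.ofReal r ^ n)⁻¹))) := by
        rw [ENNReal.mul_inv_cancel (pow_ne_zero _ hr0) (ENNReal.pow_ne_top hrt), mul_one, ← mul_assoc,
          ENNReal.inv_mul_cancel hm0 hmt, one_mul, ofReal_norm]
    _ = m⁻¹ * ∫⁻ _ in B, ENNReal.ofReal r ^ (n + 1) ∂μ := by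
        rw [setLIntegral_const, hBm]
        ring
    _ ≤ m⁻¹ * ∫⁻ y in B, gagKernel y * ‖charDiff (inner ℝ y ξ)‖ₑ ^ 2 ∂μ := by
        exact mul_le_mul' le_rfl (setLIntegral_mono' measurableSet_ball key)
    _ ≤ _ := by
        exact mul_le_mul' le_rfl (setLIntegral_le_lintegral _ _)

end Kernel

/-! ### Compactly supported functions in the Schwartz space -/

section Density

open Filter Topology

variable {E : Type*} [NormedAddCommGroup E] [InnerProductSpace ℝ E] [FiniteDimensional ℝ E]

/-- The derivatives of `χ(x/(n+1)) - 1`, for a bump function `χ` equal to `1` on the unit ball, are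
bounded by `B |x| / (n+1)`. -/
lemma exists_norm_iteratedFDeriv_bump_sub_one_le (χ : ContDiffBump (0 : E)) (hχ : χ.rIn = 1)
    (i : ℕ) : ∃ B : ℝ, 0 ≤ B ∧ ∀ (n : ℕ) (x : E),
      ‖iteratedFDeriv ℝ i (fun y : E => χ (((n : ℝ) + 1)⁻¹ • y) - 1) x‖ ≤ B * ‖x‖ / (n + 1) := by
  have hsm : ContDiff ℝ (⊤ : ℕ∞) (fun y : E => χ y - 1) := χ.contDiff.sub contDiff_const
  obtain ⟨B₀, hB₀⟩ : ∃ B₀ : ℝ, ∀ x, ‖iteratedFDeriv ℝ i (fun y : E => χ y - 1) x‖ ≤ B₀ := by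
    obtain ⟨B₁, hB₁⟩ := (χ.hasCompactSupport.iteratedFDeriv (𝕜 := ℝ) i).exists_bound_of_continuous
      (χ.contDiff.continuous_iteratedFDeriv (n := i) (m := i) le_rfl)
    refine ⟨B₁ + 1, fun x => ?_⟩
    have : (fun y : E => χ y - 1) = (fun y : E => χ y) - fun _ => (1 : ℝ) := rfl
    rw [this, iteratedFDeriv_sub (χ.contDiff (n := i)) contDiff_const, Pi.sub_apply]
    refine (norm_sub_le _ _).trans (add_le_add (hB₁ x) ?_)
    rcases Nat.eq_zero_or_pos i with rfl | hi
    · simp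
    · rw [iteratedFDeriv_const_of_ne hi.ne']
      simp
  have hB₀0 : 0 ≤ B₀ := (norm_nonneg _).trans (hB₀ 0)
  refine ⟨B₀, hB₀0, fun n x => ?_⟩
  have hn : (0 : ℝ) < n + 1 := by positivity
  -- Inside the ball of radius `n + 1` the function vanishes near `x`; outside it a plain bound
  -- suffices, because `‖x‖/(n+1) ≥ 1`.
  rcases lt_or_ge ‖x‖ ((n : ℝ) + 1) with hx | hx
  · have : (fun y : E => χ (((n : ℝ) + 1)⁻¹ • y) - 1) =ᶠ[𝓝 x] fun _ => (0 : ℝ) := by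
      filter_upwards [continuous_norm.continuousAt.eventually_lt continuousAt_const hx] with y hy
      rw [χ.one_of_mem_closedBall, sub_self]
      rw [mem_closedBall_zero_iff, hχ, norm_smul, norm_inv, Real.norm_of_nonneg hn.le,
        inv_mul_le_iff₀ hn]
      linarith
    rw [(Filter.EventuallyEq.iteratedFDeriv ℝ this i).eq_of_nhds]
    simp only [iteratedFDeriv_fun_zero, Pi.zero_apply, norm_zero]
    positivity
  · rw [iteratedFDeriv_comp_const_smul (f := fun y : E => χ y - 1) _ (hsm.of_le (by exact_mod_cast le_top))]
    simp only [norm_smul, norm_pow, norm_inv, Real.norm_of_nonneg hn.le]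
    have h1 : (((n : ℝ) + 1)⁻¹) ^ i ≤ 1 := pow_le_one₀ (by positivity) (inv_le_one_of_one_le₀ (by linarith [n.cast_nonneg (α := ℝ)]))
    have h2 : 1 ≤ ‖x‖ / (n + 1) := (one_le_div hn).2 hx
    calc _ ≤ 1 * B₀ := mul_le_mul h1 (hB₀ _) (norm_nonneg _) zero_le_one
      _ ≤ B₀ * (‖x‖ / (n + 1)) := by nlinarith
      _ = _ := by ring

/-- Compactly supported functions are dense in the Schwartz space. -/
theorem SchwartzMap.exists_tendsto_hasCompactSupport (ψ : 𝓢(E, ℂ)) :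
    ∃ φ : ℕ → 𝓢(E, ℂ), (∀ n, HasCompactSupport (φ n : E → ℂ)) ∧ Tendsto φ atTop (𝓝 ψ) := by
  let χ : ContDiffBump (0 : E) := ⟨1, 2, one_pos, one_lt_two⟩
  have hcs : ∀ n : ℕ, HasCompactSupport (fun x : E => χ (((n : ℝ) + 1)⁻¹ • x) • ψ x) := fun n =>
    (χ.hasCompactSupport.comp_homeomorph
      (Homeomorph.smulOfNeZero ((n : ℝ) + 1)⁻¹ (by positivity))).smul_right
  have hsm : ∀ n : ℕ, ContDiff ℝ (⊤ : ℕ∞) (fun x : E => χ (((n : ℝ) + 1)⁻¹ • x) • ψ x) := fun n =>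
    (χ.contDiff.comp (contDiff_const_smul _)).smul (ψ.smooth ⊤)
  refine ⟨fun n => (hcs n).toSchwartzMap (hsm n), fun n => hcs n, ?_⟩
  rw [(schwartz_withSeminorms ℝ E ℂ).tendsto_nhds]
  rintro ⟨k, l⟩ ε hε
  choose B hB0 hB using exists_norm_iteratedFDeriv_bump_sub_one_le χ rfl
  -- The factor `‖x‖/(n+1)` from the cutoff gives the decay in `n`, at the price of one more power
  -- of `‖x‖` in the seminorm of `ψ`.
  set C : ℝ := ∑ i ∈ Finset.range (l + 1), (l.choose i : ℝ) * B i *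
    SchwartzMap.seminorm ℝ (k + 1) (l - i) ψ with hC
  have hC0 : 0 ≤ C := Finset.sum_nonneg fun i _ => by have := hB0 i; positivity
  have hlim : Tendsto (fun n : ℕ => C / ((n : ℝ) + 1)) atTop (𝓝 0) :=
    by simpa [div_eq_mul_inv] using (tendsto_one_div_add_atTop_nhds_zero_nat (𝕜 := ℝ)).const_mul C
  filter_upwards [hlim.eventually_lt_const hε] with n hn
  refine lt_of_le_of_lt ?_ hn
  have hn0 : (0 : ℝ) < n + 1 := by positivity
  refine SchwartzMap.seminorm_le_bound ℝ k l _ (by positivity) fun x => ?_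
  have hfun : ((((hcs n).toSchwartzMap (hsm n)) - ψ : 𝓢(E, ℂ)) : E → ℂ) =
      fun x => (χ (((n : ℝ) + 1)⁻¹ • x) - 1) • ψ x := by
    ext x
    simp [sub_mul]
  rw [hfun]
  have hle := norm_iteratedFDeriv_smul_le (𝕜 := ℝ) (n := l) (N := ((⊤ : ℕ∞) : WithTop ℕ∞))
    (f := fun x : E => χ (((n : ℝ) + 1)⁻¹ • x) - 1) (g := ψ)
    ((χ.contDiff.comp (contDiff_const_smul _)).sub contDiff_const) (ψ.smooth ⊤) x
    (by exact_mod_cast le_top)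
  calc _ ≤ ‖x‖ ^ k * ∑ i ∈ Finset.range (l + 1), (l.choose i : ℝ) *
        ‖iteratedFDeriv ℝ i (fun x : E => χ (((n : ℝ) + 1)⁻¹ • x) - 1) x‖ *
          ‖iteratedFDeriv ℝ (l - i) ψ x‖ := by gcongr
    _ ≤ ‖x‖ ^ k * ∑ i ∈ Finset.range (l + 1), (l.choose i : ℝ) * (B i * ‖x‖ / (n + 1)) *
          ‖iteratedFDeriv ℝ (l - i) ψ x‖ := by
        gcongr with i hi
        exact hB i n x
    _ = ∑ i ∈ Finset.range (l + 1), (l.choose i : ℝ) * B i *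
          (‖x‖ ^ (k + 1) * ‖iteratedFDeriv ℝ (l - i) ψ x‖) / (n + 1) := by
        rw [Finset.mul_sum]
        refine Finset.sum_congr rfl fun i _ => ?_
        ring
    _ ≤ C / (n + 1) := by
        rw [hC, Finset.sum_div]
        gcongr with i hi
        · have := hB0 i; positivity
        · exact SchwartzMap.le_seminorm ℝ (k + 1) (l - i) ψ x

/-- `IsGivenBy` tests only against compactly supported functions; by density and continuity this
already determines the distribution. -/
theorem TemperedDistribution.eq_of_forall_hasCompactSupport {T S : 𝓢'(E, ℂ)}
    (h : ∀ φ : 𝓢(E, ℂ), HasCompactSupport (φ : E → ℂ) → T φ = S φ) : T = S := by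
  ext ψ
  obtain ⟨φ, hφ, hlim⟩ := SchwartzMap.exists_tendsto_hasCompactSupport ψ
  have h1 : Tendsto (fun n => T (φ n)) atTop (𝓝 (T ψ)) := (T.continuous.tendsto _).comp hlim
  have h2 : Tendsto (fun n => S (φ n)) atTop (𝓝 (S ψ)) := (S.continuous.tendsto _).comp hlim
  exact tendsto_nhds_unique h1 (h2.congr fun n => (h _ (hφ n)).symm)

end Density

/-! ### Fourier pairs of functions -/

/-- `g` is the Fourier transform of `f`, tested against Schwartz functions. -/
structure IsFourierPair {d : ℕ} (f g : RSpace d → ℂ) : Prop where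
  locallyIntegrable_left : LocallyIntegrable f volume
  locallyIntegrable_right : LocallyIntegrable g volume
  integrable_left : ∀ ψ : 𝓢(RSpace d, ℂ), Integrable (fun x => ψ x * f x)
  integrable_right : ∀ ψ : 𝓢(RSpace d, ℂ), Integrable (fun ξ => ψ ξ * g ξ)
  integral_eq : ∀ ψ : 𝓢(RSpace d, ℂ), ∫ x, (𝓕 ψ) x * f x = ∫ ξ, ψ ξ * g ξ

variable {d : ℕ}

/-- The Schwartz function defined by a smooth compactly supported real function. -/
lemma exists_schwartzMap_eq_ofReal {g : RSpace d → ℝ} (hg : ContDiff ℝ (⊤ : ℕ∞) g)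
    (hc : HasCompactSupport g) :
    ∃ φ : 𝓢(RSpace d, ℂ), HasCompactSupport (φ : RSpace d → ℂ) ∧ ∀ x, φ x = (g x : ℂ) := by
  have h1 : HasCompactSupport (fun x => (g x : ℂ)) := hc.comp_left (g := fun r : ℝ => (r : ℂ)) rfl
  have h2 : ContDiff ℝ (⊤ : ℕ∞) (fun x => (g x : ℂ)) := Complex.ofRealCLM.contDiff.comp hg
  exact ⟨h1.toSchwartzMap h2, h1, fun x => rfl⟩

lemma ae_eq_of_forall_integral_schwartz_eq {f f' : RSpace d → ℂ} (hf : LocallyIntegrable f volume)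
    (hf' : LocallyIntegrable f' volume)
    (h : ∀ φ : 𝓢(RSpace d, ℂ), HasCompactSupport (φ : RSpace d → ℂ) →
      ∫ x, φ x * f x = ∫ x, φ x * f' x) : f =ᵐ[volume] f' := by
  refine ae_eq_of_integral_contDiff_smul_eq hf hf' fun g hg hc => ?_
  obtain ⟨φ, hφ, hφg⟩ := exists_schwartzMap_eq_ofReal hg hc
  simpa only [hφg, Complex.real_smul] using h φ hφ

lemma MeasureTheory.MemLp.integrable_schwartz_mul {p : ℝ≥0∞} (hp : 1 ≤ p) {f : RSpace d → ℂ}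
    (hf : MemLp f p volume) (ψ : 𝓢(RSpace d, ℂ)) : Integrable (fun x => ψ x * f x) := by
  have := ENNReal.HolderConjugate.inv_one_sub_inv' hp
  have : ENNReal.HolderConjugate (1 - p⁻¹)⁻¹ p := ENNReal.HolderTriple.symm
  exact MemLp.integrable_mul (ψ.memLp (1 - p⁻¹)⁻¹ volume) hf

namespace IsFourierPair

lemma ae_eq_left {f f' g : RSpace d → ℂ} (h : IsFourierPair f g) (h' : IsFourierPair f' g) :
    f =ᵐ[volume] f' := by
  refine ae_eq_of_forall_integral_schwartz_eq h.locallyIntegrable_left h'.locallyIntegrable_left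
    fun φ _ => ?_
  have h1 := h.integral_eq (𝓕⁻ φ)
  have h2 := h'.integral_eq (𝓕⁻ φ)
  rw [FourierTransform.fourier_fourierInv_eq] at h1 h2
  rw [h1, h2]

lemma ae_eq_right {f g g' : RSpace d → ℂ} (h : IsFourierPair f g) (h' : IsFourierPair f g') :
    g =ᵐ[volume] g' :=
  ae_eq_of_forall_integral_schwartz_eq h.locallyIntegrable_right h'.locallyIntegrable_right
    fun φ _ => by rw [← h.integral_eq, ← h'.integral_eq]

lemma congr {f f' g g' : RSpace d → ℂ} (h : IsFourierPair f g) (hf : f =ᵐ[volume] f')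
    (hg : g =ᵐ[volume] g') : IsFourierPair f' g' where
  locallyIntegrable_left := h.locallyIntegrable_left.congr hf
  locallyIntegrable_right := h.locallyIntegrable_right.congr hg
  integrable_left ψ := (h.integrable_left ψ).congr (by filter_upwards [hf] with x hx; rw [hx])
  integrable_right ψ := (h.integrable_right ψ).congr (by filter_upwards [hg] with x hx; rw [hx])
  integral_eq ψ := by
    rw [← integral_congr_ae (f := fun x => (𝓕 ψ) x * f x) (by filter_upwards [hf] with x hx; rw [hx]),
      h.integral_eq, integral_congr_ae]
    filter_upwards [hg] with x hx
    rw [hx]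

lemma add {f f' g g' : RSpace d → ℂ} (h : IsFourierPair f g) (h' : IsFourierPair f' g') :
    IsFourierPair (fun x => f x + f' x) (fun x => g x + g' x) where
  locallyIntegrable_left := h.locallyIntegrable_left.add h'.locallyIntegrable_left
  locallyIntegrable_right := h.locallyIntegrable_right.add h'.locallyIntegrable_right
  integrable_left ψ := by
    simp only [mul_add]
    exact (h.integrable_left ψ).add (h'.integrable_left ψ)
  integrable_right ψ := by
    simp only [mul_add]
    exact (h.integrable_right ψ).add (h'.integrable_right ψ)
  integral_eq ψ := by
    simp only [mul_add]
    rw [integral_add (h.integrable_left _) (h'.integrable_left _),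
      integral_add (h.integrable_right _) (h'.integrable_right _), h.integral_eq, h'.integral_eq]

lemma sub {f f' g g' : RSpace d → ℂ} (h : IsFourierPair f g) (h' : IsFourierPair f' g') :
    IsFourierPair (fun x => f x - f' x) (fun x => g x - g' x) where
  locallyIntegrable_left := h.locallyIntegrable_left.sub h'.locallyIntegrable_left
  locallyIntegrable_right := h.locallyIntegrable_right.sub h'.locallyIntegrable_right
  integrable_left ψ := by
    simp only [mul_sub]
    exact (h.integrable_left ψ).sub (h'.integrable_left ψ)
  integrable_right ψ := by
    simp only [mul_sub]
    exact (h.integrable_right ψ).sub (h'.integrable_right ψ)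
  integral_eq ψ := by
    simp only [mul_sub]
    rw [integral_sub (h.integrable_left _) (h'.integrable_left _),
      integral_sub (h.integrable_right _) (h'.integrable_right _), h.integral_eq, h'.integral_eq]

end IsFourierPair

/-- Square integrable functions have a square integrable Fourier transform of the same norm. -/
theorem exists_isFourierPair_of_memLp {f : RSpace d → ℂ} (hf : MemLp f 2 volume) :
    ∃ g, MemLp g 2 volume ∧ IsFourierPair f g ∧ eLpNorm g 2 volume = eLpNorm f 2 volume := by
  set F : Lp ℂ 2 (volume : Measure (RSpace d)) := hf.toLp f with hF
  have hg : MemLp (𝓕 F : Lp ℂ 2 (volume : Measure (RSpace d))) 2 volume := Lp.memLp _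
  refine ⟨(𝓕 F : Lp ℂ 2 (volume : Measure (RSpace d))), hg, ⟨hf.locallyIntegrable (by norm_num),
    hg.locallyIntegrable (by norm_num), hf.integrable_schwartz_mul (by norm_num),
    hg.integrable_schwartz_mul (by norm_num), fun ψ => ?_⟩, ?_⟩
  · have h := congrArg (fun T : 𝓢'(RSpace d, ℂ) => T ψ) (Lp.fourier_toTemperedDistribution_eq F)
    simp only [TemperedDistribution.fourier_apply, Lp.toTemperedDistribution_apply, smul_eq_mul] at h
    rw [← h]
    refine integral_congr_ae ?_
    filter_upwards [hf.coeFn_toLp] with x hx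
    rw [hF, hx]
  · have h := Lp.norm_fourier_eq F
    rw [Lp.norm_def, Lp.norm_def, ENNReal.toReal_eq_toReal_iff' (Lp.eLpNorm_ne_top _)
      (Lp.eLpNorm_ne_top _)] at h
    rw [h]
    exact eLpNorm_congr_ae hf.coeFn_toLp

theorem exists_isFourierPair_of_memLp_right {g : RSpace d → ℂ} (hg : MemLp g 2 volume) :
    ∃ f, MemLp f 2 volume ∧ IsFourierPair f g := by
  set G : Lp ℂ 2 (volume : Measure (RSpace d)) := hg.toLp g with hG
  set F : Lp ℂ 2 (volume : Measure (RSpace d)) := 𝓕⁻ G with hF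
  have hf : MemLp F 2 volume := Lp.memLp _
  refine ⟨F, hf, ⟨hf.locallyIntegrable (by norm_num),
    hg.locallyIntegrable (by norm_num), hf.integrable_schwartz_mul (by norm_num),
    hg.integrable_schwartz_mul (by norm_num), fun ψ => ?_⟩⟩
  have h := congrArg (fun T : 𝓢'(RSpace d, ℂ) => T ψ) (Lp.fourier_toTemperedDistribution_eq F)
  rw [hF, FourierTransform.fourier_fourierInv_eq] at h
  simp only [TemperedDistribution.fourier_apply, Lp.toTemperedDistribution_apply, smul_eq_mul] at h
  rw [h]
  refine integral_congr_ae ?_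
  filter_upwards [hg.coeFn_toLp] with x hx
  rw [hG, hx]

/-- Plancherel's theorem. -/
theorem IsFourierPair.eLpNorm_eq {f g : RSpace d → ℂ} (h : IsFourierPair f g)
    (hg : MemLp g 2 volume) : eLpNorm f 2 volume = eLpNorm g 2 volume := by
  -- `f` is not assumed square integrable; uniqueness identifies it with the `L²` inverse transform
  -- of `g`.
  obtain ⟨f', hf', hp⟩ := exists_isFourierPair_of_memLp_right hg
  obtain ⟨g', hg', hp', hn⟩ := exists_isFourierPair_of_memLp hf'
  rw [eLpNorm_congr_ae (h.ae_eq_left hp), ← hn, eLpNorm_congr_ae (hp.ae_eq_right hp')]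

lemma IsFourierPair.memLp_left {f g : RSpace d → ℂ} (h : IsFourierPair f g)
    (hg : MemLp g 2 volume) : MemLp f 2 volume := by
  obtain ⟨f', hf', hp⟩ := exists_isFourierPair_of_memLp_right hg
  exact hf'.ae_eq (hp.ae_eq_left h)

lemma IsFourierPair.memLp_right {f g : RSpace d → ℂ} (h : IsFourierPair f g)
    (hf : MemLp f 2 volume) : MemLp g 2 volume := by
  obtain ⟨g', hg', hp', -⟩ := exists_isFourierPair_of_memLp hf
  exact hg'.ae_eq (hp'.ae_eq_right h)

lemma IsFourierPair.lintegral_eq {f g : RSpace d → ℂ} (h : IsFourierPair f g)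
    (hg : MemLp g 2 volume) : ∫⁻ x, ‖f x‖ₑ ^ 2 = ∫⁻ ξ, ‖g ξ‖ₑ ^ 2 := by
  have h2 := h.eLpNorm_eq hg
  simp only [eLpNorm_eq_lintegral_rpow_enorm_toReal (p := 2) (by norm_num) (by norm_num)] at h2
  have h3 := congrArg (fun x : ℝ≥0∞ => x ^ (2 : ℝ)) h2
  simp only [ENNReal.toReal_ofNat, one_div] at h3
  rw [ENNReal.rpow_inv_rpow (by norm_num), ENNReal.rpow_inv_rpow (by norm_num)] at h3
  simpa only [ENNReal.rpow_two] using h3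

/-- Integrable functions are Fourier transforms of bounded functions. -/
theorem exists_isFourierPair_of_integrable_right {g : RSpace d → ℂ} (hg : Integrable g) :
    ∃ f, IsFourierPair f g ∧ ∀ x, ‖f x‖ₑ ≤ ∫⁻ ξ, ‖g ξ‖ₑ := by
  have hcont : Continuous (𝓕⁻ g) := by
    have : (𝓕⁻ g) = fun x => 𝓕 g (-x) := by
      ext x; rw [Real.fourierInv_eq_fourier_neg]
    rw [this]
    exact (VectorFourier.fourierIntegral_continuous Real.continuous_fourierChar
      (by exact continuous_inner) hg).comp continuous_neg
  have hbound : ∀ x, ‖𝓕⁻ g x‖ₑ ≤ ∫⁻ ξ, ‖g ξ‖ₑ := fun x => by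
    rw [Real.fourierInv_eq]
    refine (enorm_integral_le_lintegral_enorm _).trans (le_of_eq ?_)
    refine lintegral_congr fun ξ => ?_
    rw [← ofReal_norm, Circle.norm_smul, ofReal_norm]
  have hmem : MemLp (𝓕⁻ g) ⊤ volume := memLp_top_of_bound hcont.aestronglyMeasurable
    (∫⁻ ξ, ‖g ξ‖ₑ).toReal (Filter.Eventually.of_forall fun x => by
      rw [← ENNReal.ofReal_le_ofReal_iff ENNReal.toReal_nonneg, ofReal_norm,
        ENNReal.ofReal_toReal hg.2.ne]
      exact hbound x)
  have hg1 : MemLp g 1 volume := memLp_one_iff_integrable.2 hg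
  refine ⟨𝓕⁻ g, ⟨hcont.locallyIntegrable, hg.locallyIntegrable,
    hmem.integrable_schwartz_mul (by norm_num), hg1.integrable_schwartz_mul le_rfl,
    fun ψ => ?_⟩, hbound⟩
  -- With the pairing `-⟨x, ξ⟩` the general Fourier integral is the inverse transform, and this is
  -- its self-adjointness.
  have h1 := VectorFourier.integral_fourierIntegral_smul_eq_flip (𝕜 := ℝ) (μ := volume)
    (ν := volume) (e := Real.fourierChar) (L := -innerₗ (RSpace d))
    (f := ((𝓕 ψ : 𝓢(RSpace d, ℂ)) : RSpace d → ℂ)) (g := g) Real.continuous_fourierChar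
    (continuous_inner.neg) (𝓕 ψ : 𝓢(RSpace d, ℂ)).integrable hg
  have h2 : (-innerₗ (RSpace d)).flip = -innerₗ (RSpace d) := by
    ext x y
    simp [real_inner_comm]
  have h3 : VectorFourier.fourierIntegral Real.fourierChar volume (-innerₗ (RSpace d))
      ((𝓕 ψ : 𝓢(RSpace d, ℂ)) : RSpace d → ℂ) = ψ := by
    change 𝓕⁻ ((𝓕 ψ : 𝓢(RSpace d, ℂ)) : RSpace d → ℂ) = ψ
    rw [← SchwartzMap.fourierInv_coe, FourierTransform.fourierInv_fourier_eq]
  rw [h2, h3] at h1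
  exact h1.symm

lemma LocallyIntegrable.comp_add_right_RSpace {f : RSpace d → ℂ}
    (hf : LocallyIntegrable f volume) (z : RSpace d) :
    LocallyIntegrable (fun x => f (x + z)) volume := by
  have h : LocallyIntegrable f (Measure.map (Homeomorph.addRight z) volume) := by
    have : Measure.map (Homeomorph.addRight z) (volume : Measure (RSpace d)) = volume :=
      (measurePreserving_add_right volume z).map_eq
    rwa [this]
  exact (locallyIntegrable_map_homeomorph (Homeomorph.addRight z)).1 h

/-- Supplies the test function from which the rule "translation of `f` is modulation of `g`" is read
off. -/
lemma fourierInv_compSubConst_fourier_apply (ψ : 𝓢(RSpace d, ℂ)) (z ξ : RSpace d) :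
    (𝓕⁻ ((𝓕 ψ : 𝓢(RSpace d, ℂ)).compSubConstCLM ℂ z) : 𝓢(RSpace d, ℂ)) ξ =
      (Real.fourierChar (inner ℝ z ξ) : ℂ) * ψ ξ := by
  have h1 : ψ ξ = 𝓕⁻ ((𝓕 ψ : 𝓢(RSpace d, ℂ)) : RSpace d → ℂ) ξ := by
    rw [← SchwartzMap.fourierInv_coe, FourierTransform.fourierInv_fourier_eq]
  rw [SchwartzMap.fourierInv_coe, h1, Real.fourierInv_eq, Real.fourierInv_eq,
    ← integral_add_right_eq_self _ z, ← integral_const_mul]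
  refine integral_congr_ae (Filter.Eventually.of_forall fun x => ?_)
  simp only [SchwartzMap.compSubConstCLM_apply, add_sub_cancel_right, inner_add_left,
    AddChar.map_add_eq_mul, Circle.smul_def, Circle.coe_mul, smul_eq_mul]
  ring

namespace IsFourierPair

lemma comp_add_right {f g : RSpace d → ℂ} (h : IsFourierPair f g) (z : RSpace d) :
    IsFourierPair (fun x => f (x + z))
      (fun ξ => (Real.fourierChar (inner ℝ z ξ) : ℂ) * g ξ) where
  locallyIntegrable_left := LocallyIntegrable.comp_add_right_RSpace h.locallyIntegrable_left z
  locallyIntegrable_right := by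
    refine h.locallyIntegrable_right.mono ?_ (Filter.Eventually.of_forall fun ξ => ?_)
    · refine Continuous.aestronglyMeasurable ?_ |>.mul
        h.locallyIntegrable_right.aestronglyMeasurable
      fun_prop
    · rw [norm_mul, Circle.norm_coe, one_mul]
  integrable_left ψ := by
    have := (h.integrable_left (ψ.compSubConstCLM ℂ z)).comp_add_right z
    simpa using this
  integrable_right ψ := by
    refine (h.integrable_right ψ).mono ?_ (Filter.Eventually.of_forall fun ξ => ?_)
    · refine ψ.continuous.aestronglyMeasurable.mul ((Continuous.aestronglyMeasurable ?_).mul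
        h.locallyIntegrable_right.aestronglyMeasurable)
      fun_prop
    · rw [norm_mul, norm_mul, norm_mul, Circle.norm_coe, one_mul]
  integral_eq ψ := by
    have h1 := h.integral_eq (𝓕⁻ ((𝓕 ψ : 𝓢(RSpace d, ℂ)).compSubConstCLM ℂ z))
    rw [FourierTransform.fourier_fourierInv_eq, ← integral_add_right_eq_self _ z] at h1
    simp only [fourierInv_compSubConst_fourier_apply, SchwartzMap.compSubConstCLM_apply,
      add_sub_cancel_right] at h1
    rw [h1]
    refine integral_congr_ae (Filter.Eventually.of_forall fun x => ?_)
    ring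

lemma difference {f g : RSpace d → ℂ} (h : IsFourierPair f g) (z : RSpace d) :
    IsFourierPair (fun x => f (x + z) - f x) (fun ξ => charDiff (inner ℝ z ξ) * g ξ) := by
  refine ((h.comp_add_right z).sub h).congr Filter.EventuallyEq.rfl
    (Filter.Eventually.of_forall fun ξ => ?_)
  simp only [charDiff]
  ring

end IsFourierPair

lemma memLp_charDiff_mul {g : RSpace d → ℂ} (hg : MemLp g 2 volume) (z : RSpace d) :
    MemLp (fun ξ => charDiff (inner ℝ z ξ) * g ξ) 2 volume := by
  refine MemLp.of_le_mul (c := 2) hg ?_ (Filter.Eventually.of_forall fun ξ => ?_)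
  · refine (Continuous.aestronglyMeasurable ?_).mul hg.aestronglyMeasurable
    exact continuous_charDiff.comp (by fun_prop)
  · rw [norm_mul, norm_charDiff]
    have := Real.abs_sin_le_one (Real.pi * inner ℝ z ξ)
    gcongr
    linarith

/-- A sum of a bounded and a square integrable function is a tempered distribution. -/
lemma exists_temperedDistribution_eq_integral {f₁ f₂ : RSpace d → ℂ} (h₁ : MemLp f₁ ⊤ volume)
    (h₂ : MemLp f₂ 2 volume) :
    ∃ S : 𝓢'(RSpace d, ℂ), ∀ φ : 𝓢(RSpace d, ℂ), S φ = ∫ x, φ x * (f₁ x + f₂ x) := by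
  refine ⟨Lp.toTemperedDistribution (h₁.toLp f₁) + Lp.toTemperedDistribution (h₂.toLp f₂),
    fun φ => ?_⟩
  have e1 : ∫ x, φ x • (h₁.toLp f₁) x = ∫ x, φ x * f₁ x := integral_congr_ae <| by
    filter_upwards [h₁.coeFn_toLp] with x hx
    rw [hx, smul_eq_mul]
  have e2 : ∫ x, φ x • (h₂.toLp f₂) x = ∫ x, φ x * f₂ x := integral_congr_ae <| by
    filter_upwards [h₂.coeFn_toLp] with x hx
    rw [hx, smul_eq_mul]
  change Lp.toTemperedDistribution (h₁.toLp f₁) φ + Lp.toTemperedDistribution (h₂.toLp f₂) φ = _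
  rw [Lp.toTemperedDistribution_apply, Lp.toTemperedDistribution_apply, e1, e2,
    ← integral_add (h₁.integrable_schwartz_mul le_top φ)
      (h₂.integrable_schwartz_mul (by norm_num) φ)]
  simp only [mul_add]

/-! ### Functions with Fourier transform in `L²(|ξ| dξ)` -/

/-- The integrand of the homogeneous Sobolev norm of order `1/2`, on the Fourier side. -/
def halfWeight (g : RSpace d → ℂ) (ξ : RSpace d) : ℂ := ((‖ξ‖ ^ (1 / 2 : ℝ) : ℝ) : ℂ) * g ξ

lemma enorm_halfWeight_sq (g : RSpace d → ℂ) (ξ : RSpace d) :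
    ‖halfWeight g ξ‖ₑ ^ 2 = ‖ξ‖ₑ * ‖g ξ‖ₑ ^ 2 := by
  rw [halfWeight, enorm_mul, mul_pow]
  congr 1
  rw [← ofReal_norm, ← ENNReal.ofReal_pow (norm_nonneg _), Complex.norm_real,
    Real.norm_of_nonneg (by positivity), ← Real.sqrt_eq_rpow, Real.sq_sqrt (norm_nonneg _),
    ofReal_norm]

lemma eLpNorm_two_sq {α F : Type*} [MeasurableSpace α] {μ : Measure α} [ENorm F]
    (f : α → F) : eLpNorm f 2 μ ^ 2 = ∫⁻ x, ‖f x‖ₑ ^ 2 ∂μ := by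
  rw [eLpNorm_eq_lintegral_rpow_enorm_toReal (p := 2) (by norm_num) (by norm_num)]
  simp only [ENNReal.toReal_ofNat, one_div, ENNReal.rpow_two]
  rw [← ENNReal.rpow_two, ENNReal.rpow_inv_rpow (by norm_num)]

lemma eLpNorm_halfWeight_sq (g : RSpace d → ℂ) :
    eLpNorm (halfWeight g) 2 volume ^ 2 = ∫⁻ ξ, ‖ξ‖ₑ * ‖g ξ‖ₑ ^ 2 := by
  simp only [eLpNorm_two_sq, enorm_halfWeight_sq]

/-- A function with a Fourier transform in `L²(|ξ| dξ)` is the sum of a small bounded function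
and a square integrable one. -/
lemma exists_isFourierPair_add [Nontrivial (RSpace d)] {g : RSpace d → ℂ}
    (hg : LocallyIntegrable g volume) (hw : eLpNorm (halfWeight g) 2 volume < ⊤) {ε : ℝ≥0∞}
    (hε : 0 < ε) :
    ∃ f₁ f₂ : RSpace d → ℂ, (∀ x, ‖f₁ x‖ₑ ≤ ε) ∧ MemLp f₁ ⊤ volume ∧ MemLp f₂ 2 volume ∧
      IsFourierPair (fun x => f₁ x + f₂ x) g := by
  have hint : ∀ r : ℝ, IntegrableOn g (Metric.ball 0 r) := fun r =>
    (hg.integrableOn_isCompact (isCompact_closedBall 0 r)).mono_set Metric.ball_subset_closedBall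
  have hball : Filter.Tendsto (fun n : ℕ => volume (Metric.ball (0 : RSpace d) (1 / ((n : ℝ) + 1))))
      Filter.atTop (nhds 0) := by
    have h0 : Filter.Tendsto (fun n : ℕ => ENNReal.ofReal ((1 / ((n : ℝ) + 1)) ^
        Module.finrank ℝ (RSpace d)) * volume (Metric.ball (0 : RSpace d) 1))
        Filter.atTop (nhds (ENNReal.ofReal (0 ^ Module.finrank ℝ (RSpace d)) *
          volume (Metric.ball (0 : RSpace d) 1))) := by
      refine ENNReal.Tendsto.mul_const (ENNReal.tendsto_ofReal
        ((tendsto_one_div_add_atTop_nhds_zero_nat (𝕜 := ℝ)).pow _)) (Or.inr measure_ball_lt_top.ne)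
    rw [zero_pow Module.finrank_pos.ne', ENNReal.ofReal_zero, zero_mul] at h0
    refine h0.congr fun n => ?_
    rw [Measure.addHaar_ball_of_pos (r := 1 / ((n : ℝ) + 1)) _ _ (by positivity)]
  -- Absolute continuity of the integral: `g` has small `L¹` norm on a small enough ball about `0`,
  -- so the low frequencies give a uniformly small function.
  have hlim := tendsto_setLIntegral_zero
    (μ := (volume : Measure (RSpace d)).restrict (Metric.ball 0 1)) (f := fun ξ => ‖g ξ‖ₑ)
    (hint 1).2.ne (s := fun n : ℕ => Metric.ball (0 : RSpace d) (1 / ((n : ℝ) + 1)))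
    (tendsto_of_tendsto_of_tendsto_of_le_of_le tendsto_const_nhds hball (fun _ => zero_le)
      (fun n => Measure.restrict_apply_le _ _))
  obtain ⟨n, hn⟩ := (hlim.eventually_lt_const hε).exists
  set δ : ℝ := 1 / ((n : ℝ) + 1) with hδ
  have hδ0 : 0 < δ := by positivity
  have hδ1 : δ ≤ 1 := by rw [hδ, div_le_one (by positivity)]; linarith [n.cast_nonneg (α := ℝ)]
  rw [Measure.restrict_restrict Metric.isOpen_ball.measurableSet,
    Set.inter_eq_left.2 (Metric.ball_subset_ball hδ1)] at hn
  set B := Metric.ball (0 : RSpace d) δ with hB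
  have hBm : MeasurableSet B := Metric.isOpen_ball.measurableSet
  obtain ⟨f₁, hp₁, hb₁⟩ := exists_isFourierPair_of_integrable_right
    ((integrable_indicator_iff hBm).2 (hint δ))
  -- Off that ball the weight `|ξ|^{1/2}` is at least `δ^{1/2}`, so the high frequencies are in
  -- `L²`.
  have hg₂ : MemLp (Bᶜ.indicator g) 2 volume := by
    have hh : MemLp (halfWeight g) 2 volume := ⟨?_, hw⟩
    · refine MemLp.of_le_mul (c := (δ ^ (1 / 2 : ℝ))⁻¹) hh
        (hg.aestronglyMeasurable.indicator hBm.compl) (Filter.Eventually.of_forall fun ξ => ?_)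
      by_cases hξ : ξ ∈ B
      · rw [Set.indicator_of_notMem (by simpa using hξ), norm_zero]
        positivity
      · rw [Set.indicator_of_mem (by simpa using hξ), halfWeight, norm_mul, Complex.norm_real,
          Real.norm_of_nonneg (by positivity), ← mul_assoc]
        have hξ' : δ ≤ ‖ξ‖ := by simpa [hB] using hξ
        refine le_mul_of_one_le_left (norm_nonneg _) ?_
        rw [← div_eq_inv_mul, one_le_div (by positivity)]
        exact Real.rpow_le_rpow hδ0.le hξ' (by norm_num)
    · unfold halfWeight
      refine AEStronglyMeasurable.mul ?_ hg.aestronglyMeasurable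
      exact (Measurable.aestronglyMeasurable (by fun_prop))
  obtain ⟨f₂, hf₂, hp₂⟩ := exists_isFourierPair_of_memLp_right hg₂
  have hf1 : ∀ x, ‖f₁ x‖ₑ ≤ ε := fun x => by
    refine (hb₁ x).trans (le_trans (le_of_eq ?_) hn.le)
    rw [← lintegral_indicator hBm]
    refine lintegral_congr fun ξ => ?_
    rw [enorm_indicator_eq_indicator_enorm]
  refine ⟨f₁, f₂, hf1, ?_, hf₂, (hp₁.add hp₂).congr Filter.EventuallyEq.rfl
    (Filter.Eventually.of_forall fun ξ => Set.indicator_self_add_compl_apply B g ξ)⟩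
  refine ⟨hp₁.locallyIntegrable_left.aestronglyMeasurable, ?_⟩
  refine lt_of_le_of_lt (eLpNorm_le_of_ae_enorm_bound (C := ∫⁻ ξ, ‖B.indicator g ξ‖ₑ)
    (Filter.Eventually.of_forall hb₁)) ?_
  simp only [ENNReal.toReal_top, inv_zero, ENNReal.rpow_zero, smul_eq_mul, mul_one]
  exact lt_of_le_of_lt le_rfl ((integrable_indicator_iff hBm).2 (hint δ)).2

/-- The Fourier transform in the definition of the homogeneous Sobolev norm may be tested against
all Schwartz functions. -/
theorem IsGivenBy.isFourierPair [Nontrivial (RSpace d)] {T : 𝓢'(RSpace d, ℂ)}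
    {f g : RSpace d → ℂ} (hf : IsGivenBy T f) (hg : IsGivenBy (𝓕 T) g)
    (hw : eLpNorm (halfWeight g) 2 volume < ⊤) : IsFourierPair f g := by
  -- A distribution `S` with transform `g` is rebuilt from the low and high frequencies. It has the
  -- same transform as `T`, hence equals `T`, and `f` agrees almost everywhere with `f₁ + f₂`.
  obtain ⟨f₁, f₂, -, h₁, h₂, hp⟩ := exists_isFourierPair_add hg.1 hw zero_lt_one
  obtain ⟨S, hS⟩ := exists_temperedDistribution_eq_integral h₁ h₂
  have hST : 𝓕 S = 𝓕 T := TemperedDistribution.eq_of_forall_hasCompactSupport fun φ hφ => by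
    rw [hg.2 φ hφ, TemperedDistribution.fourier_apply, hS, hp.integral_eq]
  have hST' : S = T := by
    rw [← FourierTransform.fourierInv_fourier_eq (F := 𝓢'(RSpace d, ℂ)) S, hST, FourierTransform.fourierInv_fourier_eq]
  refine hp.congr (ae_eq_of_forall_integral_schwartz_eq hp.locallyIntegrable_left hf.1
    fun φ hφ => ?_) Filter.EventuallyEq.rfl
  rw [← hf.2 φ hφ, ← hST', hS]

/-- `f` is square integrable up to arbitrarily small bounded errors. -/
def VanishesAtInfinity {α : Type*} [MeasureSpace α] (f : α → ℂ) : Prop :=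
  ∀ ε : ℝ≥0∞, 0 < ε → ∫⁻ x, (‖f x‖ₑ - ε) ^ 2 < ⊤

/-- With the low frequencies bounded by `ε`, the excess of `|f|` over `ε` is dominated by the square
integrable part. -/
lemma IsFourierPair.vanishesAtInfinity [Nontrivial (RSpace d)] {f g : RSpace d → ℂ}
    (h : IsFourierPair f g) (hw : eLpNorm (halfWeight g) 2 volume < ⊤) : VanishesAtInfinity f := by
  intro ε hε
  obtain ⟨f₁, f₂, h₁, -, h₂, hp⟩ := exists_isFourierPair_add h.locallyIntegrable_right hw hε
  have h3 : ∫⁻ x, ‖f₂ x‖ₑ ^ 2 < ⊤ := by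
    rw [← eLpNorm_two_sq]
    exact ENNReal.pow_lt_top h₂.2
  refine lt_of_le_of_lt (lintegral_mono_ae ?_) h3
  filter_upwards [h.ae_eq_left hp] with x hx
  gcongr
  rw [tsub_le_iff_right, hx, add_comm]
  exact (enorm_add_le _ _).trans (by gcongr; exact h₁ x)

/-- Plancherel applies although `g` need not be in `L²`: from `min(1, t²) ≤ |t|` the symbol is at
most `2π |z|^{1/2} |ξ|^{1/2}`, so its product with `g` is square integrable. -/
lemma IsFourierPair.lintegral_difference {f g : RSpace d → ℂ}
    (h : IsFourierPair f g) (hw : eLpNorm (halfWeight g) 2 volume < ⊤) (z : RSpace d) :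
    ∫⁻ x, ‖f (x + z) - f x‖ₑ ^ 2 = ∫⁻ ξ, ‖charDiff (inner ℝ z ξ)‖ₑ ^ 2 * ‖g ξ‖ₑ ^ 2 := by
  have hm : AEStronglyMeasurable (fun ξ => charDiff (inner ℝ z ξ) * g ξ) volume :=
    (h.difference z).locallyIntegrable_right.aestronglyMeasurable
  have hmem : MemLp (fun ξ => charDiff (inner ℝ z ξ) * g ξ) 2 volume := by
    have hh : MemLp (halfWeight g) 2 volume := ⟨by
      unfold halfWeight
      exact AEStronglyMeasurable.mul (Measurable.aestronglyMeasurable (by fun_prop))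
        h.locallyIntegrable_right.aestronglyMeasurable, hw⟩
    refine MemLp.of_le_mul (c := 2 * Real.pi * ‖z‖ ^ (1 / 2 : ℝ)) hh hm
      (Filter.Eventually.of_forall fun ξ => ?_)
    rw [halfWeight, norm_mul, norm_mul, ← mul_assoc]
    refine mul_le_mul_of_nonneg_right ?_ (norm_nonneg _)
    rw [Complex.norm_real, Real.norm_of_nonneg (by positivity), mul_assoc,
      ← Real.mul_rpow (norm_nonneg _) (norm_nonneg _), ← Real.sqrt_eq_rpow]
    refine abs_le_of_sq_le_sq' ?_ (by positivity) |>.2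
    refine (norm_charDiff_sq_le _).trans ?_
    rw [mul_pow (2 * Real.pi), Real.sq_sqrt (by positivity)]
    gcongr
    have hle := abs_real_inner_le_norm z ξ
    rcases le_total 1 (‖z‖ * ‖ξ‖) with h1 | h1
    · exact (min_le_left _ _).trans h1
    · refine (min_le_right _ _).trans ?_
      rw [← sq_abs]
      have h0 := abs_nonneg (inner ℝ z ξ)
      nlinarith
  rw [(h.difference z).lintegral_eq hmem]
  simp only [enorm_mul, mul_pow]

/-! ### The Sobolev embedding of `Ḣ^{1/2}(ℝ²)` into `L⁴(ℝ²)` -/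

lemma ENNReal.sq_le_of_forall_le_mul_add {x a b : ℝ≥0∞} (hb0 : b ≠ 0) (hb : b ≠ ⊤)
    (h : ∀ r : ℝ, 0 < r → x ≤ ENNReal.ofReal r * a + (ENNReal.ofReal r)⁻¹ * b) :
    x ^ 2 ≤ 4 * (a * b) := by
  rcases eq_or_ne a ⊤ with rfl | ha
  · rw [ENNReal.top_mul hb0, ENNReal.mul_top (by norm_num)]
    exact le_top
  have hx : x ≠ ⊤ := by
    refine ne_top_of_le_ne_top ?_ (h 1 one_pos)
    simp [ha, hb]
  lift a to ℝ≥0 using ha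
  lift b to ℝ≥0 using hb
  lift x to ℝ≥0 using hx
  have hb0' : 0 < (b : ℝ) := by
    have : b ≠ 0 := by simpa using hb0
    positivity
  have h' : ∀ r : ℝ, 0 < r → (x : ℝ) ≤ r * a + r⁻¹ * b := by
    intro r hr
    have h1 := h r hr
    rw [← ENNReal.ofReal_inv_of_pos hr, ← ENNReal.ofReal_coe_nnreal (p := x),
      ← ENNReal.ofReal_coe_nnreal (p := a), ← ENNReal.ofReal_coe_nnreal (p := b),
      ← ENNReal.ofReal_mul hr.le, ← ENNReal.ofReal_mul (by positivity),
      ← ENNReal.ofReal_add (by positivity) (by positivity),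
      ENNReal.ofReal_le_ofReal_iff (by positivity)] at h1
    exact h1
  have key : (x : ℝ) ^ 2 ≤ 4 * (a * b) := by
    rcases eq_or_lt_of_le a.2 with ha0 | ha0
    · have ha0 : (a : ℝ) = 0 := ha0.symm
      have hx0 : (x : ℝ) ≤ 0 := by
        refine _root_.le_of_forall_pos_le_add fun ε hε => ?_
        -- When `a = 0` the infimum is approached only as `r → ∞`.
        have := h' (b / ε) (by positivity)
        rw [ha0, mul_zero, zero_add, inv_div] at this
        rw [zero_add]
        refine this.trans (le_of_eq ?_)
        field_simp
      have : (x : ℝ) = 0 := le_antisymm hx0 x.2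
      rw [this, ha0]
      simp
    · have ha0 : (0 : ℝ) < a := ha0
      -- The value of `r` that balances the two terms.
      have h1 := h' (Real.sqrt (b / a)) (by positivity)
      have h2 : Real.sqrt (b / a) * a + (Real.sqrt (b / a))⁻¹ * b = 2 * Real.sqrt (a * b) := by
        rw [Real.sqrt_div hb0'.le, Real.sqrt_mul ha0.le]
        have e1 := Real.mul_self_sqrt ha0.le
        have e2 := Real.mul_self_sqrt hb0'.le
        have p1 := Real.sqrt_pos.2 ha0
        have p2 := Real.sqrt_pos.2 hb0'
        set s := Real.sqrt a
        set t := Real.sqrt b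
        rw [← e1, ← e2]
        field_simp
        ring
      rw [h2] at h1
      calc (x : ℝ) ^ 2 ≤ (2 * Real.sqrt (a * b)) ^ 2 := pow_le_pow_left₀ x.2 h1 2
        _ = 4 * (a * b) := by rw [mul_pow, Real.sq_sqrt (by positivity)]; norm_num
  exact_mod_cast key

/-- The Cauchy-Schwarz inequality. -/
lemma lintegral_mul_sq_le {α : Type*} [MeasurableSpace α] {μ : Measure α} {f g : α → ℝ≥0∞}
    (hf : AEMeasurable f μ) (hg : AEMeasurable g μ) :
    (∫⁻ x, f x * g x ∂μ) ^ 2 ≤ (∫⁻ x, f x ^ 2 ∂μ) * ∫⁻ x, g x ^ 2 ∂μ := by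
  have h := ENNReal.lintegral_mul_le_Lp_mul_Lq μ Real.HolderConjugate.two_two hf hg
  calc (∫⁻ x, f x * g x ∂μ) ^ 2
      ≤ ((∫⁻ x, f x ^ (2 : ℝ) ∂μ) ^ (1 / 2 : ℝ) * (∫⁻ x, g x ^ (2 : ℝ) ∂μ) ^ (1 / 2 : ℝ)) ^ 2 := by
        gcongr
        exact h
    _ = _ := by
        rw [mul_pow, ← ENNReal.rpow_two, ← ENNReal.rpow_two, one_div,
          ENNReal.rpow_inv_rpow (by norm_num), ENNReal.rpow_inv_rpow (by norm_num)]
        simp only [ENNReal.rpow_two]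

lemma enorm_sq_le_two_mul_add {F : Type*} [NormedAddCommGroup F] (a b : F) :
    ‖a + b‖ₑ ^ 2 ≤ 2 * ‖a‖ₑ ^ 2 + 2 * ‖b‖ₑ ^ 2 := by
  have h : (‖a‖₊ + ‖b‖₊) ^ 2 ≤ 2 * ‖a‖₊ ^ 2 + 2 * ‖b‖₊ ^ 2 := by
    rw [← NNReal.coe_le_coe]
    push_cast
    nlinarith [sq_nonneg (‖a‖ - ‖b‖)]
  have h' : (‖a‖ₑ + ‖b‖ₑ) ^ 2 ≤ 2 * ‖a‖ₑ ^ 2 + 2 * ‖b‖ₑ ^ 2 := by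
    simp only [enorm_eq_nnnorm]
    exact_mod_cast h
  exact (pow_le_pow_left' (enorm_add_le a b) 2).trans h'

/-- The square of the Gagliardo seminorm of order `1/2`. -/
def gagliardo {E : Type*} [NormedAddCommGroup E] [NormedSpace ℝ E] [MeasureSpace E]
    (u : E → ℂ) : ℝ≥0∞ :=
  ∫⁻ y, gagKernel y * ∫⁻ x, ‖u (x + y) - u x‖ₑ ^ 2

lemma gagliardo_eq_lintegral_swap {u : RSpace 2 → ℂ} (hu : Measurable u) :
    gagliardo u = ∫⁻ x, ∫⁻ y, gagKernel y * ‖u (x + y) - u x‖ₑ ^ 2 := by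
  unfold gagliardo
  rw [lintegral_lintegral_swap]
  · refine lintegral_congr fun y => ?_
    rw [lintegral_const_mul _ (by fun_prop)]
  · exact (by fun_prop : Measurable fun p : RSpace 2 × RSpace 2 =>
      gagKernel p.2 * ‖u (p.1 + p.2) - u p.1‖ₑ ^ 2).aemeasurable

/-- The Sobolev embedding of `Ḣ^{1/2}(ℝ²)` into `L⁴(ℝ²)`, for functions known to be in `L⁴`. -/
lemma exists_lintegral_pow_four_le_of_ne_top : ∃ C : ℝ≥0, ∀ u : RSpace 2 → ℂ, Measurable u →
    ∫⁻ x, ‖u x‖ₑ ^ 4 ≠ ⊤ → ∫⁻ x, ‖u x‖ₑ ^ 4 ≤ C * gagliardo u ^ 2 := by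
  set c : ℝ≥0∞ := volume (Metric.ball (0 : RSpace 2) 1) with hc
  have hc0 : c ≠ 0 := (Metric.measure_ball_pos _ _ one_pos).ne'
  have hct : c ≠ ⊤ := measure_ball_lt_top.ne
  set s : ℝ≥0∞ := c ^ (1 / 2 : ℝ) with hs
  have hss : s ^ 2 = c := by
    rw [hs, ← ENNReal.rpow_two, one_div, ENNReal.rpow_inv_rpow (by norm_num)]
  have hs0 : s ≠ 0 := fun h => hc0 (by rw [← hss, h]; simp)
  have hst : s ≠ ⊤ := fun h => hct (by rw [← hss, h]; simp)
  set K : ℝ≥0∞ := 4 * ((2 * c⁻¹) * (2 * c⁻¹ * s)) with hK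
  have hKt : K ≠ ⊤ := by
    rw [hK]
    have : c⁻¹ ≠ ⊤ := ENNReal.inv_ne_top.2 hc0
    finiteness
  refine ⟨(K ^ 2).toNNReal, fun u hu hfin => ?_⟩
  rw [ENNReal.coe_toNNReal (ENNReal.pow_ne_top hKt)]
  set M := ∫⁻ x, ‖u x‖ₑ ^ 4 with hM
  rcases eq_or_ne M 0 with hM0 | hM0
  · rw [hM0]; exact zero_le
  set N : ℝ≥0∞ := M ^ (1 / 2 : ℝ) with hN
  have hNN : N ^ 2 = M := by
    rw [hN, ← ENNReal.rpow_two, one_div, ENNReal.rpow_inv_rpow (by norm_num)]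
  have hN0 : N ≠ 0 := fun h => hM0 (by rw [← hNN, h]; simp)
  have hNt : N ≠ ⊤ := fun h => hfin (by rw [← hNN, h]; simp)
  have hfr : Module.finrank ℝ (RSpace 2) = 2 := by simp
  set D : RSpace 2 → ℝ≥0∞ := fun x => ∫⁻ y, gagKernel y * ‖u (x + y) - u x‖ₑ ^ 2 with hD
  -- Average `|u(x)|² ≤ 2|u(x+y) - u(x)|² + 2|u(x+y)|²` over a ball of radius `r`. The first mean is
  -- at most a multiple of `r D(x)`, since the kernel is at least `r^{-3}` there; by Cauchy-Schwarz
  -- the second is at most a multiple of `r^{-1} N`. Then optimise in `r`.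
  have hpt : ∀ x, ‖u x‖ₑ ^ 4 ≤ K * N * D x := by
    intro x
    have h := ENNReal.sq_le_of_forall_le_mul_add (x := ‖u x‖ₑ ^ 2) (a := 2 * c⁻¹ * D x)
      (b := 2 * c⁻¹ * s * N) (by simp [hct, hs0, hN0]) (by
        have : c⁻¹ ≠ ⊤ := ENNReal.inv_ne_top.2 hc0
        finiteness) fun r hr => ?_
    · calc ‖u x‖ₑ ^ 4 = (‖u x‖ₑ ^ 2) ^ 2 := by ring
        _ ≤ _ := h
        _ = K * N * D x := by rw [hK]; ring
    set ρ := ENNReal.ofReal r with hρ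
    have hρ0 : ρ ≠ 0 := by simpa [hρ] using hr
    have hρt : ρ ≠ ⊤ := ENNReal.ofReal_ne_top
    set B := Metric.ball (0 : RSpace 2) r with hB
    have hBm : MeasurableSet B := Metric.isOpen_ball.measurableSet
    have hBv : volume B = ρ ^ 2 * c := by
      rw [hB, Measure.addHaar_ball_of_pos _ _ hr, hfr, ENNReal.ofReal_pow hr.le]
    have h1 : ρ ^ 2 * c * ‖u x‖ₑ ^ 2 ≤
        2 * (∫⁻ y in B, ‖u (x + y) - u x‖ₑ ^ 2) + 2 * ∫⁻ y in B, ‖u (x + y)‖ₑ ^ 2 := by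
      rw [← lintegral_const_mul _ (by fun_prop), ← lintegral_const_mul _ (by fun_prop),
        ← lintegral_add_left (by fun_prop), ← hBv, mul_comm, ← setLIntegral_const]
      refine lintegral_mono fun y => ?_
      have := enorm_sq_le_two_mul_add (-(u (x + y) - u x)) (u (x + y))
      rw [enorm_neg] at this
      simpa using this
    have h2 : ∫⁻ y in B, ‖u (x + y) - u x‖ₑ ^ 2 ≤ ρ ^ 3 * D x := by
      rw [hD]
      simp only
      rw [← lintegral_const_mul _ (by fun_prop)]
      refine (setLIntegral_mono' (g := fun y => ρ ^ 3 * (gagKernel y * ‖u (x + y) - u x‖ₑ ^ 2)) hBm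
        fun y hy => ?_).trans (setLIntegral_le_lintegral _ _)
      rw [← mul_assoc]
      refine le_mul_of_one_le_left' ?_
      unfold gagKernel
      rw [hfr, ← ENNReal.div_eq_inv_mul.trans (mul_comm _ _)]
      have hy' : ‖y‖ₑ ≤ ρ := by
        rw [← ofReal_norm]
        exact ENNReal.ofReal_le_ofReal (by simpa [hB] using (Metric.mem_ball.1 hy).le)
      rw [ENNReal.le_div_iff_mul_le (Or.inr (pow_ne_zero _ hρ0)) (Or.inr (ENNReal.pow_ne_top hρt)),
        one_mul]
      gcongr
    have h3 : ∫⁻ y in B, ‖u (x + y)‖ₑ ^ 2 ≤ ρ * s * N := by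
      have hcs := lintegral_mul_sq_le (μ := volume.restrict B) (f := fun _ => (1 : ℝ≥0∞))
        (g := fun y => ‖u (x + y)‖ₑ ^ 2) (by fun_prop) (by fun_prop)
      simp only [one_mul, one_pow, lintegral_const, Measure.restrict_apply_univ, hBv, ← pow_mul,
        Nat.reduceMul] at hcs
      have h4 : ∫⁻ y in B, ‖u (x + y)‖ₑ ^ 4 ≤ M := by
        refine (setLIntegral_le_lintegral _ _).trans (le_of_eq ?_)
        exact lintegral_add_left_eq_self (fun y => ‖u y‖ₑ ^ 4) x
      have h5 : (∫⁻ y in B, ‖u (x + y)‖ₑ ^ 2) ^ 2 ≤ (ρ * s * N) ^ 2 := by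
        refine hcs.trans ((mul_le_mul' le_rfl h4).trans (le_of_eq ?_))
        rw [← hss, ← hNN]
        ring
      exact (ENNReal.pow_le_pow_left_iff two_ne_zero).1 h5
    have h6 : ρ ^ 2 * c * ‖u x‖ₑ ^ 2 ≤ ρ ^ 2 * c *
        (ρ * (2 * c⁻¹ * D x) + ρ⁻¹ * (2 * c⁻¹ * s * N)) := by
      refine h1.trans ((add_le_add (mul_le_mul' le_rfl h2) (mul_le_mul' le_rfl h3)).trans
        (le_of_eq ?_))
      calc 2 * (ρ ^ 3 * D x) + 2 * (ρ * s * N)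
          = (c * c⁻¹) * (2 * (ρ ^ 3 * D x)) + (ρ * ρ⁻¹) * (c * c⁻¹) * (2 * (ρ * s * N)) := by
            rw [ENNReal.mul_inv_cancel hc0 hct, ENNReal.mul_inv_cancel hρ0 hρt]
            simp
        _ = _ := by ring
    exact (ENNReal.mul_le_mul_iff_right (mul_ne_zero (pow_ne_zero _ hρ0) hc0)
      (ENNReal.mul_ne_top (ENNReal.pow_ne_top hρt) hct)).1 h6
  -- Integrating the pointwise bound gives `N² ≤ K N [u]²`; finiteness of the `L⁴` norm is what
  -- allows `N` to be cancelled.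
  have hint : N * N ≤ N * (K * gagliardo u) := by
    calc N * N = M := by rw [← hNN]; ring
      _ ≤ ∫⁻ x, K * N * D x := lintegral_mono hpt
      _ = K * N * ∫⁻ x, D x := lintegral_const_mul' _ _ (ENNReal.mul_ne_top hKt hNt)
      _ = N * (K * gagliardo u) := by
        rw [gagliardo_eq_lintegral_swap hu]
        ring
  rw [ENNReal.mul_le_mul_iff_right hN0 hNt] at hint
  calc M = N ^ 2 := hNN.symm
    _ ≤ (K * gagliardo u) ^ 2 := by gcongr
    _ = _ := by ring

lemma abs_min_tsub_sub_le (a b ε : ℝ) (M : ℝ) :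
    |min (max (a - ε) 0) M - min (max (b - ε) 0) M| ≤ |a - b| := by
  refine (abs_min_sub_min_le_max _ _ _ _).trans ?_
  rw [sub_self, abs_zero, max_eq_left (abs_nonneg _)]
  refine (abs_max_sub_max_le_max _ _ _ _).trans ?_
  rw [sub_self, abs_zero, max_eq_left (abs_nonneg _)]
  simp

/-- The Sobolev embedding of `Ḣ^{1/2}(ℝ²)` into `L⁴(ℝ²)`. -/
theorem exists_lintegral_pow_four_le_gagliardo : ∃ C : ℝ≥0, ∀ u : RSpace 2 → ℂ, Measurable u →
    VanishesAtInfinity u → ∫⁻ x, ‖u x‖ₑ ^ 4 ≤ C * gagliardo u ^ 2 := by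
  obtain ⟨C, hC⟩ := exists_lintegral_pow_four_le_of_ne_top
  refine ⟨C, fun u hu hv => ?_⟩
  -- Truncating `|u|` from below and above makes it fourth-power integrable, by
  -- `VanishesAtInfinity`. The truncation is 1-Lipschitz, so the energy does not grow, and Fatou's
  -- lemma removes it.
  set v : ℕ → RSpace 2 → ℂ := fun n x =>
    ((min (max (‖u x‖ - 1 / ((n : ℝ) + 1)) 0) n : ℝ) : ℂ) with hvdef
  have hvm : ∀ n, Measurable (v n) := fun n => by
    rw [hvdef]
    fun_prop
  have hvn : ∀ n x, ‖v n x‖ = min (max (‖u x‖ - 1 / ((n : ℝ) + 1)) 0) n := fun n x => by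
    rw [hvdef]
    simp only
    rw [Complex.norm_real, Real.norm_of_nonneg (by positivity)]
  have hfin : ∀ n, ∫⁻ x, ‖v n x‖ₑ ^ 4 ≠ ⊤ := by
    intro n
    set ε : ℝ≥0∞ := ENNReal.ofReal (1 / ((n : ℝ) + 1)) with hε
    have hε0 : 0 < ε := by rw [hε, ENNReal.ofReal_pos]; positivity
    have hle : ∀ x, ‖v n x‖ₑ ^ 4 ≤ (n : ℝ≥0∞) ^ 2 * (‖u x‖ₑ - ε) ^ 2 := by
      intro x
      have h1 : ‖v n x‖ₑ ≤ n := by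
        rw [← ofReal_norm, hvn, ← ENNReal.ofReal_natCast]
        exact ENNReal.ofReal_le_ofReal (min_le_right _ _)
      have h2 : ‖v n x‖ₑ ≤ ‖u x‖ₑ - ε := by
        rw [← ofReal_norm, hvn, hε, ← ofReal_norm, ← ENNReal.ofReal_sub _ (by positivity)]
        refine (ENNReal.ofReal_le_ofReal (min_le_left _ _)).trans (le_of_eq ?_)
        rw [ENNReal.ofReal_max]
        simp
      calc ‖v n x‖ₑ ^ 4 = ‖v n x‖ₑ ^ 2 * ‖v n x‖ₑ ^ 2 := by ring
        _ ≤ _ := by gcongr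
    refine ((lintegral_mono hle).trans_lt ?_).ne
    rw [lintegral_const_mul' _ _ (by finiteness)]
    exact ENNReal.mul_lt_top (by finiteness) (hv ε hε0)
  have hgag : ∀ n, gagliardo (v n) ≤ gagliardo u := by
    intro n
    unfold gagliardo
    refine lintegral_mono fun y => mul_le_mul' le_rfl (lintegral_mono fun x => ?_)
    have h3 : ‖v n (x + y) - v n x‖ ≤ ‖u (x + y) - u x‖ := by
      rw [hvdef]
      simp only
      rw [← Complex.ofReal_sub, Complex.norm_real, Real.norm_eq_abs]
      exact (abs_min_tsub_sub_le _ _ _ _).trans (abs_norm_sub_norm_le _ _)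
    have h4 : ‖v n (x + y) - v n x‖ₑ ≤ ‖u (x + y) - u x‖ₑ := enorm_le_iff_norm_le.2 h3
    gcongr
  have hlim : ∀ x, Filter.Tendsto (fun n => ‖v n x‖ₑ ^ 4) Filter.atTop (nhds (‖u x‖ₑ ^ 4)) := by
    intro x
    have h1 : Filter.Tendsto (fun n : ℕ => max (‖u x‖ - 1 / ((n : ℝ) + 1)) 0) Filter.atTop
        (nhds ‖u x‖) := by
      have h := ((tendsto_one_div_add_atTop_nhds_zero_nat (𝕜 := ℝ)).const_sub ‖u x‖).max
        (tendsto_const_nhds (x := (0 : ℝ)))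
      rwa [sub_zero, max_eq_left (norm_nonneg _)] at h
    have h2 : Filter.Tendsto (fun n : ℕ => ‖v n x‖) Filter.atTop (nhds ‖u x‖) := by
      refine h1.congr' ?_
      obtain ⟨m, hm⟩ := exists_nat_ge ‖u x‖
      filter_upwards [Filter.eventually_ge_atTop m] with n hn
      rw [hvn, min_eq_left]
      refine max_le ?_ (Nat.cast_nonneg n)
      have : (m : ℝ) ≤ n := by exact_mod_cast hn
      have : (0 : ℝ) < 1 / ((n : ℝ) + 1) := by positivity
      linarith
    have h3 := ENNReal.tendsto_ofReal h2
    simp only [ofReal_norm] at h3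
    exact ((ENNReal.continuous_pow 4).tendsto _).comp h3
  calc ∫⁻ x, ‖u x‖ₑ ^ 4 = ∫⁻ x, Filter.liminf (fun n => ‖v n x‖ₑ ^ 4) Filter.atTop :=
        lintegral_congr fun x => ((hlim x).liminf_eq).symm
    _ ≤ Filter.liminf (fun n => ∫⁻ x, ‖v n x‖ₑ ^ 4) Filter.atTop :=
        lintegral_liminf_le fun n => by have := hvm n; fun_prop
    _ ≤ C * gagliardo u ^ 2 := by
        refine Filter.liminf_le_of_le (by isBoundedDefault) fun b hb => ?_
        obtain ⟨n, hn⟩ := hb.exists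
        refine hn.trans ((hC (v n) (hvm n) (hfin n)).trans ?_)
        gcongr
        exact hgag n

/-! ### Directional energies and the Sobolev norm -/

section Directional

variable {d : ℕ} {E : Type*} [NormedAddCommGroup E] [InnerProductSpace ℝ E]
  [FiniteDimensional ℝ E] [MeasureSpace E] [BorelSpace E]
  [(volume : Measure E).IsAddHaarMeasure]

/-- The square of the Gagliardo seminorm of order `1/2` with increments in the directions `ι z`. -/
def dirGagliardo (ι : E → RSpace d) (f : RSpace d → ℂ) : ℝ≥0∞ :=
  ∫⁻ z, gagKernel z * ∫⁻ x, ‖f (x + ι z) - f x‖ₑ ^ 2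

/-- Plancherel for each increment, then Tonelli; the directions `ι z` enter only through the adjoint
`π`. Plancherel is a hypothesis because it is available both for `g` in `L²(|ξ| dξ)` and for `g` in
`L²`. -/
lemma dirGagliardo_eq {ι : E → RSpace d} {π : RSpace d → E} (hπ : Measurable π)
    (hιπ : ∀ z ξ, inner ℝ (ι z) ξ = inner ℝ z (π ξ)) {f g : RSpace d → ℂ}
    (hg : AEStronglyMeasurable g volume)
    (h : ∀ z, ∫⁻ x, ‖f (x + z) - f x‖ₑ ^ 2 = ∫⁻ ξ, ‖charDiff (inner ℝ z ξ)‖ₑ ^ 2 * ‖g ξ‖ₑ ^ 2) :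
    dirGagliardo ι f =
      ∫⁻ ξ, (∫⁻ z, gagKernel z * ‖charDiff (inner ℝ z (π ξ))‖ₑ ^ 2) * ‖g ξ‖ₑ ^ 2 := by
  have hc : Measurable charDiff := continuous_charDiff.measurable
  have hm1 : Measurable fun p : E × RSpace d => gagKernel p.1 * ‖charDiff (inner ℝ p.1 (π p.2))‖ₑ ^ 2 := by
    fun_prop
  have hg' : AEMeasurable (fun ξ => ‖g ξ‖ₑ ^ 2) (volume : Measure (RSpace d)) :=
    hg.aemeasurable.enorm.pow_const 2
  unfold dirGagliardo
  simp only [h, hιπ]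
  have h1 : ∀ z : E, gagKernel z * ∫⁻ ξ, ‖charDiff (inner ℝ z (π ξ))‖ₑ ^ 2 * ‖g ξ‖ₑ ^ 2 =
      ∫⁻ ξ, gagKernel z * ‖charDiff (inner ℝ z (π ξ))‖ₑ ^ 2 * ‖g ξ‖ₑ ^ 2 := fun z => by
    rw [← lintegral_const_mul'']
    · simp only [mul_assoc]
    · exact (by fun_prop : Measurable fun ξ => ‖charDiff (inner ℝ z (π ξ))‖ₑ ^ 2).aemeasurable.mul hg'
  simp only [h1]
  rw [lintegral_lintegral_swap]
  · refine lintegral_congr fun ξ => ?_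
    have h3 : Measurable fun z : E => gagKernel z * ‖charDiff (inner ℝ z (π ξ))‖ₑ ^ 2 := by
      fun_prop
    rw [lintegral_mul_const _ h3]
  · have h2 : AEMeasurable (fun p : E × RSpace d => ‖g p.2‖ₑ ^ 2) (volume.prod volume) :=
      hg'.comp_quasiMeasurePreserving Measure.quasiMeasurePreserving_snd
    exact AEMeasurable.mul hm1.aemeasurable h2

lemma exists_dirGagliardo_le [Nontrivial E] : ∃ C : ℝ≥0, ∀ {ι : E → RSpace d} {π : RSpace d → E},
    Measurable π → (∀ z ξ, inner ℝ (ι z) ξ = inner ℝ z (π ξ)) → (∀ ξ, ‖π ξ‖ ≤ ‖ξ‖) →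
    ∀ {f g : RSpace d → ℂ}, IsFourierPair f g → eLpNorm (halfWeight g) 2 volume < ⊤ →
      dirGagliardo ι f ≤ C * eLpNorm (halfWeight g) 2 volume ^ 2 := by
  obtain ⟨C, hC⟩ := exists_lintegral_charDiff_le (volume : Measure E)
  refine ⟨C, fun {ι π} hπ hιπ hπn {f g} h hw => ?_⟩
  rw [dirGagliardo_eq hπ hιπ h.locallyIntegrable_right.aestronglyMeasurable
    (h.lintegral_difference hw), eLpNorm_halfWeight_sq, ← lintegral_const_mul' _ _ (by simp)]
  refine lintegral_mono fun ξ => ?_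
  rw [← mul_assoc]
  gcongr
  refine (hC _).trans ?_
  gcongr
  exact enorm_le_iff_norm_le.2 (hπn ξ)

end Directional

/-- Reduces an upper bound by the norm to a bound for each admissible pair `(T, g)` of finite
weight; a `k`-th root brings it to the infimum. `C ≠ 0` makes the right side infinite when no such
pair exists. -/
lemma le_mul_homSobolevNorm_pow {d : ℕ} {f : RSpace d → ℂ} {X : ℝ≥0∞} {C : ℝ≥0} (hC : C ≠ 0)
    {k : ℕ} (hk : k ≠ 0)
    (h : ∀ T : 𝓢'(RSpace d, ℂ), ∀ g, IsGivenBy T f → IsGivenBy (𝓕 T) g →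
      eLpNorm (halfWeight g) 2 volume < ⊤ → X ≤ C * eLpNorm (halfWeight g) 2 volume ^ k) :
    X ≤ C * homSobolevNorm (1 / 2) f ^ k := by
  have hC' : (C : ℝ≥0∞) ≠ 0 := by simpa using hC
  have hk' : (k : ℝ) ≠ 0 := by exact_mod_cast hk
  have key : (X / C) ^ ((k : ℝ)⁻¹) ≤ homSobolevNorm (1 / 2) f := by
    refine le_iInf fun T => le_iInf fun g => le_iInf fun hT => le_iInf fun hg => ?_
    change _ ≤ eLpNorm (halfWeight g) 2 volume
    rcases lt_or_ge (eLpNorm (halfWeight g) 2 volume) ⊤ with hw | hw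
    · have h1 : X / C ≤ eLpNorm (halfWeight g) 2 volume ^ (k : ℝ) := by
        rw [ENNReal.rpow_natCast]
        exact ENNReal.div_le_of_le_mul' (h T g hT hg hw)
      calc _ ≤ (eLpNorm (halfWeight g) 2 volume ^ (k : ℝ)) ^ ((k : ℝ)⁻¹) := by gcongr
        _ = _ := ENNReal.rpow_rpow_inv hk' _
    · exact le_top.trans hw
  have h2 : X / C ≤ homSobolevNorm (1 / 2) f ^ k := by
    calc X / C = ((X / C) ^ ((k : ℝ)⁻¹)) ^ (k : ℝ) := (ENNReal.rpow_inv_rpow hk' _).symm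
      _ = ((X / C) ^ ((k : ℝ)⁻¹)) ^ k := ENNReal.rpow_natCast _ _
      _ ≤ _ := by gcongr
  rwa [ENNReal.div_le_iff_le_mul (Or.inl hC') (Or.inl ENNReal.coe_ne_top), mul_comm] at h2

lemma exists_isFourierPair_of_homSobolevNorm_lt_top {d : ℕ} [Nontrivial (RSpace d)]
    {f : RSpace d → ℂ} (h : homSobolevNorm (1 / 2) f < ⊤) :
    ∃ g, IsFourierPair f g ∧ eLpNorm (halfWeight g) 2 volume < ⊤ := by
  simp only [homSobolevNorm, iInf_lt_iff] at h
  obtain ⟨T, g, hT, hg, hw⟩ := h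
  exact ⟨g, hT.isFourierPair hg hw, hw⟩

/-- The Sobolev embedding of `Ḣ^{1/2}(ℝ²)` into `L⁴(ℝ²)`. -/
theorem exists_lintegral_pow_four_le_homSobolevNorm : ∃ C : ℝ≥0, ∀ u : RSpace 2 → ℂ, Measurable u →
    ∫⁻ x, ‖u x‖ₑ ^ 4 ≤ C * homSobolevNorm (1 / 2) u ^ 4 := by
  obtain ⟨C₁, h₁⟩ := exists_lintegral_pow_four_le_gagliardo
  obtain ⟨C₂, h₂⟩ := exists_dirGagliardo_le (d := 2) (E := RSpace 2)
  -- The summand `1` only keeps the constant nonzero, so that constant times `∞` is `∞`.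
  refine ⟨C₁ * C₂ ^ 2 + 1, fun u hu => le_mul_homSobolevNorm_pow (by positivity) four_ne_zero
    fun T g hT hg hw => ?_⟩
  have hp := hT.isFourierPair hg hw
  have h3 := h₂ (ι := id) (π := id) measurable_id (fun _ _ => rfl) (fun _ => le_rfl) hp hw
  refine (h₁ u hu (hp.vanishesAtInfinity hw)).trans ?_
  calc C₁ * gagliardo u ^ 2 ≤ C₁ * (C₂ * eLpNorm (halfWeight g) 2 volume ^ 2) ^ 2 := by
        gcongr
        exact h3
    _ = ((C₁ * C₂ ^ 2 : ℝ≥0) : ℝ≥0∞) * eLpNorm (halfWeight g) 2 volume ^ 4 := by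
        push_cast
        ring
    _ ≤ _ := by
        gcongr
        exact le_self_add

/-! ### Finite differences, gradients and the planar product estimate -/

section FiniteDifference

variable {d : ℕ}

lemma sq_setLIntegral_Ioc_le {f : ℝ → ℝ≥0∞} (hf : Measurable f) :
    (∫⁻ t in Set.Ioc (0 : ℝ) 1, f t) ^ 2 ≤ ∫⁻ t in Set.Ioc (0 : ℝ) 1, f t ^ 2 := by
  have h := lintegral_mul_sq_le (μ := volume.restrict (Set.Ioc (0 : ℝ) 1))
    (f := fun _ => (1 : ℝ≥0∞)) (g := f) (by fun_prop) (by fun_prop)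
  simpa using h

lemma continuous_fderiv_comp_apply {w : RSpace d → ℂ} (hw : ContDiff ℝ 1 w) (z : RSpace d) :
    Continuous fun x => fderiv ℝ w x z :=
  (hw.continuous_fderiv one_ne_zero).clm_apply continuous_const

/-- The fundamental theorem of calculus along the segment, then Cauchy-Schwarz on an interval of
length one. -/
lemma enorm_difference_sq_le {w : RSpace d → ℂ} (hw : ContDiff ℝ 1 w) (x z : RSpace d) :
    ‖w (x + z) - w x‖ₑ ^ 2 ≤ ∫⁻ t in Set.Ioc (0 : ℝ) 1, ‖fderiv ℝ w (x + t • z) z‖ₑ ^ 2 := by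
  have hc : Continuous fun t : ℝ => fderiv ℝ w (x + t • z) z :=
    (continuous_fderiv_comp_apply hw z).comp (by fun_prop)
  have hd : ∀ t : ℝ, HasDerivAt (fun t : ℝ => w (x + t • z)) (fderiv ℝ w (x + t • z) z) t := by
    intro t
    have h1 : HasDerivAt (fun t : ℝ => x + t • z) z t := by
      simpa using ((hasDerivAt_id t).smul_const z).const_add x
    exact ((hw.differentiable one_ne_zero) _).hasFDerivAt.comp_hasDerivAt t h1
  have h2 := intervalIntegral.integral_eq_sub_of_hasDerivAt (a := 0) (b := 1)
    (fun t _ => hd t) (hc.intervalIntegrable _ _)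
  simp only [one_smul, zero_smul, add_zero] at h2
  rw [← h2, intervalIntegral.integral_of_le zero_le_one]
  refine (pow_le_pow_left' (enorm_integral_le_lintegral_enorm _) 2).trans ?_
  exact sq_setLIntegral_Ioc_le (by fun_prop)

lemma lintegral_difference_sq_le {w : RSpace d → ℂ} (hw : ContDiff ℝ 1 w) (z : RSpace d) :
    ∫⁻ x, ‖w (x + z) - w x‖ₑ ^ 2 ≤ ∫⁻ x, ‖fderiv ℝ w x z‖ₑ ^ 2 := by
  have hc := continuous_fderiv_comp_apply hw z
  refine (lintegral_mono fun x => enorm_difference_sq_le hw x z).trans ?_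
  rw [lintegral_lintegral_swap]
  · have : ∀ t : ℝ, ∫⁻ x, ‖fderiv ℝ w (x + t • z) z‖ₑ ^ 2 = ∫⁻ x, ‖fderiv ℝ w x z‖ₑ ^ 2 := fun t =>
      lintegral_add_right_eq_self (fun x => ‖fderiv ℝ w x z‖ₑ ^ 2) (t • z)
    simp [this]
  · have h : Continuous fun p : RSpace d × ℝ => fderiv ℝ w (p.1 + p.2 • z) z :=
      hc.comp (by fun_prop)
    exact (by fun_prop : Measurable fun p : RSpace d × ℝ =>
      ‖fderiv ℝ w (p.1 + p.2 • z) z‖ₑ ^ 2).aemeasurable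

lemma memLp_two_iff {f : RSpace d → ℂ} (hf : AEStronglyMeasurable f volume) :
    MemLp f 2 volume ↔ ∫⁻ x, ‖f x‖ₑ ^ 2 < ⊤ := by
  rw [← eLpNorm_two_sq]
  constructor
  · intro h
    exact ENNReal.pow_lt_top h.2
  · intro h
    refine ⟨hf, ?_⟩
    by_contra h'
    rw [not_lt, top_le_iff] at h'
    rw [h'] at h
    simp at h

/-- The Fourier transform of a derivative. -/
lemma IsFourierPair.fderiv {f g : RSpace d → ℂ} (h : IsFourierPair f g) (hf : ContDiff ℝ 1 f)
    (m : RSpace d) (hm : MemLp (fun x => fderiv ℝ f x m) 2 volume) :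
    IsFourierPair (fun x => fderiv ℝ f x m)
      (fun ξ => ((inner ℝ ξ m : ℝ) : ℂ) * (2 * Real.pi * Complex.I * g ξ)) := by
  have ht : (fun ξ : RSpace d => inner ℝ ξ m).HasTemperateGrowth :=
    ((innerSL ℝ).flip m).hasTemperateGrowth
  have hr : ∀ ψ : 𝓢(RSpace d, ℂ), ∀ ξ,
      ψ ξ * (((inner ℝ ξ m : ℝ) : ℂ) * (2 * Real.pi * Complex.I * g ξ)) =
        ((2 * Real.pi * Complex.I) • SchwartzMap.smulLeftCLM ℂ (inner ℝ · m) ψ : 𝓢(RSpace d, ℂ)) ξ *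
          g ξ := fun ψ ξ => by
    rw [smul_apply, SchwartzMap.smulLeftCLM_apply_apply ht, Complex.real_smul,
      smul_eq_mul]
    ring
  refine ⟨hm.locallyIntegrable (by norm_num), ?_, hm.integrable_schwartz_mul (by norm_num),
    fun ψ => ?_, fun ψ => ?_⟩
  · have h1 := h.locallyIntegrable_right.continuous_smul (𝕜 := ℂ)
      (g := fun ξ : RSpace d => ((inner ℝ ξ m : ℝ) : ℂ) * (2 * Real.pi * Complex.I)) (by fun_prop)
    refine h1.congr (Filter.Eventually.of_forall fun ξ => ?_)
    simp only [smul_eq_mul]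
    ring
  · simp only [hr]
    exact h.integrable_right _
  · simp only [hr]
    rw [← h.integral_eq]
    -- Integration by parts has no boundary term, since all three products with the Schwartz
    -- function are integrable.
    have h2 := integral_mul_fderiv_eq_neg_fderiv_mul_of_integrable (μ := volume) (v := m)
      (f := (𝓕 ψ : 𝓢(RSpace d, ℂ))) (g := f)
      (h.integrable_left (LineDeriv.lineDerivOp m (𝓕 ψ)))
      (hm.integrable_schwartz_mul (by norm_num) _) (h.integrable_left _)
      (fun x _ => (𝓕 ψ : 𝓢(RSpace d, ℂ)).differentiableAt)
      (fun x _ => (hf.differentiable one_ne_zero) x)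
    rw [h2, ← integral_neg]
    refine integral_congr_ae (Filter.Eventually.of_forall fun x => ?_)
    have h3 := congrArg (fun φ : 𝓢(RSpace d, ℂ) => φ x) (SchwartzMap.lineDerivOp_fourier_eq ψ m)
    simp only [SchwartzMap.lineDerivOp_apply_eq_fderiv] at h3
    simp only [h3, neg_smul, FourierTransform.fourier_neg]
    simp

lemma MeasureTheory.MemLp.vanishesAtInfinity {f : RSpace d → ℂ} (hf : MemLp f 2 volume) :
    VanishesAtInfinity f := fun _ _ =>
  lt_of_le_of_lt (lintegral_mono fun _ => pow_le_pow_left' tsub_le_self 2)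
    ((memLp_two_iff hf.1).1 hf)

end FiniteDifference

/-- The squared `L²` norm of the gradient of a function on the plane. -/
def gradSq (w : RSpace 2 → ℂ) : ℝ≥0∞ :=
  ∫⁻ x, (‖fderiv ℝ w x (EuclideanSpace.single 0 1)‖ₑ ^ 2 +
    ‖fderiv ℝ w x (EuclideanSpace.single 1 1)‖ₑ ^ 2)

lemma IsFourierPair.lintegral_difference_of_memLp {d : ℕ} {f g : RSpace d → ℂ}
    (h : IsFourierPair f g) (hg : MemLp g 2 volume) (z : RSpace d) :
    ∫⁻ x, ‖f (x + z) - f x‖ₑ ^ 2 = ∫⁻ ξ, ‖charDiff (inner ℝ z ξ)‖ₑ ^ 2 * ‖g ξ‖ₑ ^ 2 := by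
  rw [(h.difference z).lintegral_eq (memLp_charDiff_mul hg z)]
  simp only [enorm_mul, mul_pow]

lemma eq_smul_single_add (z : RSpace 2) : z =
    z 0 • EuclideanSpace.single 0 (1 : ℝ) + z 1 • EuclideanSpace.single 1 (1 : ℝ) := by
  ext i
  fin_cases i <;> simp

lemma memLp_fderiv_single {w : RSpace 2 → ℂ} (hw : ContDiff ℝ 1 w) (hg : gradSq w < ⊤) (j : Fin 2) :
    MemLp (fun x => fderiv ℝ w x (EuclideanSpace.single j 1)) 2 volume := by
  rw [memLp_two_iff (continuous_fderiv_comp_apply hw _).aestronglyMeasurable]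
  refine lt_of_le_of_lt (lintegral_mono fun x => ?_) hg
  fin_cases j
  · exact le_self_add
  · exact le_add_self

lemma memLp_fderiv_apply {w : RSpace 2 → ℂ} (hw : ContDiff ℝ 1 w) (hg : gradSq w < ⊤)
    (z : RSpace 2) : MemLp (fun x => fderiv ℝ w x z) 2 volume := by
  have h := ((memLp_fderiv_single hw hg 0).const_mul (z 0 : ℂ)).add
    ((memLp_fderiv_single hw hg 1).const_mul (z 1 : ℂ))
  refine h.ae_eq (Filter.Eventually.of_forall fun x => ?_)
  conv_rhs => rw [eq_smul_single_add z]
  simp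

lemma memLp_difference {w : RSpace 2 → ℂ} (hw : ContDiff ℝ 1 w) (hg : gradSq w < ⊤)
    (z : RSpace 2) : MemLp (fun x => w (x + z) - w x) 2 volume := by
  have hc := hw.continuous
  rw [memLp_two_iff (by fun_prop : Continuous fun x => w (x + z) - w x).aestronglyMeasurable]
  refine (lintegral_difference_sq_le hw z).trans_lt ?_
  rw [← memLp_two_iff (continuous_fderiv_comp_apply hw _).aestronglyMeasurable]
  exact memLp_fderiv_apply hw hg z

lemma enorm_sq_eq_add (ξ : RSpace 2) : ‖ξ‖ₑ ^ 2 = ‖ξ 0‖ₑ ^ 2 + ‖ξ 1‖ₑ ^ 2 := by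
  rw [← ofReal_norm, ← ofReal_norm, ← ofReal_norm, ← ENNReal.ofReal_pow (norm_nonneg _),
    ← ENNReal.ofReal_pow (norm_nonneg _), ← ENNReal.ofReal_pow (norm_nonneg _),
    ← ENNReal.ofReal_add (by positivity) (by positivity), EuclideanSpace.norm_sq_eq]
  simp

lemma fderiv_difference {d : ℕ} {w : RSpace d → ℂ} (hw : ContDiff ℝ 1 w) (x z m : RSpace d) :
    fderiv ℝ (fun x => w (x + z) - w x) x m = fderiv ℝ w (x + z) m - fderiv ℝ w x m := by
  have hd := hw.differentiable one_ne_zero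
  have h1 : DifferentiableAt ℝ (fun x => w (x + z)) x := (hd.comp (differentiable_id.add_const z)) x
  rw [fderiv_fun_sub h1 (hd x), fderiv_comp_add_right]
  rfl

/-- The Fourier transform of the differences of a function with square integrable gradient. -/
lemma exists_isFourierPair_difference {w : RSpace 2 → ℂ} (hw : ContDiff ℝ 1 w)
    (hg : gradSq w < ⊤) :
    ∃ H : RSpace 2 → ℝ≥0∞, AEMeasurable H ∧ ∫⁻ ξ, H ξ = gradSq w ∧
      ∀ z, ∃ g, MemLp g 2 volume ∧ IsFourierPair (fun x => w (x + z) - w x) g ∧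
        ∀ᵐ ξ, ‖ξ‖ₑ ^ 2 * ‖g ξ‖ₑ ^ 2 ≤ ‖charDiff (inner ℝ z ξ)‖ₑ ^ 2 * H ξ := by
  -- `w` need not have a Fourier transform that is a function, so the transforms `v j` of its
  -- partial derivatives stand in for `ξ_j ŵ`, up to the factor `2πi`.
  have hv := fun j => exists_isFourierPair_of_memLp (memLp_fderiv_single hw hg j)
  choose v hv2 hvp hvn using hv
  have hvm : ∀ j, AEMeasurable (fun ξ => ‖v j ξ‖ₑ ^ 2) (volume : Measure (RSpace 2)) := fun j =>
    (hv2 j).1.aemeasurable.enorm.pow_const 2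
  have hdm : ∀ m, Measurable fun x => ‖fderiv ℝ w x m‖ₑ ^ 2 := fun m => by
    have := continuous_fderiv_comp_apply hw m
    fun_prop
  refine ⟨fun ξ => ‖v 0 ξ‖ₑ ^ 2 + ‖v 1 ξ‖ₑ ^ 2, (hvm 0).add (hvm 1), ?_, fun z => ?_⟩
  · rw [lintegral_add_left' (hvm 0), gradSq, lintegral_add_left (hdm _),
      (hvp 0).lintegral_eq (hv2 0), (hvp 1).lintegral_eq (hv2 1)]
  have hu := memLp_difference hw hg z
  obtain ⟨g, hg2, hgp, -⟩ := exists_isFourierPair_of_memLp hu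
  have hcd : ContDiff ℝ 1 fun x => w (x + z) - w x :=
    (hw.comp (contDiff_id.add contDiff_const)).sub hw
  -- The transform of `∂_j δ_z w = δ_z ∂_j w` computed in two ways; uniqueness links `g` to `v j`.
  have hj : ∀ j, (fun ξ : RSpace 2 => ((inner ℝ ξ (EuclideanSpace.single j (1 : ℝ)) : ℝ) : ℂ) *
      (2 * Real.pi * Complex.I * g ξ)) =ᵐ[volume] fun ξ => charDiff (inner ℝ z ξ) * v j ξ := by
    intro j
    have h1 := (hvp j).difference z
    have h2 : MemLp (fun x => fderiv ℝ (fun x => w (x + z) - w x) x (EuclideanSpace.single j 1)) 2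
        volume := by
      simp only [fderiv_difference hw]
      exact h1.memLp_left (memLp_charDiff_mul (hv2 j) z)
    have h3 := hgp.fderiv hcd (EuclideanSpace.single j 1) h2
    simp only [fderiv_difference hw] at h3
    exact h3.ae_eq_right h1
  refine ⟨g, hg2, hgp, ?_⟩
  filter_upwards [hj 0, hj 1] with ξ h0 h1
  have hle : ∀ j, ((inner ℝ ξ (EuclideanSpace.single j (1 : ℝ)) : ℝ) : ℂ) *
      (2 * Real.pi * Complex.I * g ξ) = charDiff (inner ℝ z ξ) * v j ξ →
      ‖ξ j‖ₑ ^ 2 * ‖g ξ‖ₑ ^ 2 ≤ ‖charDiff (inner ℝ z ξ)‖ₑ ^ 2 * ‖v j ξ‖ₑ ^ 2 := by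
    intro j h
    rw [← mul_pow, ← mul_pow, ← enorm_mul, ← h, ← enorm_smul]
    gcongr
    rw [enorm_le_iff_norm_le, norm_smul, norm_mul, norm_mul, norm_mul, norm_mul, Complex.norm_I,
      Complex.norm_real, Complex.norm_real, EuclideanSpace.inner_single_right]
    simp only [one_mul, conj_trivial, mul_one, Complex.norm_ofNat, Real.norm_eq_abs,
      abs_of_pos Real.pi_pos]
    gcongr
    refine le_mul_of_one_le_left (norm_nonneg _) ?_
    linarith [Real.pi_gt_three]
  rw [enorm_sq_eq_add, add_mul, mul_add]
  exact add_le_add (hle 0 h0) (hle 1 h1)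

lemma gagliardo_eq_of_memLp {f g : RSpace 2 → ℂ} (h : IsFourierPair f g)
    (hg : MemLp g 2 volume) : gagliardo f =
      ∫⁻ ξ, (∫⁻ y, gagKernel y * ‖charDiff (inner ℝ y ξ)‖ₑ ^ 2) * ‖g ξ‖ₑ ^ 2 := by
  have h0 := dirGagliardo_eq (d := 2) (E := RSpace 2) (ι := id) (π := id) measurable_id
    (fun _ _ => rfl) hg.1 (h.lintegral_difference_of_memLp hg)
  exact h0

/-- The differences of a function with square integrable gradient, in the Gagliardo seminorm. -/
theorem exists_lintegral_gagliardo_difference_le : ∃ C : ℝ≥0, ∀ w : RSpace 2 → ℂ,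
    ContDiff ℝ 1 w → gradSq w < ⊤ →
      ∫⁻ z, gagKernel z * gagliardo (fun x => w (x + z) - w x) ≤ C * gradSq w := by
  obtain ⟨C, hC⟩ := exists_lintegral_charDiff_le (volume : Measure (RSpace 2))
  refine ⟨C * C, fun w hw hg => ?_⟩
  obtain ⟨H, hH, hHi, hHz⟩ := exists_isFourierPair_difference hw hg
  -- The inner energy gives one factor `|ξ|`, and `|ξ| |g|²` is at most `|ξ|^{-1} |e^{2πi z·ξ} - 1|²
  -- H`. The outer integral in `z` gives a second `|ξ|`, which cancels the inverse and leaves `∫ H`.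
  have h1 : ∀ z, gagliardo (fun x => w (x + z) - w x) ≤
      ∫⁻ ξ, C * (‖charDiff (inner ℝ z ξ)‖ₑ ^ 2 * (‖ξ‖ₑ⁻¹ * H ξ)) := by
    intro z
    obtain ⟨g, hg2, hgp, hle⟩ := hHz z
    have heq : gagliardo (fun x => w (x + z) - w x) =
        ∫⁻ ξ, (∫⁻ y, gagKernel y * ‖charDiff (inner ℝ y ξ)‖ₑ ^ 2) * ‖g ξ‖ₑ ^ 2 :=
      gagliardo_eq_of_memLp hgp hg2
    rw [heq]
    refine lintegral_mono_ae ?_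
    have hne : ∀ᵐ ξ : RSpace 2, ξ ≠ 0 := by simp [ae_iff]
    filter_upwards [hle, hne] with ξ hξ hξ0
    have e0 : ‖ξ‖ₑ ≠ 0 := by simpa using hξ0
    calc _ ≤ C * ‖ξ‖ₑ * ‖g ξ‖ₑ ^ 2 := by
          gcongr
          exact hC ξ
      _ = C * ‖ξ‖ₑ * ‖g ξ‖ₑ ^ 2 * (‖ξ‖ₑ * ‖ξ‖ₑ⁻¹) := by
          rw [ENNReal.mul_inv_cancel e0 enorm_ne_top, mul_one]
      _ = C * (‖ξ‖ₑ⁻¹ * (‖ξ‖ₑ ^ 2 * ‖g ξ‖ₑ ^ 2)) := by ring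
      _ ≤ C * (‖ξ‖ₑ⁻¹ * (‖charDiff (inner ℝ z ξ)‖ₑ ^ 2 * H ξ)) := by gcongr
      _ = _ := by ring
  have hcm : Measurable charDiff := continuous_charDiff.measurable
  have hK : Measurable fun p : RSpace 2 × RSpace 2 =>
      gagKernel p.1 * ‖charDiff (inner ℝ p.1 p.2)‖ₑ ^ 2 := by fun_prop
  have hHm : AEMeasurable (fun ξ => C * (‖ξ‖ₑ⁻¹ * H ξ)) (volume : Measure (RSpace 2)) :=
    ((by fun_prop : Measurable fun ξ : RSpace 2 => ‖ξ‖ₑ⁻¹).aemeasurable.mul hH).const_mul _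
  calc ∫⁻ z, gagKernel z * gagliardo (fun x => w (x + z) - w x)
      ≤ ∫⁻ z, ∫⁻ ξ, gagKernel z * ‖charDiff (inner ℝ z ξ)‖ₑ ^ 2 * (C * (‖ξ‖ₑ⁻¹ * H ξ)) := by
        refine lintegral_mono fun z => (mul_le_mul' le_rfl (h1 z)).trans (le_of_eq ?_)
        rw [← lintegral_const_mul'']
        · refine lintegral_congr fun ξ => ?_
          ring
        · exact (((by fun_prop : Measurable fun ξ : RSpace 2 =>
            ‖charDiff (inner ℝ z ξ)‖ₑ ^ 2).aemeasurable.mul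
            ((by fun_prop : Measurable fun ξ : RSpace 2 => ‖ξ‖ₑ⁻¹).aemeasurable.mul hH)).const_mul _)
    _ = ∫⁻ ξ, (∫⁻ z, gagKernel z * ‖charDiff (inner ℝ z ξ)‖ₑ ^ 2) * (C * (‖ξ‖ₑ⁻¹ * H ξ)) := by
        rw [lintegral_lintegral_swap]
        · refine lintegral_congr fun ξ => ?_
          have h3 : Measurable fun z : RSpace 2 =>
            gagKernel z * ‖charDiff (inner ℝ z ξ)‖ₑ ^ 2 := by fun_prop
          rw [lintegral_mul_const _ h3]
        · have h2 : AEMeasurable (fun p : RSpace 2 × RSpace 2 => C * (‖p.2‖ₑ⁻¹ * H p.2))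
              (volume.prod volume) :=
            hHm.comp_quasiMeasurePreserving Measure.quasiMeasurePreserving_snd
          exact AEMeasurable.mul hK.aemeasurable h2
    _ ≤ ∫⁻ ξ, C * C * H ξ := by
        refine lintegral_mono fun ξ => ?_
        calc _ ≤ C * ‖ξ‖ₑ * (C * (‖ξ‖ₑ⁻¹ * H ξ)) := by
              gcongr
              exact hC ξ
          _ = C * C * (‖ξ‖ₑ * ‖ξ‖ₑ⁻¹) * H ξ := by ring
          _ ≤ C * C * 1 * H ξ := by
              gcongr
              exact ENNReal.mul_inv_le_one _
          _ = _ := by rw [mul_one]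
    _ = _ := by
        rw [lintegral_const_mul' _ _ (by finiteness), hHi]
        push_cast
        rfl

/-- The product estimate on the plane. -/
theorem exists_lintegral_mul_difference_le : ∃ C : ℝ≥0, ∀ u w : RSpace 2 → ℂ, Measurable u →
    VanishesAtInfinity u → ContDiff ℝ 1 w → gradSq w < ⊤ →
      ∫⁻ z, gagKernel z * ∫⁻ x, ‖u x‖ₑ ^ 2 * ‖w (x + z) - w x‖ₑ ^ 2 ≤
        C * (gagliardo u * gradSq w) := by
  obtain ⟨C₁, h₁⟩ := exists_lintegral_pow_four_le_gagliardo
  obtain ⟨C₂, h₂⟩ := exists_lintegral_gagliardo_difference_le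
  refine ⟨C₁ * C₂, fun u w hu huv hw hg => ?_⟩
  have hc := hw.continuous
  -- Cauchy-Schwarz puts both factors in `L⁴`. The embedding applies to the increment of `w`, which
  -- is square integrable even if `w` is not.
  have key : ∀ z, ∫⁻ x, ‖u x‖ₑ ^ 2 * ‖w (x + z) - w x‖ₑ ^ 2 ≤
      C₁ * gagliardo u * gagliardo (fun x => w (x + z) - w x) := by
    intro z
    have hm : Measurable fun x => w (x + z) - w x := by fun_prop
    have hcs := lintegral_mul_sq_le (μ := volume) (f := fun x => ‖u x‖ₑ ^ 2)
      (g := fun x => ‖w (x + z) - w x‖ₑ ^ 2) (by fun_prop) (by fun_prop)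
    simp only [← pow_mul, Nat.reduceMul] at hcs
    have h3 := h₁ u hu huv
    have h4 := h₁ _ hm (memLp_difference hw hg z).vanishesAtInfinity
    refine (ENNReal.pow_le_pow_left_iff two_ne_zero).1 (hcs.trans ((mul_le_mul' h3 h4).trans
      (le_of_eq ?_)))
    ring
  calc _ ≤ ∫⁻ z, C₁ * gagliardo u * (gagKernel z * gagliardo (fun x => w (x + z) - w x)) := by
        refine lintegral_mono fun z => (mul_le_mul' le_rfl (key z)).trans (le_of_eq ?_)
        ring
    _ = C₁ * gagliardo u * ∫⁻ z, gagKernel z * gagliardo (fun x => w (x + z) - w x) := by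
        rw [lintegral_const_mul]
        refine measurable_gagKernel.mul (Measurable.lintegral_prod_right' (f := fun p : RSpace 2 ×
          RSpace 2 => gagKernel p.2 * ∫⁻ x, ‖w (x + p.2 + p.1) - w (x + p.2) -
            (w (x + p.1) - w x)‖ₑ ^ 2) ?_)
        refine (measurable_gagKernel.comp measurable_snd).mul (Measurable.lintegral_prod_right'
          (f := fun q : (RSpace 2 × RSpace 2) × RSpace 2 => ‖w (q.2 + q.1.2 + q.1.1) -
            w (q.2 + q.1.2) - (w (q.2 + q.1.1) - w q.2)‖ₑ ^ 2) ?_)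
        fun_prop
    _ ≤ C₁ * gagliardo u * (C₂ * gradSq w) := by
        gcongr
        exact h₂ w hw hg
    _ = _ := by
        push_cast
        ring

/-! ### Horizontal slices and vertical lines in `ℝ³` -/

section Slicing

/-- The inclusion of the horizontal plane in `ℝ³`. -/
def horEmbed : RSpace 2 →L[ℝ] RSpace 3 :=
  LinearMap.toContinuousLinearMap
    { toFun := fun z => joinHV z 0
      map_add' := fun x y => by ext i; fin_cases i <;> simp [joinHV]
      map_smul' := fun c x => by ext i; fin_cases i <;> simp [joinHV] }

/-- The inclusion of the vertical axis in `ℝ³`. -/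
def vertEmbed : ℝ →L[ℝ] RSpace 3 :=
  LinearMap.toContinuousLinearMap
    { toFun := fun t => joinHV 0 t
      map_add' := fun x y => by ext i; fin_cases i <;> simp [joinHV]
      map_smul' := fun c x => by ext i; fin_cases i <;> simp [joinHV] }

lemma horEmbed_apply (z : RSpace 2) : horEmbed z = joinHV z 0 := rfl

lemma vertEmbed_apply (t : ℝ) : vertEmbed t = joinHV 0 t := rfl

lemma joinHV_eq_add (xh : RSpace 2) (x3 : ℝ) : joinHV xh x3 = horEmbed xh + vertEmbed x3 := by
  rw [horEmbed_apply, vertEmbed_apply]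
  ext i
  fin_cases i <;> simp [joinHV]

lemma joinHV_add_horEmbed (xh z : RSpace 2) (x3 : ℝ) :
    joinHV xh x3 + horEmbed z = joinHV (xh + z) x3 := by
  rw [joinHV_eq_add, joinHV_eq_add, map_add]
  abel

lemma joinHV_add_vertEmbed (xh : RSpace 2) (x3 t : ℝ) :
    joinHV xh x3 + vertEmbed t = joinHV xh (x3 + t) := by
  rw [joinHV_eq_add, joinHV_eq_add, map_add]
  abel

@[fun_prop]
lemma continuous_joinHV : Continuous fun p : RSpace 2 × ℝ => joinHV p.1 p.2 := by
  simp only [joinHV_eq_add]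
  fun_prop

@[fun_prop]
lemma Continuous.joinHV {α : Type*} [TopologicalSpace α] {f : α → RSpace 2} {g : α → ℝ}
    (hf : Continuous f) (hg : Continuous g) : Continuous fun x => joinHV (f x) (g x) :=
  continuous_joinHV.comp (hf.prodMk hg)

@[fun_prop]
lemma Measurable.joinHV {α : Type*} [MeasurableSpace α] {f : α → RSpace 2} {g : α → ℝ}
    (hf : Measurable f) (hg : Measurable g) : Measurable fun x => joinHV (f x) (g x) :=
  continuous_joinHV.measurable.comp (hf.prodMk hg)

lemma measurePreserving_joinHV :
    MeasurePreserving (fun p : ℝ × RSpace 2 => joinHV p.2 p.1) (volume.prod volume) volume := by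
  have h1 : MeasurePreserving (Prod.map (id : ℝ → ℝ) (WithLp.ofLp : RSpace 2 → (Fin 2 → ℝ)))
      (volume.prod volume) (volume.prod volume) :=
    (MeasurePreserving.id volume).prod (PiLp.volume_preserving_ofLp (Fin 2))
  have h2 := (volume_preserving_piFinSuccAbove (fun _ : Fin 3 => ℝ) (Fin.last 2)).symm
  have h3 := PiLp.volume_preserving_toLp (Fin 3)
  have h4 := h3.comp (h2.comp h1)
  have e : (fun p : ℝ × RSpace 2 => joinHV p.2 p.1) = WithLp.toLp 2 ∘
      (MeasurableEquiv.piFinSuccAbove (fun _ : Fin 3 => ℝ) (Fin.last 2)).symm ∘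
        Prod.map id WithLp.ofLp := by
    funext p
    refine PiLp.ext fun i => ?_
    fin_cases i <;> rfl
  rw [e]
  exact h4

lemma lintegral_eq_lintegral_joinHV {F : RSpace 3 → ℝ≥0∞} (hF : Measurable F) :
    ∫⁻ x, F x = ∫⁻ x3 : ℝ, ∫⁻ xh : RSpace 2, F (joinHV xh x3) := by
  rw [← measurePreserving_joinHV.lintegral_comp hF, lintegral_prod]
  exact (by fun_prop : Measurable fun p : ℝ × RSpace 2 => F (joinHV p.2 p.1)).aemeasurable

/-- The square of the horizontal Gagliardo seminorm. -/
def gagH (f : RSpace 3 → ℂ) : ℝ≥0∞ := dirGagliardo horEmbed f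

/-- The square of the vertical Gagliardo seminorm. -/
def gagV (f : RSpace 3 → ℂ) : ℝ≥0∞ := dirGagliardo vertEmbed f

/-- Stated for a general integrand because it slices both the horizontal energy and the product term
`|a|² |δ_z b|²`. -/
lemma lintegral_gagKernel_mul_horEmbed {F : RSpace 3 → RSpace 2 → ℝ≥0∞}
    (hF : Measurable fun p : RSpace 3 × RSpace 2 => F p.1 p.2) :
    ∫⁻ z, gagKernel z * ∫⁻ x, F x z =
      ∫⁻ x3 : ℝ, ∫⁻ z, gagKernel z * ∫⁻ xh, F (joinHV xh x3) z := by
  have hm : ∀ z, Measurable fun x => F x z := fun z => hF.comp (measurable_id.prodMk measurable_const)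
  have hm2 : Measurable fun q : (RSpace 2 × ℝ) × RSpace 2 => F (joinHV q.2 q.1.2) q.1.1 :=
    hF.comp (by fun_prop : Measurable fun q : (RSpace 2 × ℝ) × RSpace 2 =>
      (joinHV q.2 q.1.2, q.1.1))
  have hm3 : Measurable fun p : RSpace 2 × ℝ => ∫⁻ xh, F (joinHV xh p.2) p.1 :=
    Measurable.lintegral_prod_right' (f := fun q : (RSpace 2 × ℝ) × RSpace 2 =>
      F (joinHV q.2 q.1.2) q.1.1) hm2
  have h1 : ∀ z : RSpace 2, gagKernel z * ∫⁻ x, F x z =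
      ∫⁻ x3 : ℝ, gagKernel z * ∫⁻ xh, F (joinHV xh x3) z := fun z => by
    have h2 : Measurable fun x3 : ℝ => ∫⁻ xh, F (joinHV xh x3) z :=
      hm3.comp (by fun_prop : Measurable fun x3 : ℝ => (z, x3))
    rw [lintegral_const_mul _ h2, lintegral_eq_lintegral_joinHV (hm z)]
  simp only [h1]
  rw [lintegral_lintegral_swap]
  exact ((measurable_gagKernel.comp measurable_fst).mul hm3).aemeasurable

lemma gagH_eq_lintegral {f : RSpace 3 → ℂ} (hf : Measurable f) :
    gagH f = ∫⁻ x3 : ℝ, gagliardo fun xh => f (joinHV xh x3) := by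
  have h := lintegral_gagKernel_mul_horEmbed (F := fun x z => ‖f (x + horEmbed z) - f x‖ₑ ^ 2)
    (by fun_prop)
  simp only [joinHV_add_horEmbed] at h
  exact h

/-- Tonelli treats one threshold at a time; the thresholds `1/(n+1)` share a common null set, and
the condition for a smaller threshold implies it for a larger one. -/
lemma VanishesAtInfinity.ae_slice {f : RSpace 3 → ℂ} (hf : Measurable f)
    (h : VanishesAtInfinity f) :
    ∀ᵐ x3 : ℝ, VanishesAtInfinity fun xh => f (joinHV xh x3) := by
  have h1 : ∀ n : ℕ, ∀ᵐ x3 : ℝ, ∫⁻ xh, (‖f (joinHV xh x3)‖ₑ - ((n : ℝ≥0∞) + 1)⁻¹) ^ 2 < ⊤ := by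
    intro n
    have h2 := h ((n : ℝ≥0∞) + 1)⁻¹ (by simp)
    rw [lintegral_eq_lintegral_joinHV (by fun_prop)] at h2
    refine ae_lt_top ?_ h2.ne
    exact Measurable.lintegral_prod_right' (f := fun q : ℝ × RSpace 2 =>
      (‖f (joinHV q.2 q.1)‖ₑ - ((n : ℝ≥0∞) + 1)⁻¹) ^ 2) (by fun_prop)
  filter_upwards [ae_all_iff.2 h1] with x3 hx ε hε
  obtain ⟨n, hn⟩ := ENNReal.exists_inv_nat_lt hε.ne'
  refine (lintegral_mono fun xh => ?_).trans_lt (hx n)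
  have h3 : ((n : ℝ≥0∞) + 1)⁻¹ ≤ ε := (ENNReal.inv_le_inv.2 le_self_add).trans hn.le
  gcongr

/-- The adjoint of the inclusion of the plane is the projection `ξ ↦ ξ_h`, which does not increase
norms. -/
lemma exists_gagH_le : ∃ C : ℝ≥0, ∀ {f g : RSpace 3 → ℂ}, IsFourierPair f g →
    eLpNorm (halfWeight g) 2 volume < ⊤ → gagH f ≤ C * eLpNorm (halfWeight g) 2 volume ^ 2 := by
  obtain ⟨C, hC⟩ := exists_dirGagliardo_le (d := 3) (E := RSpace 2)
  refine ⟨C, fun h hw => hC (ι := horEmbed) (π := fun ξ => !₂[ξ 0, ξ 1]) (by fun_prop)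
    (fun z ξ => ?_) (fun ξ => ?_) h hw⟩
  · simp [horEmbed_apply, joinHV, PiLp.inner_apply, Fin.sum_univ_three, Fin.sum_univ_two]
  · rw [EuclideanSpace.norm_eq, EuclideanSpace.norm_eq]
    refine Real.sqrt_le_sqrt ?_
    simp only [Fin.sum_univ_three, Fin.sum_univ_two]
    simp
    positivity

lemma exists_gagV_le : ∃ C : ℝ≥0, ∀ {f g : RSpace 3 → ℂ}, IsFourierPair f g →
    eLpNorm (halfWeight g) 2 volume < ⊤ → gagV f ≤ C * eLpNorm (halfWeight g) 2 volume ^ 2 := by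
  obtain ⟨C, hC⟩ := exists_dirGagliardo_le (d := 3) (E := ℝ)
  refine ⟨C, fun h hw => hC (ι := vertEmbed) (π := fun ξ => ξ 2) (by fun_prop)
    (fun z ξ => ?_) (fun ξ => PiLp.norm_apply_le _ _) h hw⟩
  simp [vertEmbed_apply, joinHV, PiLp.inner_apply, Fin.sum_univ_three]

end Slicing

/-! ### Hardy's inequality and the product estimates for the energies -/

/-- Hardy's inequality. -/
theorem exists_lintegral_gagKernel_mul_le : ∃ C : ℝ≥0, ∀ w : ℝ → ℂ, ContDiff ℝ 1 w → ∀ y : ℝ,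
    ∫⁻ t, gagKernel t * ‖w (y + t) - w y‖ₑ ^ 2 ≤ C * ∫⁻ s, ‖deriv w s‖ₑ ^ 2 := by
  set I : ℝ≥0∞ := ∫⁻ θ in Set.Ioc (0 : ℝ) 1, ENNReal.ofReal (θ ^ (-(1 / 2) : ℝ)) with hI
  have hIt : I ≠ ⊤ := by
    have h1 : IntervalIntegrable (fun θ : ℝ => θ ^ (-(1 / 2) : ℝ)) volume 0 1 :=
      intervalIntegral.intervalIntegrable_rpow' (by norm_num)
    rw [intervalIntegrable_iff_integrableOn_Ioc_of_le zero_le_one] at h1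
    exact h1.lintegral_lt_top.ne
  refine ⟨(I * I).toNNReal, fun w hw y => ?_⟩
  rw [ENNReal.coe_toNNReal (ENNReal.mul_ne_top hIt hIt)]
  have hdc : Continuous (deriv w) := hw.continuous_deriv le_rfl
  set h : ℝ → ℝ≥0∞ := fun s => ‖deriv w s‖ₑ with hh
  have hhm : Measurable h := by fun_prop
  have hpt : ∀ t, gagKernel t * ‖w (y + t) - w y‖ₑ ^ 2 ≤
      I * ∫⁻ θ in Set.Ioc (0 : ℝ) 1, ENNReal.ofReal (θ ^ (1 / 2 : ℝ)) * h (y + θ • t) ^ 2 := by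
    intro t
    have hd : ∀ θ : ℝ, HasDerivAt (fun θ : ℝ => w (y + θ * t)) (deriv w (y + θ * t) * t) θ := by
      intro θ
      have h1 : HasDerivAt (fun θ : ℝ => y + θ * t) t θ := by
        simpa using ((hasDerivAt_id θ).mul_const t).const_add y
      have h2 := ((hw.differentiable one_ne_zero) (y + θ * t)).hasDerivAt.scomp θ h1
      rw [Complex.real_smul, mul_comm] at h2
      exact h2
    have h2 := intervalIntegral.integral_eq_sub_of_hasDerivAt (a := 0) (b := 1)
      (fun θ _ => hd θ) ((by fun_prop : Continuous fun θ : ℝ =>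
        deriv w (y + θ * t) * t).intervalIntegrable _ _)
    simp only [one_mul, zero_mul, add_zero] at h2
    have h3 : ‖w (y + t) - w y‖ₑ ≤ ‖t‖ₑ * ∫⁻ θ in Set.Ioc (0 : ℝ) 1, h (y + θ • t) := by
      rw [← h2, intervalIntegral.integral_of_le zero_le_one]
      refine (enorm_integral_le_lintegral_enorm _).trans (le_of_eq ?_)
      rw [← lintegral_const_mul _ (by fun_prop)]
      refine lintegral_congr fun θ => ?_
      rw [enorm_mul, mul_comm, smul_eq_mul, hh]
      congr 1
      rw [← ofReal_norm, ← ofReal_norm, Complex.norm_real]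
    -- Cauchy-Schwarz is weighted because the substitution `s = θt` below costs `θ^{-1}`: without
    -- weights the `θ` integral would diverge, with them `θ^{1/2 - 1}` is integrable.
    have h4 : (∫⁻ θ in Set.Ioc (0 : ℝ) 1, h (y + θ • t)) ^ 2 ≤
        I * ∫⁻ θ in Set.Ioc (0 : ℝ) 1, ENNReal.ofReal (θ ^ (1 / 2 : ℝ)) * h (y + θ • t) ^ 2 := by
      have hcs := lintegral_mul_sq_le (μ := volume.restrict (Set.Ioc (0 : ℝ) 1))
        (f := fun θ : ℝ => ENNReal.ofReal (θ ^ (-(1 / 4) : ℝ)))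
        (g := fun θ : ℝ => ENNReal.ofReal (θ ^ (1 / 4 : ℝ)) * h (y + θ • t))
        (by fun_prop) (by fun_prop)
      have e1 : ∫⁻ θ in Set.Ioc (0 : ℝ) 1, h (y + θ • t) = ∫⁻ θ in Set.Ioc (0 : ℝ) 1,
          ENNReal.ofReal (θ ^ (-(1 / 4) : ℝ)) *
            (ENNReal.ofReal (θ ^ (1 / 4 : ℝ)) * h (y + θ • t)) := by
        refine setLIntegral_congr_fun measurableSet_Ioc fun θ hθ => ?_
        rw [← mul_assoc, ← ENNReal.ofReal_mul (Real.rpow_nonneg hθ.1.le _),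
          ← Real.rpow_add hθ.1]
        norm_num
      have e2 : I = ∫⁻ θ in Set.Ioc (0 : ℝ) 1, ENNReal.ofReal (θ ^ (-(1 / 4) : ℝ)) ^ 2 := by
        refine setLIntegral_congr_fun measurableSet_Ioc fun θ hθ => ?_
        rw [← ENNReal.ofReal_pow (Real.rpow_nonneg hθ.1.le _), ← Real.rpow_natCast,
          ← Real.rpow_mul hθ.1.le]
        norm_num
      rw [e1, e2]
      refine hcs.trans (le_of_eq ?_)
      congr 1
      refine setLIntegral_congr_fun measurableSet_Ioc fun θ hθ => ?_
      rw [mul_pow, ← ENNReal.ofReal_pow (Real.rpow_nonneg hθ.1.le _), ← Real.rpow_natCast,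
        ← Real.rpow_mul hθ.1.le]
      norm_num
    refine le_trans ?_ h4
    have hk : gagKernel t * ‖t‖ₑ ^ 2 ≤ 1 := by
      unfold gagKernel
      simp only [Module.finrank_self, Nat.reduceAdd]
      exact ENNReal.inv_mul_le_one _
    calc gagKernel t * ‖w (y + t) - w y‖ₑ ^ 2
        ≤ gagKernel t * (‖t‖ₑ * ∫⁻ θ in Set.Ioc (0 : ℝ) 1, h (y + θ • t)) ^ 2 := by gcongr
      _ = gagKernel t * ‖t‖ₑ ^ 2 * (∫⁻ θ in Set.Ioc (0 : ℝ) 1, h (y + θ • t)) ^ 2 := by ring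
      _ ≤ 1 * (∫⁻ θ in Set.Ioc (0 : ℝ) 1, h (y + θ • t)) ^ 2 := by gcongr
      _ = _ := one_mul _
  calc _ ≤ ∫⁻ t, I * ∫⁻ θ in Set.Ioc (0 : ℝ) 1,
        ENNReal.ofReal (θ ^ (1 / 2 : ℝ)) * h (y + θ • t) ^ 2 := lintegral_mono hpt
    _ = I * ∫⁻ θ in Set.Ioc (0 : ℝ) 1, ∫⁻ t,
        ENNReal.ofReal (θ ^ (1 / 2 : ℝ)) * h (y + θ • t) ^ 2 := by
        rw [lintegral_const_mul' _ _ hIt, lintegral_lintegral_swap]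
        exact (by fun_prop : Measurable fun p : ℝ × ℝ =>
          ENNReal.ofReal (p.2 ^ (1 / 2 : ℝ)) * h (y + p.2 • p.1) ^ 2).aemeasurable
    _ = I * ∫⁻ θ in Set.Ioc (0 : ℝ) 1,
        ENNReal.ofReal (θ ^ (-(1 / 2) : ℝ)) * ∫⁻ s, h s ^ 2 := by
        congr 1
        refine setLIntegral_congr_fun measurableSet_Ioc fun θ hθ => ?_
        rw [lintegral_const_mul _ (by fun_prop), lintegral_comp_smul_of_pos volume
          (H := fun s => h (y + s) ^ 2) (by fun_prop) hθ.1,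
          lintegral_add_left_eq_self (fun s => h s ^ 2) y, Module.finrank_self, pow_one,
          ← ENNReal.ofReal_inv_of_pos hθ.1, ← mul_assoc,
          ← ENNReal.ofReal_mul (Real.rpow_nonneg hθ.1.le _), ← Real.rpow_neg_one θ,
          ← Real.rpow_add hθ.1]
        norm_num
    _ = _ := by
        rw [lintegral_mul_const _ (by fun_prop), ← mul_assoc]

/-- The Leibniz rule for increments, with `b` shifted in the first term and `a` unshifted in the
second, so that `a` can be held fixed while the increments of `b` are integrated. -/
lemma dirGagliardo_mul_le {d : ℕ} {E : Type*} [NormedAddCommGroup E] [InnerProductSpace ℝ E]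
    [FiniteDimensional ℝ E] [MeasureSpace E] [BorelSpace E] {ι : E → RSpace d} (hι : Measurable ι)
    {a b : RSpace d → ℂ} (ha : Measurable a) (hb : Measurable b) {B : ℝ≥0∞}
    (hB : ∀ x, ‖b x‖ₑ ≤ B) :
    dirGagliardo ι (fun x => a x * b x) ≤ 2 * B ^ 2 * dirGagliardo ι a +
      2 * ∫⁻ z, gagKernel z * ∫⁻ x, ‖a x‖ₑ ^ 2 * ‖b (x + ι z) - b x‖ₑ ^ 2 := by
  have hpt : ∀ x z, ‖a (x + ι z) * b (x + ι z) - a x * b x‖ₑ ^ 2 ≤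
      2 * B ^ 2 * ‖a (x + ι z) - a x‖ₑ ^ 2 + 2 * (‖a x‖ₑ ^ 2 * ‖b (x + ι z) - b x‖ₑ ^ 2) := by
    intro x z
    have e : a (x + ι z) * b (x + ι z) - a x * b x =
        b (x + ι z) * (a (x + ι z) - a x) + a x * (b (x + ι z) - b x) := by ring
    rw [e]
    refine (enorm_sq_le_two_mul_add _ _).trans ?_
    rw [enorm_mul, enorm_mul, mul_pow, mul_pow, ← mul_assoc 2]
    gcongr
    exact hB _
  have hm1 : Measurable fun z => gagKernel z * ∫⁻ x, ‖a (x + ι z) - a x‖ₑ ^ 2 :=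
    measurable_gagKernel.mul (Measurable.lintegral_prod_right' (f := fun q : E × RSpace d =>
      ‖a (q.2 + ι q.1) - a q.2‖ₑ ^ 2) (by fun_prop))
  have hm2 : Measurable fun z => gagKernel z * ∫⁻ x, ‖a x‖ₑ ^ 2 * ‖b (x + ι z) - b x‖ₑ ^ 2 :=
    measurable_gagKernel.mul (Measurable.lintegral_prod_right' (f := fun q : E × RSpace d =>
      ‖a q.2‖ₑ ^ 2 * ‖b (q.2 + ι q.1) - b q.2‖ₑ ^ 2) (by fun_prop))
  unfold dirGagliardo
  rw [← lintegral_const_mul _ hm1, ← lintegral_const_mul _ hm2,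
    ← lintegral_add_left (hm1.const_mul _)]
  refine lintegral_mono fun z => ?_
  calc _ ≤ gagKernel z * ∫⁻ x, (2 * B ^ 2 * ‖a (x + ι z) - a x‖ₑ ^ 2 +
        2 * (‖a x‖ₑ ^ 2 * ‖b (x + ι z) - b x‖ₑ ^ 2)) :=
        mul_le_mul' le_rfl (lintegral_mono fun x => hpt x z)
    _ = gagKernel z * (2 * B ^ 2 * (∫⁻ x, ‖a (x + ι z) - a x‖ₑ ^ 2) +
        2 * ∫⁻ x, ‖a x‖ₑ ^ 2 * ‖b (x + ι z) - b x‖ₑ ^ 2) := by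
        rw [lintegral_add_left (by fun_prop), lintegral_const_mul _ (by fun_prop),
          lintegral_const_mul _ (by fun_prop)]
    _ = _ := by ring

/-- The planar product estimate holds on almost every slice with the same `S`; integrating in `x_3`
reassembles the horizontal energy of `a`. -/
theorem exists_gagH_mul_le : ∃ C : ℝ≥0, ∀ a b : RSpace 3 → ℂ, Measurable a →
    VanishesAtInfinity a → ContDiff ℝ 1 b → ∀ B S : ℝ≥0∞, (∀ x, ‖b x‖ₑ ≤ B) → S < ⊤ →
    (∀ᵐ x3 : ℝ, gradSq (fun xh => b (joinHV xh x3)) ≤ S) →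
      gagH (fun x => a x * b x) ≤ C * (B ^ 2 + S) * gagH a := by
  obtain ⟨C, hC⟩ := exists_lintegral_mul_difference_le
  refine ⟨2 + 2 * C, fun a b ha hav hb B S hB hS hbS => ?_⟩
  have hbc := hb.continuous
  have hcd : ∀ x3 : ℝ, ContDiff ℝ 1 fun xh => b (joinHV xh x3) := fun x3 => by
    simp only [joinHV_eq_add]
    fun_prop
  have hfin : ∀ᵐ x3 : ℝ, ∫⁻ z, gagKernel z * ∫⁻ xh, ‖a (joinHV xh x3)‖ₑ ^ 2 *
      ‖b (joinHV (xh + z) x3) - b (joinHV xh x3)‖ₑ ^ 2 ≤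
        C * S * gagliardo fun xh => a (joinHV xh x3) := by
    filter_upwards [hbS, hav.ae_slice ha] with x3 h1 h2
    refine (hC (fun xh => a (joinHV xh x3)) (fun xh => b (joinHV xh x3)) (by fun_prop) h2
      (hcd x3) (h1.trans_lt hS)).trans ?_
    calc _ ≤ C * (gagliardo (fun xh => a (joinHV xh x3)) * S) := by gcongr
      _ = _ := by ring
  have hsec : ∫⁻ z, gagKernel z * ∫⁻ x, ‖a x‖ₑ ^ 2 * ‖b (x + horEmbed z) - b x‖ₑ ^ 2 ≤
      C * S * gagH a := by
    rw [lintegral_gagKernel_mul_horEmbed (F := fun x z => ‖a x‖ₑ ^ 2 *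
      ‖b (x + horEmbed z) - b x‖ₑ ^ 2) (by fun_prop)]
    simp only [joinHV_add_horEmbed]
    refine (lintegral_mono_ae hfin).trans (le_of_eq ?_)
    rw [lintegral_const_mul' _ _ (by finiteness), gagH_eq_lintegral ha]
  refine (dirGagliardo_mul_le (by fun_prop) ha hbc.measurable hB).trans ?_
  calc _ ≤ 2 * B ^ 2 * gagH a + 2 * (C * S * gagH a) := by
        gcongr
        exact le_rfl
    -- The added terms only complete the expansion of a single constant times `B ^ 2 + S`.
    _ ≤ 2 * B ^ 2 * gagH a + 2 * (C * S * gagH a) + (2 * S * gagH a + 2 * C * B ^ 2 * gagH a) :=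
        le_self_add
    _ = _ := by
        push_cast
        ring

lemma hasDerivAt_vertical {b : RSpace 3 → ℂ} (hb : Differentiable ℝ b) (xh : RSpace 2) (s : ℝ) :
    HasDerivAt (fun s => b (joinHV xh s)) (partialDeriv3 2 b (joinHV xh s)) s := by
  have h1 : HasDerivAt (fun s : ℝ => joinHV xh s) (EuclideanSpace.single 2 1) s := by
    simp only [joinHV_eq_add]
    have h2 : HasDerivAt (fun s : ℝ => horEmbed xh + vertEmbed s) (vertEmbed 1) s :=
      (vertEmbed.hasFDerivAt (x := s)).hasDerivAt.const_add _
    convert h2 using 1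
    rw [vertEmbed_apply]
    ext i
    fin_cases i <;> simp [joinHV]
  exact (hb _).hasFDerivAt.comp_hasDerivAt s h1

lemma continuous_partialDeriv3 {b : RSpace 3 → ℂ} (hb : ContDiff ℝ 1 b) (i : Fin 3) :
    Continuous (partialDeriv3 i b) := continuous_fderiv_comp_apply hb _

/-- Hardy's bound on each vertical line is independent of the height of the base point, so after
Cauchy-Schwarz in `x_h` the integrals over the heights of `a` and of `∂_3 b` decouple. The cost is
the horizontal energy of `a`, which controls its `L²_v L⁴_h` norm. -/
theorem exists_gagV_mul_le : ∃ C : ℝ≥0, ∀ a b : RSpace 3 → ℂ, Measurable a →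
    VanishesAtInfinity a → ContDiff ℝ 1 b → ∀ B : ℝ≥0∞, (∀ x, ‖b x‖ₑ ≤ B) →
      gagV (fun x => a x * b x) ≤ C * (B ^ 2 * gagV a + gagH a *
        ∫⁻ s : ℝ, (∫⁻ xh, ‖partialDeriv3 2 b (joinHV xh s)‖ₑ ^ 4) ^ (1 / 2 : ℝ)) := by
  obtain ⟨C₁, h₁⟩ := exists_lintegral_pow_four_le_gagliardo
  obtain ⟨C₂, h₂⟩ := exists_lintegral_gagKernel_mul_le
  set r : ℝ≥0∞ := (C₁ : ℝ≥0∞) ^ (1 / 2 : ℝ) with hr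
  have hrt : r ≠ ⊤ := ENNReal.rpow_ne_top_of_nonneg (by norm_num) ENNReal.coe_ne_top
  refine ⟨2 + 2 * (C₂ * r.toNNReal), fun a b ha hav hb B hB => ?_⟩
  have hbc := hb.continuous
  have hbm : Measurable b := hbc.measurable
  have hpc := continuous_partialDeriv3 hb 2
  have hder := fun xh s => hasDerivAt_vertical (hb.differentiable one_ne_zero) xh s
  generalize partialDeriv3 2 b = p at hpc hder ⊢
  have hpm : Measurable p := hpc.measurable
  set A : ℝ → ℝ≥0∞ := fun y => (∫⁻ xh, ‖a (joinHV xh y)‖ₑ ^ 4) ^ (1 / 2 : ℝ) with hA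
  set D : ℝ → ℝ≥0∞ := fun s => (∫⁻ xh, ‖p (joinHV xh s)‖ₑ ^ 4) ^ (1 / 2 : ℝ) with hD
  have hDm : Measurable D :=
    (Measurable.lintegral_prod_right' (f := fun q : ℝ × RSpace 2 =>
      ‖p (joinHV q.2 q.1)‖ₑ ^ 4) (by fun_prop)).pow_const _
  have hAm : Measurable A :=
    (Measurable.lintegral_prod_right' (f := fun q : ℝ × RSpace 2 =>
      ‖a (joinHV q.2 q.1)‖ₑ ^ 4) (by fun_prop)).pow_const _
  have hAint : ∫⁻ y, A y ≤ r * gagH a := by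
    rw [gagH_eq_lintegral ha, ← lintegral_const_mul' _ _ hrt]
    refine lintegral_mono_ae ?_
    filter_upwards [hav.ae_slice ha] with y hy
    calc A y ≤ (C₁ * gagliardo (fun xh => a (joinHV xh y)) ^ 2) ^ (1 / 2 : ℝ) := by
          exact ENNReal.rpow_le_rpow (h₁ _ (by fun_prop) hy) (by norm_num)
      _ = _ := by
          rw [ENNReal.mul_rpow_of_nonneg _ _ (by norm_num), ← ENNReal.rpow_two,
            ← ENNReal.rpow_mul]
          norm_num [hr]
  have hcs : ∀ y s, ∫⁻ xh, ‖a (joinHV xh y)‖ₑ ^ 2 * ‖p (joinHV xh s)‖ₑ ^ 2 ≤ A y * D s := by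
    intro y s
    have h := lintegral_mul_sq_le (μ := volume) (f := fun xh => ‖a (joinHV xh y)‖ₑ ^ 2)
      (g := fun xh => ‖p (joinHV xh s)‖ₑ ^ 2) (by fun_prop) (by fun_prop)
    simp only [← pow_mul, Nat.reduceMul] at h
    refine (ENNReal.pow_le_pow_left_iff two_ne_zero).1 (h.trans (le_of_eq ?_))
    rw [mul_pow, hA, hD]
    simp only [← ENNReal.rpow_two, ← ENNReal.rpow_mul]
    norm_num
  have hhardy : ∀ xh y, ∫⁻ t, gagKernel t * ‖b (joinHV xh (y + t)) - b (joinHV xh y)‖ₑ ^ 2 ≤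
      C₂ * ∫⁻ s, ‖p (joinHV xh s)‖ₑ ^ 2 := by
    intro xh y
    have hw : ContDiff ℝ 1 fun s => b (joinHV xh s) := by
      simp only [joinHV_eq_add]
      fun_prop
    have h := h₂ _ hw y
    have hd : deriv (fun s => b (joinHV xh s)) = fun s => p (joinHV xh s) :=
      funext fun s => (hder xh s).deriv
    rwa [hd] at h
  have hsec : ∫⁻ t, gagKernel t * ∫⁻ x, ‖a x‖ₑ ^ 2 * ‖b (x + vertEmbed t) - b x‖ₑ ^ 2 ≤
      C₂ * (r * gagH a * ∫⁻ s, D s) := by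
    have hFm : Measurable fun q : RSpace 3 × ℝ =>
        gagKernel q.2 * ‖b (q.1 + vertEmbed q.2) - b q.1‖ₑ ^ 2 := by fun_prop
    calc ∫⁻ t, gagKernel t * ∫⁻ x, ‖a x‖ₑ ^ 2 * ‖b (x + vertEmbed t) - b x‖ₑ ^ 2
        = ∫⁻ x, ‖a x‖ₑ ^ 2 * ∫⁻ t, gagKernel t * ‖b (x + vertEmbed t) - b x‖ₑ ^ 2 := by
          have e1 : ∀ t : ℝ, gagKernel t * ∫⁻ x, ‖a x‖ₑ ^ 2 * ‖b (x + vertEmbed t) - b x‖ₑ ^ 2 =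
              ∫⁻ x, gagKernel t * (‖a x‖ₑ ^ 2 * ‖b (x + vertEmbed t) - b x‖ₑ ^ 2) := fun t =>
            (lintegral_const_mul _ (by fun_prop)).symm
          have e2 : ∀ x, ‖a x‖ₑ ^ 2 * ∫⁻ t, gagKernel t * ‖b (x + vertEmbed t) - b x‖ₑ ^ 2 =
              ∫⁻ t, gagKernel t * (‖a x‖ₑ ^ 2 * ‖b (x + vertEmbed t) - b x‖ₑ ^ 2) := fun x => by
            rw [← lintegral_const_mul _ (by fun_prop)]
            refine lintegral_congr fun t => ?_
            ring
          simp only [e1, e2]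
          rw [lintegral_lintegral_swap]
          exact (by fun_prop : Measurable fun q : ℝ × RSpace 3 => gagKernel q.1 *
            (‖a q.2‖ₑ ^ 2 * ‖b (q.2 + vertEmbed q.1) - b q.2‖ₑ ^ 2)).aemeasurable
      _ = ∫⁻ y : ℝ, ∫⁻ xh, ‖a (joinHV xh y)‖ₑ ^ 2 *
            ∫⁻ t, gagKernel t * ‖b (joinHV xh (y + t)) - b (joinHV xh y)‖ₑ ^ 2 := by
          have hm : Measurable fun x => ‖a x‖ₑ ^ 2 *
              ∫⁻ t, gagKernel t * ‖b (x + vertEmbed t) - b x‖ₑ ^ 2 :=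
            (by fun_prop : Measurable fun x => ‖a x‖ₑ ^ 2).mul
              (Measurable.lintegral_prod_right' hFm)
          rw [lintegral_eq_lintegral_joinHV hm]
          simp only [joinHV_add_vertEmbed]
      _ ≤ ∫⁻ y : ℝ, ∫⁻ xh, ∫⁻ s, C₂ * (‖a (joinHV xh y)‖ₑ ^ 2 * ‖p (joinHV xh s)‖ₑ ^ 2) := by
          refine lintegral_mono fun y => lintegral_mono fun xh => ?_
          rw [lintegral_const_mul _ (by fun_prop), lintegral_const_mul _ (by fun_prop)]
          refine (mul_le_mul' le_rfl (hhardy xh y)).trans (le_of_eq ?_)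
          ring
      _ ≤ ∫⁻ y : ℝ, ∫⁻ s : ℝ, C₂ * (A y * D s) := by
          refine lintegral_mono fun y => ?_
          rw [lintegral_lintegral_swap]
          · refine lintegral_mono fun s => ?_
            rw [lintegral_const_mul _ (by fun_prop)]
            exact mul_le_mul' le_rfl (hcs y s)
          · exact (by fun_prop : Measurable fun q : RSpace 2 × ℝ => (C₂ : ℝ≥0∞) *
              (‖a (joinHV q.1 y)‖ₑ ^ 2 * ‖p (joinHV q.1 q.2)‖ₑ ^ 2)).aemeasurable
      _ = C₂ * ((∫⁻ y, A y) * ∫⁻ s, D s) := by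
          have e3 : ∀ y, ∫⁻ s : ℝ, C₂ * (A y * D s) = A y * (C₂ * ∫⁻ s, D s) := fun y => by
            rw [lintegral_const_mul _ (hDm.const_mul _), lintegral_const_mul _ hDm]
            ring
          simp only [e3]
          rw [lintegral_mul_const _ hAm]
          ring
      _ ≤ _ := by gcongr
  refine (dirGagliardo_mul_le (by fun_prop) ha hbc.measurable hB).trans ?_
  calc _ ≤ 2 * B ^ 2 * gagV a + 2 * (C₂ * (r * gagH a * ∫⁻ s, D s)) := by
        gcongr
        exact le_rfl
    _ ≤ 2 * B ^ 2 * gagV a + 2 * (C₂ * (r * gagH a * ∫⁻ s, D s)) +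
        (2 * (C₂ * r) * (B ^ 2 * gagV a) + 2 * (gagH a * ∫⁻ s, D s)) := le_self_add
    _ = _ := by
        push_cast
        rw [ENNReal.coe_toNNReal hrt]
        ring

/-! ### Duality with `L²(|ξ|^{-1} dξ)` -/

/-- A linear functional dominated by the norm of a linear map into a Hilbert space is represented
by a vector of that space. -/
lemma exists_inner_eq_of_norm_le {V H : Type*} [AddCommGroup V] [Module ℂ V]
    [NormedAddCommGroup H] [InnerProductSpace ℂ H] [CompleteSpace H] (l : V →ₗ[ℂ] ℂ)
    (K : V →ₗ[ℂ] H) {M : ℝ} (hM : 0 ≤ M) (h : ∀ v, ‖l v‖ ≤ M * ‖K v‖) :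
    ∃ w : H, ‖w‖ ≤ M ∧ ∀ v, inner ℂ w (K v) = l v := by
  -- The bound makes `l` vanish on the kernel of `K`, so it descends to the range; Hahn-Banach
  -- extends it to `H`, where the Riesz theorem applies.
  obtain ⟨L, hL, hLn⟩ := exists_extension_norm_eq _ (l.compLeftInverse K)
  refine ⟨(InnerProductSpace.toDual ℂ H).symm L, ?_, fun v => ?_⟩
  · rw [LinearIsometryEquiv.norm_map, hLn]
    refine ContinuousLinearMap.opNorm_le_bound _ hM ?_
    rintro ⟨_, v, rfl⟩
    rw [LinearMap.compLeftInverse_apply_of_bdd l K ⟨M, h⟩ v _ rfl]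
    exact h v
  · rw [InnerProductSpace.toDual_symm_apply]
    exact (hL ⟨K v, v, rfl⟩).trans (LinearMap.compLeftInverse_apply_of_bdd l K ⟨M, h⟩ v _ rfl)

section NegativeWeight

variable {d : ℕ}

/-- Multiplication by `|ξ|^{-1/2}`. -/
def negHalfWeight (h : RSpace d → ℂ) (ξ : RSpace d) : ℂ :=
  ((‖ξ‖ ^ (-(1 / 2) : ℝ) : ℝ) : ℂ) * h ξ

lemma norm_negHalfWeight (h : RSpace d → ℂ) (ξ : RSpace d) :
    ‖negHalfWeight h ξ‖ = ‖ξ‖ ^ (-(1 / 2) : ℝ) * ‖h ξ‖ := by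
  rw [negHalfWeight, norm_mul, Complex.norm_real, Real.norm_of_nonneg (by positivity)]

lemma aestronglyMeasurable_negHalfWeight {h : RSpace d → ℂ} (hh : AEStronglyMeasurable h volume) :
    AEStronglyMeasurable (negHalfWeight h) volume :=
  (Measurable.aestronglyMeasurable (by fun_prop)).mul hh

/-- `|ξ|^{-1}` is locally integrable because `d ≥ 2`. -/
lemma memLp_negHalfWeight_ball (hd : 2 ≤ d) {h : RSpace d → ℂ}
    (hh : AEStronglyMeasurable h volume) {c : ℝ} (hc : ∀ ξ, ‖h ξ‖ ≤ c) (r : ℝ) :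
    MemLp (negHalfWeight h) 2 (volume.restrict (Metric.ball 0 r)) := by
  have hm := aestronglyMeasurable_negHalfWeight hh
  rw [memLp_two_iff_integrable_sq_norm hm.restrict]
  refine integrableOn_ball_of_norm_le_rpow (C := c ^ 2) (α := 1) (by simp; omega)
    (by simp; omega) (Filter.Eventually.of_forall fun ξ => ?_) (hm.norm.pow 2)
  rw [norm_pow, norm_norm, norm_negHalfWeight, mul_pow, ← Real.rpow_natCast (‖ξ‖ ^ _),
    ← Real.rpow_mul (norm_nonneg _), mul_comm]
  have := hc ξ
  norm_num
  gcongr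

lemma memLp_negHalfWeight_schwartz (hd : 2 ≤ d) (ψ : 𝓢(RSpace d, ℂ)) :
    MemLp (negHalfWeight ψ) 2 volume := by
  have hm := aestronglyMeasurable_negHalfWeight (ψ.continuous.aestronglyMeasurable (μ := volume))
  obtain ⟨c, -, hc⟩ := ψ.decay 0 0
  have h1 : MemLp (negHalfWeight ψ) 2 (volume.restrict (Metric.ball 0 1)) :=
    memLp_negHalfWeight_ball hd ψ.continuous.aestronglyMeasurable (c := c)
      (fun ξ => by simpa using hc ξ) 1
  have h2 : MemLp (negHalfWeight ψ) 2 (volume.restrict (Metric.ball 0 1)ᶜ) := by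
    refine MemLp.of_le ((ψ.memLp 2 volume).restrict _) hm.restrict ?_
    filter_upwards [self_mem_ae_restrict Metric.isOpen_ball.measurableSet.compl] with ξ hξ
    have hξ' : 1 ≤ ‖ξ‖ := by simpa using hξ
    rw [norm_negHalfWeight]
    exact mul_le_of_le_one_left (norm_nonneg _)
      (Real.rpow_le_one_of_one_le_of_nonpos hξ' (by norm_num))
  rw [memLp_two_iff_integrable_sq_norm hm.restrict] at h1 h2
  rw [memLp_two_iff_integrable_sq_norm hm, ← integrableOn_univ,
    ← Set.union_compl_self (Metric.ball 0 1)]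
  exact IntegrableOn.union h1 h2

/-- On a ball both `|ξ|^{-1/2}` and `h` are square integrable. This makes the density found by
duality locally integrable, as the norm requires. -/
lemma MeasureTheory.MemLp.locallyIntegrable_negHalfWeight (hd : 2 ≤ d) {h : RSpace d → ℂ}
    (hh : MemLp h 2 volume) : LocallyIntegrable (negHalfWeight h) volume := by
  rw [locallyIntegrable_iff]
  intro K hK
  obtain ⟨R, -, hR⟩ := hK.isBounded.exists_pos_norm_lt
  refine IntegrableOn.mono_set ?_ (fun x hx => mem_ball_zero_iff.2 (hR x hx) :
    K ⊆ Metric.ball 0 R)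
  have h1 := memLp_negHalfWeight_ball hd (h := fun _ => 1) aestronglyMeasurable_const
    (c := 1) (by simp) R
  refine (h1.integrable_mul (hh.restrict (Metric.ball 0 R))).congr
    (Filter.Eventually.of_forall fun ξ => ?_)
  simp [negHalfWeight]

lemma halfWeight_negHalfWeight_ae_eq [Nontrivial (RSpace d)] (h : RSpace d → ℂ) :
    halfWeight (negHalfWeight h) =ᵐ[volume] h := by
  have : ∀ᵐ ξ : RSpace d, ξ ≠ 0 := by simp [ae_iff]
  filter_upwards [this] with ξ hξ
  rw [halfWeight, negHalfWeight, ← mul_assoc, ← Complex.ofReal_mul,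
    ← Real.rpow_add (norm_pos_iff.2 hξ)]
  simp

lemma negHalfWeight_mul_halfWeight_ae_eq [Nontrivial (RSpace d)] (g h : RSpace d → ℂ) :
    (fun ξ => negHalfWeight g ξ * halfWeight h ξ) =ᵐ[volume] fun ξ => g ξ * h ξ := by
  filter_upwards [halfWeight_negHalfWeight_ae_eq fun _ => 1] with ξ hξ
  simp only [halfWeight, negHalfWeight, mul_one] at hξ ⊢
  linear_combination (g ξ * h ξ) * hξ

/-- A functional bounded by the norm of `Ḣ^{-1/2}` is given by a function in `L²(|ξ| dξ)`. -/
theorem exists_eq_integral_of_norm_le (hd : 2 ≤ d) (l : 𝓢(RSpace d, ℂ) →ₗ[ℂ] ℂ) {M : ℝ≥0}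
    (h : ∀ ψ, ‖l ψ‖ₑ ≤ M * eLpNorm (negHalfWeight ψ) 2 volume) :
    ∃ g : RSpace d → ℂ, LocallyIntegrable g volume ∧ (∀ ψ, l ψ = ∫ ξ, ψ ξ * g ξ) ∧
      eLpNorm (halfWeight g) 2 volume ≤ M := by
  have : Nonempty (Fin d) := ⟨⟨0, by omega⟩⟩
  have : Nontrivial (RSpace d) := inferInstance
  let K : 𝓢(RSpace d, ℂ) →ₗ[ℂ] Lp ℂ 2 (volume : Measure (RSpace d)) :=
    { toFun := fun ψ => (memLp_negHalfWeight_schwartz hd ψ).toLp _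
      map_add' := fun ψ φ => by
        rw [← MemLp.toLp_add]
        congr 1
        ext ξ
        simp [negHalfWeight, mul_add]
      map_smul' := fun c ψ => by
        rw [RingHom.id_apply, ← MemLp.toLp_const_smul]
        congr 1
        ext ξ
        simp [negHalfWeight, mul_left_comm] }
  have hK : ∀ ψ, ‖l ψ‖ ≤ M * ‖K ψ‖ := fun ψ => by
    have hn : ‖K ψ‖ₑ = eLpNorm (negHalfWeight ψ) 2 volume := Lp.enorm_toLp (memLp_negHalfWeight_schwartz hd ψ)
    have h1 := h ψ
    rw [← hn, ← ofReal_norm, ← ofReal_norm, ← ENNReal.ofReal_coe_nnreal,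
      ← ENNReal.ofReal_mul (by positivity), ENNReal.ofReal_le_ofReal_iff (by positivity)] at h1
    exact h1
  obtain ⟨w, hw, hwl⟩ := exists_inner_eq_of_norm_le l K M.2 hK
  -- The conjugate undoes the conjugate-linearity of the inner product in its first argument.
  have hmem : MemLp (fun ξ => starRingEnd ℂ (w ξ)) 2 volume := (Lp.memLp w).star
  refine ⟨negHalfWeight fun ξ => starRingEnd ℂ (w ξ), hmem.locallyIntegrable_negHalfWeight hd,
    fun ψ => ?_, ?_⟩
  · rw [← hwl, L2.inner_def]
    refine integral_congr_ae ?_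
    filter_upwards [(memLp_negHalfWeight_schwartz hd ψ).coeFn_toLp] with ξ hξ
    change inner ℂ (w ξ) ((memLp_negHalfWeight_schwartz hd ψ).toLp _ ξ) = _
    rw [hξ, RCLike.inner_apply]
    simp only [negHalfWeight]
    ring
  · rw [eLpNorm_congr_ae (halfWeight_negHalfWeight_ae_eq _)]
    have h1 : eLpNorm (fun ξ => starRingEnd ℂ (w ξ)) 2 volume = eLpNorm w 2 volume :=
      eLpNorm_congr_norm_ae (Filter.Eventually.of_forall fun ξ => by simp)
    rw [h1, ← Lp.enorm_def, ← ofReal_norm, ← ENNReal.ofReal_coe_nnreal]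
    exact ENNReal.ofReal_le_ofReal hw

end NegativeWeight

/-! ### Soft thresholding and the return from energies to the norm -/

/-- The map shrinking the modulus of a complex number by `ε`. -/
def softThreshold (ε : ℝ) (w : ℂ) : ℂ := ((max 0 (1 - ε / ‖w‖) : ℝ) : ℂ) * w

lemma measurable_softThreshold (ε : ℝ) : Measurable (softThreshold ε) := by
  unfold softThreshold
  fun_prop

lemma norm_softThreshold {ε : ℝ} (hε : 0 ≤ ε) (w : ℂ) :
    ‖softThreshold ε w‖ = max 0 (‖w‖ - ε) := by
  rw [softThreshold, norm_mul, Complex.norm_real, Real.norm_of_nonneg (le_max_left _ _)]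
  rcases eq_or_ne w 0 with rfl | hw
  · simp [hε]
  · have hw' : 0 < ‖w‖ := norm_pos_iff.2 hw
    rw [max_mul_of_nonneg _ _ hw'.le]
    congr 1
    · simp
    · field_simp

lemma norm_softThreshold_le {ε : ℝ} (hε : 0 ≤ ε) (w : ℂ) : ‖softThreshold ε w‖ ≤ ‖w‖ := by
  rw [norm_softThreshold hε]
  exact max_le (norm_nonneg _) (by linarith)

lemma norm_sub_softThreshold_le {ε : ℝ} (hε : 0 ≤ ε) (w : ℂ) : ‖w - softThreshold ε w‖ ≤ ε := by
  rcases eq_or_ne w 0 with rfl | hw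
  · simpa [softThreshold] using hε
  have hw' : 0 < ‖w‖ := norm_pos_iff.2 hw
  have e : w - softThreshold ε w = ((1 - max 0 (1 - ε / ‖w‖) : ℝ) : ℂ) * w := by
    rw [softThreshold, Complex.ofReal_sub]
    push_cast
    ring
  have h1 : (0 : ℝ) ≤ 1 - max 0 (1 - ε / ‖w‖) := by
    rw [sub_nonneg]
    have : 0 ≤ ε / ‖w‖ := by positivity
    exact max_le zero_le_one (by linarith)
  rw [e, norm_mul, Complex.norm_real, Real.norm_of_nonneg h1]
  calc (1 - max 0 (1 - ε / ‖w‖)) * ‖w‖ ≤ (ε / ‖w‖) * ‖w‖ := by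
        gcongr
        have := le_max_right 0 (1 - ε / ‖w‖)
        linarith
    _ = ε := by field_simp

lemma norm_softThreshold_sub_le {ε : ℝ} (hε : 0 ≤ ε) (w v : ℂ) :
    ‖softThreshold ε w - softThreshold ε v‖ ≤ ‖w - v‖ := by
  set l := max 0 (1 - ε / ‖w‖) with hl
  set m := max 0 (1 - ε / ‖v‖) with hm
  have hl1 : l ≤ 1 := max_le zero_le_one (by linarith [div_nonneg hε (norm_nonneg w)])
  have hm1 : m ≤ 1 := max_le zero_le_one (by linarith [div_nonneg hε (norm_nonneg v)])
  have hl0 : 0 ≤ l := le_max_left _ _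
  have hm0 : 0 ≤ m := le_max_left _ _
  have hlw : l * ‖w‖ = max 0 (‖w‖ - ε) := by
    rw [← norm_softThreshold hε, softThreshold, norm_mul, Complex.norm_real,
      Real.norm_of_nonneg hl0]
  have hmv : m * ‖v‖ = max 0 (‖v‖ - ε) := by
    rw [← norm_softThreshold hε, softThreshold, norm_mul, Complex.norm_real,
      Real.norm_of_nonneg hm0]
  have hd : |l * ‖w‖ - m * ‖v‖| ≤ |‖w‖ - ‖v‖| := by
    rw [hlw, hmv, max_comm 0, max_comm 0]
    refine (abs_max_sub_max_le_abs _ _ _).trans (le_of_eq ?_)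
    congr 1
    ring
  have hi : inner ℝ w v ≤ ‖w‖ * ‖v‖ := real_inner_le_norm w v
  have e1 := norm_sub_sq_real w v
  have e2 : ‖softThreshold ε w - softThreshold ε v‖ ^ 2 =
      (l * ‖w‖) ^ 2 - 2 * (l * m * inner ℝ w v) + (m * ‖v‖) ^ 2 := by
    have h1 : softThreshold ε w = l • w := by rw [softThreshold, Complex.real_smul]
    have h2 : softThreshold ε v = m • v := by rw [softThreshold, Complex.real_smul]
    rw [h1, h2, norm_sub_sq_real, norm_smul, norm_smul, real_inner_smul_left,
      real_inner_smul_right, Real.norm_of_nonneg hl0, Real.norm_of_nonneg hm0]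
    ring
  have h3 : l * m ≤ 1 := mul_le_one₀ hl1 hm0 hm1
  have h4 := sq_le_sq.2 hd
  refine abs_le_of_sq_le_sq' ?_ (norm_nonneg _) |>.2
  -- Here `|w - v|² = (|w| - |v|)² + 2(|w||v| - ⟨w, v⟩)`, and the thresholded difference has the
  -- same form with `l|w|`, `m|v|` and a factor `lm ≤ 1` on the second term.
  nlinarith [mul_nonneg (sub_nonneg.2 h3) (sub_nonneg.2 hi)]

/-- The modulus after thresholding is exactly the excess of `|f|` over `ε`. -/
lemma VanishesAtInfinity.memLp_softThreshold {d : ℕ} {f : RSpace d → ℂ} (hv : VanishesAtInfinity f)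
    (hf : Measurable f) {ε : ℝ} (hε : 0 < ε) :
    MemLp (fun x => softThreshold ε (f x)) 2 volume := by
  have hm : Measurable fun x => softThreshold ε (f x) := (measurable_softThreshold ε).comp hf
  rw [memLp_two_iff hm.aestronglyMeasurable]
  refine lt_of_le_of_lt (le_of_eq (lintegral_congr fun x => ?_))
    (hv (ENNReal.ofReal ε) (by simpa using hε))
  rw [← ofReal_norm, norm_softThreshold hε.le, ← ofReal_norm, ← ENNReal.ofReal_sub _ hε.le]
  congr 1
  rcases le_total (‖f x‖ - ε) 0 with h | h
  · rw [max_eq_left h, ENNReal.ofReal_of_nonpos h, ENNReal.ofReal_zero]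
  · rw [max_eq_right h]

lemma dirGagliardo_softThreshold_le {d : ℕ} {E : Type*} [NormedAddCommGroup E] [InnerProductSpace ℝ E]
    [MeasureSpace E] (ι : E → RSpace d) (f : RSpace d → ℂ) {ε : ℝ} (hε : 0 ≤ ε) :
    dirGagliardo ι (fun x => softThreshold ε (f x)) ≤ dirGagliardo ι f := by
  unfold dirGagliardo
  gcongr
  exact enorm_le_iff_norm_le.2 (norm_softThreshold_sub_le hε _ _)

lemma enorm_le_horizontal_add_vertical (ξ : RSpace 3) :
    ‖ξ‖ₑ ≤ ‖(!₂[ξ 0, ξ 1] : RSpace 2)‖ₑ + ‖ξ 2‖ₑ := by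
  rw [← ofReal_norm, ← ofReal_norm, ← ofReal_norm, ← ENNReal.ofReal_add (norm_nonneg _)
    (norm_nonneg _)]
  refine ENNReal.ofReal_le_ofReal (abs_le_of_sq_le_sq' ?_ (by positivity)).2
  have h0 : 0 ≤ ‖(!₂[ξ 0, ξ 1] : RSpace 2)‖ * ‖ξ 2‖ := by positivity
  rw [add_sq, EuclideanSpace.norm_sq_eq, EuclideanSpace.norm_sq_eq]
  simp only [Fin.sum_univ_three, Fin.sum_univ_two]
  simp only [Matrix.cons_val_zero, Matrix.cons_val_one]
  linarith

/-- `|ξ| ≤ |ξ_h| + |ξ_3|`, and the lower bound for the symbol integral applies to each part in its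
own dimension. -/
lemma exists_eLpNorm_halfWeight_sq_le : ∃ C : ℝ≥0, ∀ f g : RSpace 3 → ℂ, MemLp f 2 volume →
    IsFourierPair f g → eLpNorm (halfWeight g) 2 volume ^ 2 ≤ C * (gagH f + gagV f) := by
  obtain ⟨C₁, h₁⟩ := exists_le_lintegral_charDiff (volume : Measure (RSpace 2))
  obtain ⟨C₂, h₂⟩ := exists_le_lintegral_charDiff (volume : Measure ℝ)
  refine ⟨C₁ + C₂, fun f g hf h => ?_⟩
  have hg := h.memLp_right hf
  have eH := dirGagliardo_eq (ι := horEmbed) (π := fun ξ => !₂[ξ 0, ξ 1]) (by fun_prop)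
    (fun z ξ => by
      simp [horEmbed_apply, joinHV, PiLp.inner_apply, Fin.sum_univ_three, Fin.sum_univ_two])
    hg.1 (h.lintegral_difference_of_memLp hg)
  have eV := dirGagliardo_eq (ι := vertEmbed) (π := fun ξ => ξ 2) (by fun_prop)
    (fun z ξ => by simp [vertEmbed_apply, joinHV, PiLp.inner_apply, Fin.sum_univ_three])
    hg.1 (h.lintegral_difference_of_memLp hg)
  have hc : Measurable charDiff := continuous_charDiff.measurable
  have hm : Measurable fun ξ : RSpace 3 =>
      ∫⁻ z : RSpace 2, gagKernel z * ‖charDiff (inner ℝ z !₂[ξ 0, ξ 1])‖ₑ ^ 2 :=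
    Measurable.lintegral_prod_right' (f := fun q : RSpace 3 × RSpace 2 =>
      gagKernel q.2 * ‖charDiff (inner ℝ q.2 !₂[q.1 0, q.1 1])‖ₑ ^ 2) (by fun_prop)
  rw [eLpNorm_halfWeight_sq]
  calc ∫⁻ ξ, ‖ξ‖ₑ * ‖g ξ‖ₑ ^ 2
      ≤ ∫⁻ ξ : RSpace 3, (C₁ * ((∫⁻ z : RSpace 2,
          gagKernel z * ‖charDiff (inner ℝ z !₂[ξ 0, ξ 1])‖ₑ ^ 2) * ‖g ξ‖ₑ ^ 2) +
          C₂ * ((∫⁻ t : ℝ, gagKernel t * ‖charDiff (inner ℝ t (ξ 2))‖ₑ ^ 2) * ‖g ξ‖ₑ ^ 2)) := by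
        refine lintegral_mono fun ξ => ?_
        rw [← mul_assoc, ← mul_assoc, ← add_mul]
        gcongr
        exact (enorm_le_horizontal_add_vertical ξ).trans (add_le_add (h₁ _) (h₂ _))
    _ = C₁ * gagH f + C₂ * gagV f := by
        rw [lintegral_add_left', lintegral_const_mul' _ _ (by simp),
          lintegral_const_mul' _ _ (by simp), ← eH, ← eV]
        · rfl
        · exact (hm.aemeasurable.mul (hg.1.aemeasurable.enorm.pow_const 2)).const_mul _
    _ ≤ C₁ * gagH f + C₂ * gagV f + (C₁ * gagV f + C₂ * gagH f) := le_self_add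
    _ = _ := by
        push_cast
        ring

/-- Cauchy-Schwarz with the weights `|ξ|^{-1/2}` and `|ξ|^{1/2}`, whose product is `1` almost
everywhere. -/
lemma enorm_integral_mul_le {d : ℕ} (hd : 2 ≤ d) (ψ : 𝓢(RSpace d, ℂ)) {g : RSpace d → ℂ}
    (hg : AEStronglyMeasurable g volume) : ‖∫ ξ, ψ ξ * g ξ‖ₑ ≤
      eLpNorm (halfWeight g) 2 volume * eLpNorm (negHalfWeight ψ) 2 volume := by
  have : Nonempty (Fin d) := ⟨⟨0, by omega⟩⟩
  rw [← integral_congr_ae (negHalfWeight_mul_halfWeight_ae_eq ψ g)]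
  refine (enorm_integral_le_lintegral_enorm _).trans ?_
  simp only [enorm_mul]
  refine (ENNReal.pow_le_pow_left_iff two_ne_zero).1 ?_
  rw [mul_comm (eLpNorm _ _ _), mul_pow, eLpNorm_two_sq, eLpNorm_two_sq]
  have hw : AEStronglyMeasurable (halfWeight g) volume :=
    (Measurable.aestronglyMeasurable (by fun_prop)).mul hg
  exact lintegral_mul_sq_le (memLp_negHalfWeight_schwartz hd ψ).1.aemeasurable.enorm
    hw.aemeasurable.enorm

lemma tendsto_integral_mul_softThreshold {d : ℕ} {f : RSpace d → ℂ} (hf : Measurable f)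
    (hint : ∀ ψ : 𝓢(RSpace d, ℂ), Integrable fun x => ψ x * f x) (ψ : 𝓢(RSpace d, ℂ)) :
    Filter.Tendsto (fun n : ℕ => ∫ x, ψ x * softThreshold (1 / ((n : ℝ) + 1)) (f x)) Filter.atTop
      (nhds (∫ x, ψ x * f x)) := by
  have hε0 : ∀ n : ℕ, (0 : ℝ) ≤ 1 / ((n : ℝ) + 1) := fun n => by positivity
  refine tendsto_integral_of_dominated_convergence (fun x => ‖ψ x * f x‖)
    (fun n => ?_) (hint ψ).norm (fun n => Filter.Eventually.of_forall fun x => ?_)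
    (Filter.Eventually.of_forall fun x => ?_)
  · exact ψ.continuous.aestronglyMeasurable.mul
      ((measurable_softThreshold _).comp hf).aestronglyMeasurable
  · rw [norm_mul, norm_mul]
    exact mul_le_mul_of_nonneg_left (norm_softThreshold_le (hε0 n) _) (norm_nonneg _)
  · refine Filter.Tendsto.const_mul _ ?_
    rw [tendsto_iff_norm_sub_tendsto_zero]
    refine squeeze_zero (fun _ => norm_nonneg _) (fun n => ?_)
      (tendsto_one_div_add_atTop_nhds_zero_nat (𝕜 := ℝ))
    rw [norm_sub_rev]
    exact norm_sub_softThreshold_le (hε0 n) _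

/-- Duality yields a density `g` of `𝓕 T`, and the pair `(T, g)` competes in the infimum that
defines the norm. -/
lemma homSobolevNorm_le {d : ℕ} (hd : 2 ≤ d) {f : RSpace d → ℂ} {T : 𝓢'(RSpace d, ℂ)}
    (hf : LocallyIntegrable f volume) (hT : ∀ φ, T φ = ∫ x, φ x * f x) {M : ℝ≥0}
    (h : ∀ ψ : 𝓢(RSpace d, ℂ), ‖(𝓕 T) ψ‖ₑ ≤ M * eLpNorm (negHalfWeight ψ) 2 volume) :
    homSobolevNorm (1 / 2) f ≤ M := by
  let l : 𝓢(RSpace d, ℂ) →ₗ[ℂ] ℂ :=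
    { toFun := fun ψ => (𝓕 T) ψ
      map_add' := fun ψ φ => map_add _ ψ φ
      map_smul' := fun c ψ => map_smul _ c ψ }
  obtain ⟨g, hgl, hgT, hgM⟩ := exists_eq_integral_of_norm_le hd l h
  have hfT : IsGivenBy T f := ⟨hf, fun φ _ => hT φ⟩
  have hgT' : IsGivenBy (𝓕 T) g := ⟨hgl, fun φ _ => hgT φ⟩
  refine le_trans ?_ hgM
  exact iInf_le_of_le T (iInf_le_of_le g (iInf_le_of_le hfT (iInf_le_of_le hgT' le_rfl)))

/-- A function vanishing at infinity with finite Gagliardo seminorms is in `Ḣ^{1/2}(ℝ³)`. -/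
theorem exists_homSobolevNorm_sq_le : ∃ C : ℝ≥0, ∀ f : RSpace 3 → ℂ, Measurable f →
    VanishesAtInfinity f → gagH f < ⊤ → gagV f < ⊤ →
      homSobolevNorm (1 / 2) f ^ 2 ≤ C * (gagH f + gagV f) := by
  obtain ⟨C, hC⟩ := exists_eLpNorm_halfWeight_sq_le
  refine ⟨C, fun f hf hv hH hV => ?_⟩
  obtain ⟨M, hM⟩ : ∃ M : ℝ≥0, (M : ℝ≥0∞) ^ 2 = C * (gagH f + gagV f) := by
    refine ⟨((C * (gagH f + gagV f)) ^ (1 / 2 : ℝ)).toNNReal, ?_⟩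
    have ht : C * (gagH f + gagV f) ≠ ⊤ :=
      ENNReal.mul_ne_top ENNReal.coe_ne_top (ENNReal.add_ne_top.2 ⟨hH.ne, hV.ne⟩)
    rw [ENNReal.coe_toNNReal (ENNReal.rpow_ne_top_of_nonneg (by norm_num) ht),
      ← ENNReal.rpow_two, ← ENNReal.rpow_mul]
    norm_num
  set ε : ℕ → ℝ := fun n => 1 / ((n : ℝ) + 1) with hε
  have hε0 : ∀ n, 0 < ε n := fun n => by positivity
  have hmem : ∀ n, MemLp (fun x => softThreshold (ε n) (f x)) 2 volume := fun n =>
    hv.memLp_softThreshold hf (hε0 n)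
  -- Splitting `f` at one threshold into bounded plus square integrable shows that it is a tempered
  -- distribution.
  have hbdd : MemLp (fun x => f x - softThreshold (ε 0) (f x)) ⊤ volume :=
    memLp_top_of_bound (hf.sub ((measurable_softThreshold _).comp hf)).aestronglyMeasurable (ε 0)
      (Filter.Eventually.of_forall fun x => norm_sub_softThreshold_le (hε0 0).le _)
  have hsum : ∀ x, (f x - softThreshold (ε 0) (f x)) + softThreshold (ε 0) (f x) = f x :=
    fun x => sub_add_cancel _ _
  obtain ⟨T, hT⟩ := exists_temperedDistribution_eq_integral hbdd (hmem 0)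
  simp only [hsum] at hT
  have hint : ∀ ψ : 𝓢(RSpace 3, ℂ), Integrable fun x => ψ x * f x := fun ψ => by
    have := (hbdd.integrable_schwartz_mul le_top ψ).add
      ((hmem 0).integrable_schwartz_mul (by norm_num) ψ)
    refine this.congr (Filter.Eventually.of_forall fun x => ?_)
    simp only [Pi.add_apply, ← mul_add, hsum]
  have hloc : LocallyIntegrable f volume :=
    ((hbdd.locallyIntegrable le_top).add ((hmem 0).locallyIntegrable (by norm_num))).congr
      (Filter.Eventually.of_forall hsum)
  choose g hg hp _ using fun n => exists_isFourierPair_of_memLp (hmem n)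
  have hgM : ∀ n, eLpNorm (halfWeight (g n)) 2 volume ≤ M := fun n => by
    refine (ENNReal.pow_le_pow_left_iff two_ne_zero).1 ((hC _ _ (hmem n) (hp n)).trans ?_)
    rw [hM]
    gcongr
    · exact dirGagliardo_softThreshold_le _ _ (hε0 n).le
    · exact dirGagliardo_softThreshold_le _ _ (hε0 n).le
  -- The bound holds for every threshold with the same `M`, and the pairings converge as the
  -- threshold tends to `0`.
  have hbound : ∀ ψ : 𝓢(RSpace 3, ℂ), ‖(𝓕 T) ψ‖ₑ ≤ M * eLpNorm (negHalfWeight ψ) 2 volume := by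
    intro ψ
    have hn : ∀ n, ‖∫ x, (𝓕 ψ) x * softThreshold (ε n) (f x)‖ₑ ≤
        M * eLpNorm (negHalfWeight ψ) 2 volume := fun n => by
      rw [(hp n).integral_eq]
      exact (enorm_integral_mul_le (by norm_num) ψ (hg n).1).trans (mul_le_mul' (hgM n) le_rfl)
    have hlim := tendsto_integral_mul_softThreshold hf (fun ψ => hint ψ) (𝓕 ψ)
    rw [TemperedDistribution.fourier_apply, hT]
    exact le_of_tendsto' ((continuous_enorm.tendsto _).comp hlim) hn
  rw [← hM]
  gcongr
  exact homSobolevNorm_le (by norm_num) hloc hT hbound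

/-! ### Assembling the product law -/

lemma homSobolevNorm_half_zero {d : ℕ} (hd : 2 ≤ d) :
    homSobolevNorm (1 / 2) (fun _ : RSpace d => (0 : ℂ)) = 0 := by
  have h := homSobolevNorm_le hd (f := fun _ => 0) (T := 0) (M := 0)
    (locallyIntegrable_const 0) (fun φ => by simp) fun ψ => by
      rw [TemperedDistribution.fourier_apply]
      simp
  simpa using h

/-- The threshold `ε` for the product becomes `ε/(B+1)` for `a`; `B + 1` avoids dividing by zero. -/
lemma VanishesAtInfinity.mul {α : Type*} [MeasureSpace α] {a b : α → ℂ}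
    (ha : VanishesAtInfinity a) {B : ℝ≥0∞} (hB : B ≠ ⊤) (hb : ∀ x, ‖b x‖ₑ ≤ B) :
    VanishesAtInfinity fun x => a x * b x := by
  intro ε hε
  have h0 : B + 1 ≠ 0 := by simp
  have ht : B + 1 ≠ ⊤ := by finiteness
  have hpt : ∀ x, (‖a x * b x‖ₑ - ε) ^ 2 ≤ (B + 1) ^ 2 * (‖a x‖ₑ - ε / (B + 1)) ^ 2 := fun x => by
    rw [← mul_pow, ENNReal.mul_sub (fun _ _ => ht), ENNReal.mul_div_cancel h0 ht, enorm_mul,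
      mul_comm]
    gcongr
    exact (hb x).trans le_self_add
  refine (lintegral_mono hpt).trans_lt ?_
  rw [lintegral_const_mul' _ _ (by finiteness)]
  exact ENNReal.mul_lt_top (by finiteness) (ha _ (ENNReal.div_pos hε.ne' ht))

lemma exists_gagH_add_gagV_le : ∃ C : ℝ≥0, ∀ f : RSpace 3 → ℂ,
    gagH f + gagV f ≤ C * homSobolevNorm (1 / 2) f ^ 2 := by
  obtain ⟨C₁, h₁⟩ := exists_gagH_le
  obtain ⟨C₂, h₂⟩ := exists_gagV_le
  refine ⟨C₁ + C₂ + 1, fun f => le_mul_homSobolevNorm_pow (by positivity) two_ne_zero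
    fun T g hT hg hw => ?_⟩
  have hp := hT.isFourierPair hg hw
  refine (add_le_add (h₁ hp hw) (h₂ hp hw)).trans ?_
  rw [← add_mul]
  gcongr
  push_cast
  exact le_self_add

/-- Almost every slice has zero energy, hence zero `L⁴` norm by the planar embedding;
`VanishesAtInfinity` is what excludes constants. -/
lemma ae_eq_zero_of_gagH_eq_zero {f : RSpace 3 → ℂ} (hf : Measurable f)
    (hv : VanishesAtInfinity f) (h : gagH f = 0) : f =ᵐ[volume] 0 := by
  obtain ⟨C, hC⟩ := exists_lintegral_pow_four_le_gagliardo
  have h4 : ∫⁻ x, ‖f x‖ₑ ^ 4 = 0 := by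
    rw [lintegral_eq_lintegral_joinHV (by fun_prop)]
    have hm : Measurable fun x3 : ℝ => gagliardo fun xh => f (joinHV xh x3) :=
      Measurable.lintegral_prod_right' (f := fun q : ℝ × RSpace 2 => gagKernel q.2 *
        ∫⁻ xh, ‖f (joinHV (xh + q.2) q.1) - f (joinHV xh q.1)‖ₑ ^ 2)
        ((measurable_gagKernel.comp measurable_snd).mul (Measurable.lintegral_prod_right'
          (f := fun r : (ℝ × RSpace 2) × RSpace 2 =>
            ‖f (joinHV (r.2 + r.1.2) r.1.1) - f (joinHV r.2 r.1.1)‖ₑ ^ 2) (by fun_prop)))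
    rw [gagH_eq_lintegral hf, lintegral_eq_zero_iff hm] at h
    refine le_antisymm ?_ zero_le
    rw [← lintegral_zero (μ := (volume : Measure ℝ))]
    refine lintegral_mono_ae ?_
    filter_upwards [h, hv.ae_slice hf] with x3 h1 h2
    refine (hC (fun xh => f (joinHV xh x3)) (by fun_prop) h2).trans ?_
    rw [h1]
    simp
  rw [lintegral_eq_zero_iff (by fun_prop)] at h4
  filter_upwards [h4] with x hx
  simpa using hx

lemma eq_zero_of_homSobolevNorm_eq_zero {f : RSpace 3 → ℂ} (hf : Continuous f)
    (h : homSobolevNorm (1 / 2) f = 0) : f = 0 := by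
  obtain ⟨g, hp, hw⟩ := exists_isFourierPair_of_homSobolevNorm_lt_top (h.trans_lt ENNReal.zero_lt_top)
  obtain ⟨C, hC⟩ := exists_gagH_add_gagV_le
  have h1 := hC f
  rw [h, zero_pow two_ne_zero, mul_zero, nonpos_iff_eq_zero, add_eq_zero] at h1
  exact Continuous.ae_eq_iff_eq volume hf continuous_zero |>.1
    (ae_eq_zero_of_gagH_eq_zero hf.measurable (hp.vanishesAtInfinity hw) h1.1)

/-- The set where the bound holds is closed and of full measure, hence dense. It turns the essential
supremum of `b` into a bound at every point. -/
lemma Continuous.enorm_le_eLpNorm_top {X F : Type*} [TopologicalSpace X] [MeasurableSpace X]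
    [NormedAddCommGroup F] {μ : Measure X} [μ.IsOpenPosMeasure] {f : X → F} (hf : Continuous f)
    (x : X) : ‖f x‖ₑ ≤ eLpNorm f ⊤ μ := by
  have hd := Measure.dense_of_ae (ae_le_eLpNormEssSup (f := f) (μ := μ))
  have hc : IsClosed {x | ‖f x‖ₑ ≤ eLpNormEssSup f μ} :=
    isClosed_le hf.enorm continuous_const
  rw [eLpNorm_exponent_top]
  have hx : x ∈ closure {x | ‖f x‖ₑ ≤ eLpNormEssSup f μ} := hd x
  rwa [hc.closure_eq] at hx

lemma gradSq_slice_eq {b : RSpace 3 → ℂ} (hb : Differentiable ℝ b) (x3 : ℝ) :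
    gradSq (fun xh => b (joinHV xh x3)) =
      eLpNorm (fun xh => horGrad b (joinHV xh x3)) 2 volume ^ 2 := by
  have hd : ∀ xh z, fderiv ℝ (fun xh => b (joinHV xh x3)) xh z =
      fderiv ℝ b (joinHV xh x3) (horEmbed z) := fun xh z => by
    simp only [joinHV_eq_add]
    have h1 : HasFDerivAt (fun xh : RSpace 2 => horEmbed xh + vertEmbed x3) horEmbed xh :=
      horEmbed.hasFDerivAt.add_const _
    have h2 := (hb (horEmbed xh + vertEmbed x3)).hasFDerivAt.comp xh h1
    exact congrArg (fun L => L z) h2.fderiv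
  have e0 : horEmbed (EuclideanSpace.single 0 1) = EuclideanSpace.single 0 1 := by
    rw [horEmbed_apply]
    ext i
    fin_cases i <;> simp [joinHV]
  have e1 : horEmbed (EuclideanSpace.single 1 1) = EuclideanSpace.single 1 1 := by
    rw [horEmbed_apply]
    ext i
    fin_cases i <;> simp [joinHV]
  rw [eLpNorm_two_sq, gradSq]
  refine lintegral_congr fun xh => ?_
  rw [hd, hd, e0, e1, horGrad, ← ofReal_norm, ← ofReal_norm, ← ofReal_norm,
    ← ENNReal.ofReal_pow (norm_nonneg _), ← ENNReal.ofReal_pow (norm_nonneg _),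
    ← ENNReal.ofReal_pow (norm_nonneg _), ← ENNReal.ofReal_add (by positivity) (by positivity),
    EuclideanSpace.norm_sq_eq]
  simp [partialDeriv3]

lemma ae_gradSq_slice_le {b : RSpace 3 → ℂ} (hb : Differentiable ℝ b) :
    ∀ᵐ x3 : ℝ, gradSq (fun xh => b (joinHV xh x3)) ≤
      vertHorNorm ⊤ (fun u => eLpNorm u 2 volume) (horGrad b) ^ 2 := by
  rw [vertHorNorm, eLpNorm_exponent_top]
  filter_upwards [ae_le_eLpNormEssSup (μ := (volume : Measure ℝ))
    (f := fun x3 : ℝ => eLpNorm (fun xh => horGrad b (joinHV xh x3)) 2 volume)] with x3 h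
  rw [gradSq_slice_eq hb]
  gcongr
  simpa using h

/-- The square root turns the fourth-power embedding on each slice into the square that the `L²`
norm in `x_3` integrates. -/
lemma exists_lintegral_slice_le : ∃ C : ℝ≥0, ∀ p : RSpace 3 → ℂ, Measurable p →
    ∫⁻ s : ℝ, (∫⁻ xh, ‖p (joinHV xh s)‖ₑ ^ 4) ^ (1 / 2 : ℝ) ≤
      C * vertHorNorm 2 (homSobolevNorm (1 / 2)) p ^ 2 := by
  obtain ⟨C, hC⟩ := exists_lintegral_pow_four_le_homSobolevNorm
  have ht : (C : ℝ≥0∞) ^ (1 / 2 : ℝ) ≠ ⊤ :=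
    ENNReal.rpow_ne_top_of_nonneg (by norm_num) ENNReal.coe_ne_top
  refine ⟨((C : ℝ≥0∞) ^ (1 / 2 : ℝ)).toNNReal, fun p hp => ?_⟩
  rw [ENNReal.coe_toNNReal ht, vertHorNorm, eLpNorm_two_sq, ← lintegral_const_mul' _ _ ht]
  refine lintegral_mono fun s => ?_
  refine (ENNReal.rpow_le_rpow (hC (fun xh => p (joinHV xh s)) (by fun_prop))
    (by norm_num : (0 : ℝ) ≤ 1 / 2)).trans (le_of_eq ?_)
  rw [ENNReal.mul_rpow_of_nonneg _ _ (by norm_num), ← ENNReal.rpow_natCast _ 4,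
    ← ENNReal.rpow_mul, ← ENNReal.rpow_two]
  norm_num

/-- The product law, when all the norms are finite. -/
theorem exists_homSobolevNorm_mul_sq_le : ∃ K : ℝ≥0, ∀ a b : RSpace 3 → ℂ, Continuous a →
    ContDiff ℝ 1 b → homSobolevNorm (1 / 2) a < ⊤ → ∀ S : ℝ≥0∞, S < ⊤ →
      vertHorNorm ⊤ (fun u => eLpNorm u 2 volume) (horGrad b) ≤ S → eLpNorm b ⊤ volume ≤ S →
      vertHorNorm 2 (homSobolevNorm (1 / 2)) (partialDeriv3 2 b) ≤ S →
        homSobolevNorm (1 / 2) (fun x => a x * b x) ^ 2 ≤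
          K * (homSobolevNorm (1 / 2) a * S) ^ 2 := by
  obtain ⟨C₁, h₁⟩ := exists_gagH_mul_le
  obtain ⟨C₂, h₂⟩ := exists_gagV_mul_le
  obtain ⟨C₃, h₃⟩ := exists_gagH_add_gagV_le
  obtain ⟨C₄, h₄⟩ := exists_lintegral_slice_le
  obtain ⟨C₅, h₅⟩ := exists_homSobolevNorm_sq_le
  refine ⟨C₅ * (2 * C₁ * C₃ + C₂ * (C₃ + C₃ * C₄)), fun a b ha hb hN S hS hS₁ hS₂ hS₃ => ?_⟩
  obtain ⟨g, hp, hw⟩ := exists_isFourierPair_of_homSobolevNorm_lt_top hN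
  have hav := hp.vanishesAtInfinity hw
  have hbS : ∀ x, ‖b x‖ₑ ≤ S := fun x => (hb.continuous.enorm_le_eLpNorm_top x).trans hS₂
  set N := homSobolevNorm (1 / 2) a with hNdef
  have hH : gagH a ≤ C₃ * N ^ 2 := le_self_add.trans (h₃ a)
  have hV : gagV a ≤ C₃ * N ^ 2 := le_add_self.trans (h₃ a)
  have gH : gagH (fun x => a x * b x) ≤ C₁ * (S ^ 2 + S ^ 2) * (C₃ * N ^ 2) := by
    refine (h₁ a b ha.measurable hav hb S (S ^ 2) hbS (ENNReal.pow_lt_top hS) ?_).trans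
      (mul_le_mul' le_rfl hH)
    filter_upwards [ae_gradSq_slice_le (hb.differentiable one_ne_zero)] with x3 h
    exact h.trans (by gcongr)
  have gV : gagV (fun x => a x * b x) ≤
      C₂ * (S ^ 2 * (C₃ * N ^ 2) + C₃ * N ^ 2 * (C₄ * S ^ 2)) := by
    refine (h₂ a b ha.measurable hav hb S hbS).trans ?_
    gcongr
    exact (h₄ _ (continuous_partialDeriv3 hb 2).measurable).trans (by gcongr)
  refine (h₅ _ (ha.mul hb.continuous).measurable (hav.mul hS.ne hbS)
    (gH.trans_lt (by finiteness)) (gV.trans_lt (by finiteness))).trans ?_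
  calc _ ≤ C₅ * (C₁ * (S ^ 2 + S ^ 2) * (C₃ * N ^ 2) +
        C₂ * (S ^ 2 * (C₃ * N ^ 2) + C₃ * N ^ 2 * (C₄ * S ^ 2))) :=
        mul_le_mul' le_rfl (add_le_add gH gV)
    _ = _ := by
        push_cast
        ring

theorem mainTheorem7 :
    ∃ C : ℝ≥0, ∀ a b : RSpace 3 → ℂ,
      ContDiff ℝ (⊤ : ℕ∞) a → ContDiff ℝ (⊤ : ℕ∞) b →
        homSobolevNorm (1 / 2) (fun x => a x * b x) ≤
          (C : ℝ≥0∞) * homSobolevNorm (1 / 2) a *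
            (vertHorNorm ⊤ (fun u => eLpNorm u 2 volume) (horGrad b)
              + eLpNorm b ⊤ volume
              + vertHorNorm 2 (homSobolevNorm (1 / 2)) (partialDeriv3 2 b)) := by
  obtain ⟨K, hK⟩ := exists_homSobolevNorm_mul_sq_le
  -- `K + 1` serves as a square root of `K`, since `K ≤ (K + 1)²`, and is nonzero for the infinite
  -- cases.
  refine ⟨K + 1, fun a b ha hb => ?_⟩
  set S := vertHorNorm ⊤ (fun u => eLpNorm u 2 volume) (horGrad b) + eLpNorm b ⊤ volume +
    vertHorNorm 2 (homSobolevNorm (1 / 2)) (partialDeriv3 2 b) with hS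
  have hz := homSobolevNorm_half_zero (d := 3) (by norm_num)
  -- Under `0·∞ = 0`, a vanishing factor must force `ab = 0` even when the other is infinite:
  -- continuity gives `a = 0`, respectively `b = 0`, everywhere.
  rcases eq_or_ne (homSobolevNorm (1 / 2) a) 0 with hN0 | hN0
  · have ha0 := eq_zero_of_homSobolevNorm_eq_zero ha.continuous hN0
    simp only [ha0, Pi.zero_apply, zero_mul, hz, zero_le]
  rcases eq_or_ne S 0 with hS0 | hS0
  · have hB : eLpNorm b ⊤ volume = 0 := by
      rw [hS, add_eq_zero, add_eq_zero] at hS0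
      exact hS0.1.2
    have hb0 : ∀ x, b x = 0 := fun x => by
      have := hb.continuous.enorm_le_eLpNorm_top (μ := volume) x
      simpa [hB] using this
    simp only [hb0, mul_zero, hz, zero_le]
  have hC0 : ((K + 1 : ℝ≥0) : ℝ≥0∞) ≠ 0 := by simp
  rcases eq_or_ne (homSobolevNorm (1 / 2) a) ⊤ with hNt | hNt
  · rw [hNt, ENNReal.mul_top hC0, ENNReal.top_mul hS0]
    exact le_top
  rcases eq_or_ne S ⊤ with hSt | hSt
  · rw [hSt, ENNReal.mul_top (mul_ne_zero hC0 hN0)]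
    exact le_top
  refine (ENNReal.pow_le_pow_left_iff two_ne_zero).1 ((hK a b ha.continuous
    (hb.of_le (by simp)) hNt.lt_top S hSt.lt_top (le_self_add.trans le_self_add)
    (le_add_self.trans le_self_add) le_add_self).trans ?_)
  rw [mul_assoc, mul_pow _ (_ * _)]
  gcongr
  push_cast
  calc (K : ℝ≥0∞) ≤ K + (K ^ 2 + K + 1) := le_self_add
    _ = _ := by ring

end
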